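/- Let $\mathfrak g$ be a finite-dimensional simple complex Lie algebra with Killing form $k$, let $\mathfrak h\subset\mathfrak b\subset\mathfrak g$ be a Cartan subalgebra and a Borel subalgebra, let $R\subset\mathfrak h^\star$ be the set of roots and $R^+$ the set of roots of $\mathfrak b$. Let $\widehat{\mathfrak g}=\mathfrak g\otimes\mathbb C[t,t^{-1}]\oplus\mathbb CK\oplus\mathbb CD$ be the affine Kac–Moody algebra, with $[x\otimes t^n,y\otimes t^m]=[x,y]\otimes t^{n+m}+n\delta_{m,-n}k(x,y)K$, $K$ central and $[D,x\otimes t^n]=n\,x\otimes t^n$. Put $\widehat{\mathfrak h}=\mathfrak h\oplus\mathbb CK\oplus\mathbb CD$ and $\widehat{\mathfrak b}=\mathfrak g\otimes t\mathbb C[t]\oplus\mathfrak b\oplus\mathbb CK\oplus\mathbb CD$. View $\mathfrak h^\star\subset\widehat{\mathfrak h}^\star$ via the projection $\widehat{\mathfrak h}\to\mathfrak h$, and let $\delta\in\widehat{\mathfrak h}^\star$ be zero on $\mathfrak h\oplus\mathbb CK$ with $\delta(D)=1$. For $\lambda,\mu\in\widehat{\mathfrak h}^\star$ write $\mu\le\lambda$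 if $\lambda-\mu$ is a (possibly empty) sum of elements of $\widehat R^+=R^+\cup\{\alpha+n\delta\mid\alpha\in R,\ n>0\}\cup\{n\delta\mid n>0\}$. A subset $\mathcal J\subset\widehat{\mathfrak h}^\star$ is *open* if $\lambda\in\mathcal J$ and $\mu\le\lambda$ imply $\mu\in\mathcal J$, and *locally bounded* if $\{\gamma\in\mathcal J\mid\gamma\ge\mu\}$ is finite for every $\mu\in\widehat{\mathfrak h}^\star$. A *local deformation algebra* is a commutative, Noetherian, local algebra $A$ over the symmetric algebra $S(\mathfrak h)$. Let $\mathbb K$ be its residue field and $\tau\colon\widehat{\mathfrak h}\to A$ the linear map given on $\mathfrak h$ by the $S(\mathfrak h)$-algebra structure, with $\tau(K)=\tau(D)=0$. A $\widehat{\mathfrak g}_A$-module is an $A$-module with an $A$-linear action of $\widehat{\mathfrak g}$. Its weight spaces are $M_\lambda=\{m\in M\mid Hm=(\lambda(H)+\tau(H))m\ \text{for all }H\in\widehat{\mathfrak h}\}$. The category $\widehat{\mathcal O}_A$ is the full subcategory of those $\widehat{\mathfrak g}_A$-modules $M$ such that $M=\bigoplus_{\lambda\in\widehat{\mathfrak h}^\star}M_\lambda$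 and every element of $M$ lies in a $\widehat{\mathfrak b}$-stable, finitely generated $A$-submodule. For $\mathcal J\subset\widehat{\mathfrak h}^\star$, the category $\widehat{\mathcal O}_A^{\mathcal J}$ is the full subcategory of those objects with $M_\lambda\ne0$ only for $\lambda\in\mathcal J$. The same definitions apply to $\mathbb K$, as an $S(\mathfrak h)$-algebra via $A\to\mathbb K$. The module $L_A(\mu)$ is the simple quotient of the Verma module $\Delta_{\mathbb K}(\mu)=U(\widehat{\mathfrak g})\otimes_{U(\widehat{\mathfrak b})}\mathbb K_\mu$, where $\widehat{\mathfrak h}$ acts on the one-dimensional $\mathbb K$-vector space $\mathbb K_\mu$ by $\mu+\tau$ and $[\widehat{\mathfrak b},\widehat{\mathfrak b}]$ acts by zero, regarded as a $\widehat{\mathfrak g}_A$-module via $A\to\mathbb K$. **Theorem.** Let $A$ be a local deformation algebra, $\mathcal J\subset\widehat{\mathfrak h}^\star$ an open, locally bounded subset, and $\mu\in\mathcal J$. Then $L_A(\mu)$ has a projective cover $c\colon P_A^{\mathcal J}(\mu)\to L_A(\mu)$ in $\widehat{\mathcal O}_A^{\mathcal J}$. That is, $P_A^{\mathcal J}(\mu)$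 is a projective object of $\widehat{\mathcal O}_A^{\mathcal J}$, $c$ is a surjective homomorphism, and every homomorphism $g\colon M\to P_A^{\mathcal J}(\mu)$ from an object $M$ of $\widehat{\mathcal O}_A^{\mathcal J}$ such that $c\circ g$ is surjective is itself surjective. -/

import Mathlib

open scoped TensorProduct

universe u v w w₁ w₂

noncomputable section

set_option linter.unusedSectionVars false

namespace AffineO

/-! ### The affine Kac-Moody algebra -/

section Affine

variable (𝔤 : Type v) [LieRing 𝔤] [LieAlgebra ℂ 𝔤]

/-- The underlying space of the loop algebra `𝔤 ⊗ ℂ[t,t⁻¹]`; the element `x ⊗ tⁿ` is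
`Finsupp.single n x`. -/
abbrev Loop : Type v := ℤ →₀ 𝔤

variable {𝔤} in
/-- The bilinear map on the loop algebra with `(x ⊗ tⁿ, y ⊗ tᵐ) ↦ B n m x y`. -/
def Loop.bilin {V : Type*} [AddCommGroup V] [Module ℂ V] (B : ℤ → ℤ → 𝔤 →ₗ[ℂ] 𝔤 →ₗ[ℂ] V) :
    Loop 𝔤 →ₗ[ℂ] Loop 𝔤 →ₗ[ℂ] V :=
  Finsupp.lsum ℂ fun n => LinearMap.flip (Finsupp.lsum ℂ fun m => (B n m).flip)

/-- The bracket of the loop algebra, `[x ⊗ tⁿ, y ⊗ tᵐ] = [x, y] ⊗ tⁿ⁺ᵐ`. -/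
def Loop.br : Loop 𝔤 →ₗ[ℂ] Loop 𝔤 →ₗ[ℂ] Loop 𝔤 :=
  Loop.bilin fun n m => (LinearMap.mk₂ ℂ (fun x y : 𝔤 => ⁅x, y⁆)
    add_lie smul_lie lie_add lie_smul).compr₂ (Finsupp.lsingle (n + m))

/-- The derivation `t d/dt` of the loop algebra, `x ⊗ tⁿ ↦ n x ⊗ tⁿ`. -/
def Loop.euler : Loop 𝔤 →ₗ[ℂ] Loop 𝔤 :=
  Finsupp.lsum ℂ fun n : ℤ => (n : ℂ) • Finsupp.lsingle n

/-- The cocycle `(x ⊗ tⁿ, y ⊗ tᵐ) ↦ n δ_{m,-n} k(x,y)`, with `k` the Killing form. -/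
def Loop.cocycle : Loop 𝔤 →ₗ[ℂ] Loop 𝔤 →ₗ[ℂ] ℂ :=
  Loop.bilin fun n m => if m = -n then (n : ℂ) • killingForm ℂ 𝔤 else 0

variable {𝔤}

@[simp] lemma Loop.bilin_single {V : Type*} [AddCommGroup V] [Module ℂ V]
    (B : ℤ → ℤ → 𝔤 →ₗ[ℂ] 𝔤 →ₗ[ℂ] V) (n m : ℤ) (x y : 𝔤) :
    Loop.bilin B (Finsupp.single n x) (Finsupp.single m y) = B n m x y := by
  simp [Loop.bilin]

@[simp] lemma Loop.br_single (n m : ℤ) (x y : 𝔤) :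
    Loop.br 𝔤 (Finsupp.single n x) (Finsupp.single m y) = Finsupp.single (n + m) ⁅x, y⁆ := by
  simp [Loop.br]

@[simp] lemma Loop.euler_single (n : ℤ) (x : 𝔤) :
    Loop.euler 𝔤 (Finsupp.single n x) = (n : ℂ) • Finsupp.single n x := by
  simp [Loop.euler]

@[simp] lemma Loop.cocycle_single (n m : ℤ) (x y : 𝔤) :
    Loop.cocycle 𝔤 (Finsupp.single n x) (Finsupp.single m y) =
      if m = -n then (n : ℂ) * killingForm ℂ 𝔤 x y else 0 := by
  simp only [Loop.cocycle, Loop.bilin_single]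
  split_ifs <;> simp

lemma Loop.euler_apply (f : Loop 𝔤) (k : ℤ) : Loop.euler 𝔤 f k = (k : ℂ) • f k := by
  classical
  induction f using Finsupp.induction_linear with
  | zero => simp
  | add a b ha hb => simp [ha, hb]
  | single n x =>
    by_cases h : n = k
    · subst h; simp
    · simp [h]

lemma Loop.br_apply (f g : Loop 𝔤) (k : ℤ) : Loop.br 𝔤 f g k =
    ∑ n ∈ f.support, ∑ m ∈ g.support, if n + m = k then ⁅f n, g m⁆ else 0 := by
  classical
  conv_lhs => rw [← f.sum_single, ← g.sum_single]
  simp only [Finsupp.sum, map_sum, LinearMap.sum_apply, Loop.br_single, Finsupp.finsetSum_apply,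
    Finsupp.single_apply]
  exact Finset.sum_comm

lemma Loop.br_self (f : Loop 𝔤) : Loop.br 𝔤 f f = 0 := by
  have skew : ∀ f g : Loop 𝔤, Loop.br 𝔤 f g = - Loop.br 𝔤 g f := by
    intro f g
    induction f using Finsupp.induction_linear with
    | zero => simp
    | add a b ha hb => simp only [map_add, LinearMap.add_apply, ha, hb]; abel
    | single n x =>
      induction g using Finsupp.induction_linear with
      | zero => simp
      | add a b ha hb => simp only [map_add, LinearMap.add_apply, ha, hb]; abel
      | single m y =>
        rw [Loop.br_single, Loop.br_single, ← lie_skew, Finsupp.single_neg, add_comm]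
  have h : (2 : ℂ) • Loop.br 𝔤 f f = 0 := by
    rw [two_smul]
    nth_rewrite 1 [skew f f]
    exact neg_add_cancel _
  exact (smul_eq_zero.mp h).resolve_left two_ne_zero

lemma Loop.br_skew (f g : Loop 𝔤) : Loop.br 𝔤 f g = - Loop.br 𝔤 g f := by
  have := Loop.br_self (f + g)
  simp only [map_add, LinearMap.add_apply, Loop.br_self, zero_add, add_zero] at this
  exact eq_neg_of_add_eq_zero_right this

lemma Loop.br_br (f g h : Loop 𝔤) : Loop.br 𝔤 f (Loop.br 𝔤 g h) =
    Loop.br 𝔤 (Loop.br 𝔤 f g) h + Loop.br 𝔤 g (Loop.br 𝔤 f h) := by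
  induction f using Finsupp.induction_linear with
  | zero => simp
  | add a b ha hb => simp only [map_add, LinearMap.add_apply, ha, hb]; abel
  | single n x =>
    induction g using Finsupp.induction_linear with
    | zero => simp
    | add a b ha hb => simp only [map_add, LinearMap.add_apply, ha, hb]; abel
    | single m y =>
      induction h using Finsupp.induction_linear with
      | zero => simp
      | add a b ha hb => simp only [map_add, ha, hb]; abel
      | single p z =>
        simp only [Loop.br_single, leibniz_lie x y z, Finsupp.single_add, add_assoc,
          add_left_comm n m p]

lemma Loop.euler_br (f g : Loop 𝔤) : Loop.euler 𝔤 (Loop.br 𝔤 f g) =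
    Loop.br 𝔤 (Loop.euler 𝔤 f) g + Loop.br 𝔤 f (Loop.euler 𝔤 g) := by
  induction f using Finsupp.induction_linear with
  | zero => simp
  | add a b ha hb => simp only [map_add, LinearMap.add_apply, ha, hb]; abel
  | single n x =>
    induction g using Finsupp.induction_linear with
    | zero => simp
    | add a b ha hb => simp only [map_add, ha, hb]; abel
    | single m y =>
      simp only [Loop.br_single, Loop.euler_single, map_smul, LinearMap.smul_apply, ← add_smul]
      push_cast; rfl

lemma Loop.cocycle_skew (f g : Loop 𝔤) : Loop.cocycle 𝔤 f g = - Loop.cocycle 𝔤 g f := by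
  induction f using Finsupp.induction_linear with
  | zero => simp
  | add a b ha hb => simp only [map_add, LinearMap.add_apply, ha, hb]; abel
  | single n x =>
    induction g using Finsupp.induction_linear with
    | zero => simp
    | add a b ha hb => simp only [map_add, LinearMap.add_apply, ha, hb]; abel
    | single m y =>
      have : killingForm ℂ 𝔤 y x = killingForm ℂ 𝔤 x y := LieModule.traceForm_comm ..
      simp only [Loop.cocycle_single, this]
      by_cases h : m = -n
      · subst h; simp
      · rw [if_neg h, if_neg (by omega)]; simp

lemma Loop.cocycle_self (f : Loop 𝔤) : Loop.cocycle 𝔤 f f = 0 :=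
  self_eq_neg.mp (Loop.cocycle_skew f f)

lemma Loop.cocycle_euler (f g : Loop 𝔤) :
    Loop.cocycle 𝔤 (Loop.euler 𝔤 f) g + Loop.cocycle 𝔤 f (Loop.euler 𝔤 g) = 0 := by
  induction f using Finsupp.induction_linear with
  | zero => simp
  | add a b ha hb =>
    simp only [map_add, LinearMap.add_apply]
    linear_combination ha + hb
  | single n x =>
    induction g using Finsupp.induction_linear with
    | zero => simp
    | add a b ha hb =>
      simp only [map_add]
      linear_combination ha + hb
    | single m y =>
      simp only [Loop.euler_single, map_smul, LinearMap.smul_apply, Loop.cocycle_single,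
        smul_eq_mul]
      by_cases h : m = -n
      · subst h; simp
      · simp [h]

lemma Loop.cocycle_br (f g h : Loop 𝔤) : Loop.cocycle 𝔤 f (Loop.br 𝔤 g h) =
    Loop.cocycle 𝔤 (Loop.br 𝔤 f g) h + Loop.cocycle 𝔤 g (Loop.br 𝔤 f h) := by
  induction f using Finsupp.induction_linear with
  | zero => simp
  | add a b ha hb => simp only [map_add, LinearMap.add_apply, ha, hb]; abel
  | single n x =>
    induction g using Finsupp.induction_linear with
    | zero => simp
    | add a b ha hb => simp only [map_add, LinearMap.add_apply, ha, hb]; abel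
    | single m y =>
      induction h using Finsupp.induction_linear with
      | zero => simp
      | add a b ha hb => simp only [map_add, ha, hb]; abel
      | single p z =>
        have e1 : killingForm ℂ 𝔤 ⁅x, y⁆ z = killingForm ℂ 𝔤 x ⁅y, z⁆ :=
          LieModule.traceForm_apply_lie_apply ..
        have e2 : killingForm ℂ 𝔤 y ⁅x, z⁆ = - killingForm ℂ 𝔤 x ⁅y, z⁆ := by
          rw [← e1, ← lie_skew x y, map_neg, LinearMap.neg_apply, neg_neg]
          exact (LieModule.traceForm_apply_lie_apply ..).symm
        simp only [Loop.br_single, Loop.cocycle_single, e1, e2]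
        by_cases hs : n + m + p = 0
        · rw [if_pos (by omega), if_pos (by omega), if_pos (by omega)]
          push_cast; ring
        · rw [if_neg (by omega), if_neg (by omega), if_neg (by omega)]; simp

variable (𝔤) in
/-- The affine Kac-Moody algebra `(ℂ[t,t⁻¹] ⊗ 𝔤) ⊕ ℂK ⊕ ℂD`. -/
@[ext] structure Affine : Type v where
  /-- the component in the loop algebra -/
  loop : Loop 𝔤
  /-- the coefficient of the central element `K` -/
  central : ℂ
  /-- the coefficient of the derivation element `D` -/
  deg : ℂ

namespace Affine

/-- The underlying vector space is a direct sum. -/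
def equivProd : Affine 𝔤 ≃ Loop 𝔤 × ℂ × ℂ where
  toFun x := (x.loop, x.central, x.deg)
  invFun p := ⟨p.1, p.2.1, p.2.2⟩
  left_inv _ := rfl
  right_inv _ := rfl

instance : AddCommGroup (Affine 𝔤) := equivProd.addCommGroup

instance : Module ℂ (Affine 𝔤) := equivProd.module ℂ

@[simp] lemma loop_zero : (0 : Affine 𝔤).loop = 0 := rfl
@[simp] lemma central_zero : (0 : Affine 𝔤).central = 0 := rfl
@[simp] lemma deg_zero : (0 : Affine 𝔤).deg = 0 := rfl
@[simp] lemma loop_add (x y : Affine 𝔤) : (x + y).loop = x.loop + y.loop := rfl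
@[simp] lemma central_add (x y : Affine 𝔤) : (x + y).central = x.central + y.central := rfl
@[simp] lemma deg_add (x y : Affine 𝔤) : (x + y).deg = x.deg + y.deg := rfl
@[simp] lemma loop_smul (c : ℂ) (x : Affine 𝔤) : (c • x).loop = c • x.loop := rfl
@[simp] lemma central_smul (c : ℂ) (x : Affine 𝔤) : (c • x).central = c * x.central := rfl
@[simp] lemma deg_smul (c : ℂ) (x : Affine 𝔤) : (c • x).deg = c * x.deg := rfl

instance : Bracket (Affine 𝔤) (Affine 𝔤) where
  bracket x y :=
    ⟨Loop.br 𝔤 x.loop y.loop + x.deg • Loop.euler 𝔤 y.loop - y.deg • Loop.euler 𝔤 x.loop,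
      Loop.cocycle 𝔤 x.loop y.loop, 0⟩

@[simp] lemma loop_lie (x y : Affine 𝔤) : ⁅x, y⁆.loop =
    Loop.br 𝔤 x.loop y.loop + x.deg • Loop.euler 𝔤 y.loop - y.deg • Loop.euler 𝔤 x.loop := rfl
@[simp] lemma central_lie (x y : Affine 𝔤) :
    ⁅x, y⁆.central = Loop.cocycle 𝔤 x.loop y.loop := rfl
@[simp] lemma deg_lie (x y : Affine 𝔤) : ⁅x, y⁆.deg = 0 := rfl

instance : LieRing (Affine 𝔤) where
  add_lie x y z := by
    ext1
    · simp only [loop_lie, loop_add, deg_add, map_add, LinearMap.add_apply, add_smul, smul_add]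
      abel
    · simp
    · simp
  lie_add x y z := by
    ext1
    · simp only [loop_lie, loop_add, deg_add, map_add, add_smul, smul_add]
      abel
    · simp
    · simp
  lie_self x := by
    ext1
    · simp [Loop.br_self]
    · simp [Loop.cocycle_self]
    · simp
  leibniz_lie x y z := by
    ext1
    · have h1 := Loop.br_br x.loop y.loop z.loop
      have h2 := Loop.br_skew (Loop.euler 𝔤 x.loop) y.loop
      simp only [loop_lie, loop_add, deg_lie, map_add, map_sub, map_smul, LinearMap.add_apply,
        LinearMap.sub_apply, LinearMap.smul_apply, Loop.euler_br, smul_add, smul_sub, zero_smul,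
        smul_smul, h1, h2]
      rw [mul_comm y.deg x.deg, mul_comm z.deg x.deg, mul_comm z.deg y.deg]
      simp only [smul_neg]
      abel
    · have h1 := Loop.cocycle_euler x.loop z.loop
      have h2 := Loop.cocycle_euler y.loop z.loop
      have h3 := Loop.cocycle_euler x.loop y.loop
      have h4 := Loop.cocycle_skew y.loop (Loop.euler 𝔤 x.loop)
      have h5 := Loop.cocycle_br x.loop y.loop z.loop
      simp only [loop_lie, central_lie, central_add, map_add, map_sub, map_smul,
        LinearMap.add_apply, LinearMap.sub_apply, LinearMap.smul_apply, smul_eq_mul]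
      linear_combination h5 + y.deg * h1 - x.deg * h2 - z.deg * h3 + z.deg * h4
    · simp

instance : LieAlgebra ℂ (Affine 𝔤) where
  lie_smul c x y := by
    ext1
    · simp [smul_sub, smul_add, smul_smul, mul_comm]
    · simp
    · simp

end Affine

end Affine

/-! ### Cartan and Borel subalgebras, roots and weights -/

section Weights

variable {𝔤 : Type v} [LieRing 𝔤] [LieAlgebra ℂ 𝔤]

/-- A Borel subalgebra is a maximal solvable subalgebra. -/
def IsBorel (𝔟 : LieSubalgebra ℂ 𝔤) : Prop :=
  Maximal (fun 𝔠 : LieSubalgebra ℂ 𝔤 => LieAlgebra.IsSolvable 𝔠) 𝔟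

/-- The affine Cartan subalgebra `𝔥 ⊕ ℂK ⊕ ℂD`. -/
abbrev CartanHat (H : LieSubalgebra ℂ 𝔤) : Type v := H × ℂ × ℂ

/-- The inclusion of the affine Cartan subalgebra into the affine Kac-Moody algebra. -/
def CartanHat.incl (H : LieSubalgebra ℂ 𝔤) : CartanHat H →ₗ[ℂ] Affine 𝔤 where
  toFun h := ⟨Finsupp.single 0 (h.1 : 𝔤), h.2.1, h.2.2⟩
  map_add' x y := by ext1 <;> simp
  map_smul' c x := by ext1 <;> simp

/-- The affine Borel subalgebra `(𝔤 ⊗ t ℂ[t]) ⊕ 𝔟 ⊕ ℂK ⊕ ℂD`. -/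
def borelHat (𝔟 : LieSubalgebra ℂ 𝔤) : LieSubalgebra ℂ (Affine 𝔤) where
  carrier := {x | (∀ n < 0, x.loop n = 0) ∧ x.loop 0 ∈ 𝔟}
  add_mem' {x y} hx hy :=
    ⟨fun n hn => by simp [hx.1 n hn, hy.1 n hn], by simpa using add_mem hx.2 hy.2⟩
  zero_mem' := by simp
  smul_mem' c x hx := ⟨fun n hn => by simp [hx.1 n hn], by simpa using 𝔟.smul_mem c hx.2⟩
  lie_mem' {x y} hx hy := by
    have h1 : ∀ k < 0, Loop.br 𝔤 x.loop y.loop k = 0 := by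
      intro k hk
      rw [Loop.br_apply]
      refine Finset.sum_eq_zero fun n _ => Finset.sum_eq_zero fun m _ => ?_
      split_ifs with h
      · rcases (by omega : n < 0 ∨ m < 0) with h' | h'
        · simp [hx.1 n h']
        · simp [hy.1 m h']
      · rfl
    have h2 : Loop.br 𝔤 x.loop y.loop 0 ∈ 𝔟 := by
      rw [Loop.br_apply]
      refine sum_mem fun n _ => sum_mem fun m _ => ?_
      split_ifs with h
      · rcases (by omega : n < 0 ∨ m < 0 ∨ (n = 0 ∧ m = 0)) with h' | h' | ⟨rfl, rfl⟩
        · simp [hx.1 n h']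
        · simp [hy.1 m h']
        · exact 𝔟.lie_mem hx.2 hy.2
      · exact zero_mem _
    exact ⟨fun n hn => by simp [Loop.euler_apply, h1 n hn, hx.1 n hn, hy.1 n hn],
      by simpa [Loop.euler_apply] using h2⟩

/-- The linear forms on the affine Cartan subalgebra. -/
abbrev Wt (H : LieSubalgebra ℂ 𝔤) : Type v := Module.Dual ℂ (CartanHat H)

variable (H : LieSubalgebra ℂ 𝔤)

/-- Linear forms on `𝔥` are viewed as linear forms on the affine Cartan subalgebra that vanish on
`K` and `D`. -/
def finWt (α : Module.Dual ℂ H) : Wt H := α ∘ₗ LinearMap.fst ℂ H (ℂ × ℂ)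

/-- The linear form `δ`, which vanishes on `𝔥 ⊕ ℂK` and takes the value `1` on `D`. -/
def delta : Wt H := LinearMap.snd ℂ ℂ ℂ ∘ₗ LinearMap.snd ℂ H (ℂ × ℂ)

/-- The roots of `𝔤` with respect to `𝔥`. -/
def roots [LieRing.IsNilpotent H] : Set (Module.Dual ℂ H) :=
  {α | α ≠ 0 ∧ LieAlgebra.rootSpace H (α : H → ℂ) ≠ ⊥}

/-- The positive roots, i.e. the roots of `𝔟`. -/
def posRoots [LieRing.IsNilpotent H] (𝔟 : LieSubalgebra ℂ 𝔤) : Set (Module.Dual ℂ H) :=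
  {α ∈ roots H | ∀ x ∈ LieAlgebra.rootSpace H (α : H → ℂ), x ∈ 𝔟}

/-- The positive affine roots. -/
def posAffineRoots [LieRing.IsNilpotent H] (𝔟 : LieSubalgebra ℂ 𝔤) : Set (Wt H) :=
  {β | (∃ α ∈ posRoots H 𝔟, β = finWt H α) ∨
    (∃ α ∈ roots H, ∃ n : ℕ, 0 < n ∧ β = finWt H α + n • delta H) ∨
    (∃ n : ℕ, 0 < n ∧ β = n • delta H)}

/-- The order on weights: `μ ≤ ν` if `ν - μ` is a sum of positive affine roots. -/
def WtLE [LieRing.IsNilpotent H] (𝔟 : LieSubalgebra ℂ 𝔤) (μ ν : Wt H) : Prop :=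
  ν - μ ∈ AddSubmonoid.closure (posAffineRoots H 𝔟)

/-- Open sets of weights: those closed downwards. -/
def IsOpenWt [LieRing.IsNilpotent H] (𝔟 : LieSubalgebra ℂ 𝔤) (J : Set (Wt H)) : Prop :=
  ∀ ν ∈ J, ∀ μ, WtLE H 𝔟 μ ν → μ ∈ J

/-- Locally bounded sets of weights. -/
def IsLocallyBounded [LieRing.IsNilpotent H] (𝔟 : LieSubalgebra ℂ 𝔤) (J : Set (Wt H)) : Prop :=
  ∀ μ, {γ ∈ J | WtLE H 𝔟 μ γ}.Finite

end Weights

/-! ### The deformed category `𝒪`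

A deformation algebra is a Noetherian commutative algebra over the symmetric algebra of `𝔥`.
A `ĝ_A`-module, i.e. an `A`-module with an `A`-linear action of the affine Kac-Moody algebra `ĝ`,
is a Lie module over the `A`-Lie algebra `A ⊗ ĝ`. -/

section Deformed

variable {𝔤 : Type v} [LieRing 𝔤] [LieAlgebra ℂ 𝔤] (H : LieSubalgebra ℂ 𝔤)
  (𝔟 : LieSubalgebra ℂ 𝔤)
  (A : Type u) [CommRing A] [Algebra ℂ A]

/-- The base change to `A` of the affine Kac-Moody algebra. -/
abbrev AffineOver (𝔤 : Type v) [LieRing 𝔤] [LieAlgebra ℂ 𝔤] (A : Type u) [CommRing A]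
    [Algebra ℂ A] : Type (max u v) := A ⊗[ℂ] Affine 𝔤

variable [Algebra (SymmetricAlgebra ℂ H) A] [IsScalarTower ℂ (SymmetricAlgebra ℂ H) A]

/-- The canonical map `τ` from the affine Cartan subalgebra to `A`; it kills `K` and `D`. -/
def tau : CartanHat H →ₗ[ℂ] A :=
  (IsScalarTower.toAlgHom ℂ (SymmetricAlgebra ℂ H) A).toLinearMap ∘ₗ
    SymmetricAlgebra.ι ℂ H ∘ₗ LinearMap.fst ℂ H (ℂ × ℂ)

/-- The `A`-valued character `ν + τ` of the affine Cartan subalgebra. -/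
def char (ν : Wt H) (h : CartanHat H) : A := algebraMap ℂ A (ν h) + tau H A h

section Modules

variable (M : Type w) [AddCommGroup M] [Module A M] [LieRingModule (AffineOver 𝔤 A) M]
  [LieModule A (AffineOver 𝔤 A) M]

/-- The weight space `M_ν`, on which the affine Cartan subalgebra acts by `ν + τ`. -/
def weightSpace (ν : Wt H) : Submodule A M where
  carrier := {m | ∀ h : CartanHat H, ⁅(1 : A) ⊗ₜ[ℂ] CartanHat.incl H h, m⁆ = char H A ν h • m}
  add_mem' {x y} hx hy h := by simp [hx h, hy h]
  zero_mem' h := by simp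
  smul_mem' c x hx h := by rw [lie_smul, hx h, smul_comm]

open Classical in
/-- `M` is a weight module: it is the direct sum of its weight spaces. -/
def IsWeightModule : Prop := DirectSum.IsInternal fun ν : Wt H => weightSpace H A M ν

/-- `M` is locally finite over the affine Borel subalgebra. -/
def IsLocallyBorelFinite : Prop :=
  ∀ m : M, ∃ N : Submodule A M, m ∈ N ∧ N.FG ∧
    ∀ x ∈ borelHat 𝔟, ∀ n ∈ N, ⁅(1 : A) ⊗ₜ[ℂ] x, n⁆ ∈ N

/-- `M` is an object of the deformed category `𝒪_A`. -/
structure InO : Prop where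
  isWeightModule : IsWeightModule H A M
  isLocallyBorelFinite : IsLocallyBorelFinite 𝔟 A M

/-- `M` is an object of the truncated deformed category `𝒪_A^J`. -/
structure InOJ (J : Set (Wt H)) : Prop extends InO H 𝔟 A M where
  weight_mem : ∀ ν, weightSpace H A M ν ≠ ⊥ → ν ∈ J

end Modules

/-! ### Verma modules and simple objects -/

/-- The left ideal of `U(ĝ_A)` generated by the elements `h - (ν + τ)(h)` for `h` in the affine
Cartan subalgebra and by the commutators of the affine Borel subalgebra. -/
def vermaIdeal (ν : Wt H) : Submodule (UniversalEnvelopingAlgebra A (AffineOver 𝔤 A))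
    (UniversalEnvelopingAlgebra A (AffineOver 𝔤 A)) :=
  Submodule.span _
    ({y | ∃ h : CartanHat H, y =
        UniversalEnvelopingAlgebra.ι A ((1 : A) ⊗ₜ[ℂ] CartanHat.incl H h) -
          algebraMap A _ (char H A ν h)} ∪
      {y | ∃ x ∈ borelHat 𝔟, ∃ x' ∈ borelHat 𝔟, y =
        UniversalEnvelopingAlgebra.ι A ((1 : A) ⊗ₜ[ℂ] ⁅x, x'⁆)})

/-- The deformed Verma module `Δ_A(ν) = U(ĝ) ⊗_{U(b̂)} A_ν`. Here `A_ν` is free of rank one over `A`,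
the affine Cartan subalgebra acts on it by `ν + τ`, and `[b̂, b̂]` acts by zero, so that the induced
module is the quotient of `U(ĝ_A)` by the left ideal generated by the annihilator relations. -/
def Verma (ν : Wt H) : Type (max u v) :=
  UniversalEnvelopingAlgebra A (AffineOver 𝔤 A) ⧸ vermaIdeal H 𝔟 A ν

namespace Verma

variable (ν : Wt H)

instance : AddCommGroup (Verma H 𝔟 A ν) :=
  inferInstanceAs (AddCommGroup (_ ⧸ vermaIdeal H 𝔟 A ν))

instance : Module (UniversalEnvelopingAlgebra A (AffineOver 𝔤 A)) (Verma H 𝔟 A ν) :=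
  inferInstanceAs (Module _ (_ ⧸ vermaIdeal H 𝔟 A ν))

instance : Module A (Verma H 𝔟 A ν) :=
  Module.compHom _ (algebraMap A (UniversalEnvelopingAlgebra A (AffineOver 𝔤 A)))

lemma smul_def (a : A) (m : Verma H 𝔟 A ν) :
    a • m = algebraMap A (UniversalEnvelopingAlgebra A (AffineOver 𝔤 A)) a • m := rfl

instance : LieRingModule (AffineOver 𝔤 A) (Verma H 𝔟 A ν) where
  bracket x m := UniversalEnvelopingAlgebra.ι A x • m
  add_lie x y m := by
    change UniversalEnvelopingAlgebra.ι A (x + y) • m = _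
    rw [map_add, add_smul]
  lie_add x m n := smul_add _ m n
  leibniz_lie x y m := by
    change UniversalEnvelopingAlgebra.ι A x • UniversalEnvelopingAlgebra.ι A y • m =
      UniversalEnvelopingAlgebra.ι A ⁅x, y⁆ • m +
        UniversalEnvelopingAlgebra.ι A y • UniversalEnvelopingAlgebra.ι A x • m
    let _ : LieRing (UniversalEnvelopingAlgebra A (AffineOver 𝔤 A)) := LieRing.ofAssociativeRing
    rw [LieHom.map_lie, LieRing.of_associative_ring_bracket, sub_smul, mul_smul, mul_smul]
    exact (sub_add_cancel _ _).symm

lemma lie_def (x : AffineOver 𝔤 A) (m : Verma H 𝔟 A ν) :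
    ⁅x, m⁆ = UniversalEnvelopingAlgebra.ι A x • m := rfl

instance : LieModule A (AffineOver 𝔤 A) (Verma H 𝔟 A ν) where
  smul_lie a x m := by
    rw [lie_def, lie_def, smul_def, map_smul, Algebra.smul_def, mul_smul]
  lie_smul a x m := by
    rw [lie_def, lie_def, smul_def, smul_def, ← mul_smul, ← mul_smul, Algebra.commutes]

end Verma

/-- The sum of all proper submodules of the Verma module. When `A` is a field this is its largest
proper submodule. -/
def vermaRad (ν : Wt H) : LieSubmodule A (AffineOver 𝔤 A) (Verma H 𝔟 A ν) :=
  sSup {N | N ≠ ⊤}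

end Deformed

section Simple

/-- A `ĝ_K`-module over the residue field `K` of a local deformation algebra `A`, viewed as a
`ĝ_A`-module on which `A` acts through the quotient map `A → K`. -/
def Res (A : Type u) (M : Type w) : Type w :=
  let _ := A
  M

variable (𝔤 : Type v) [LieRing 𝔤] [LieAlgebra ℂ 𝔤] (A : Type u) [CommRing A] [IsLocalRing A]
  [Algebra ℂ A]

/-- The Lie algebra homomorphism `ĝ_A → ĝ_K`. -/
def toResidue : AffineOver 𝔤 A →ₗ⁅ℂ⁆ AffineOver 𝔤 (IsLocalRing.ResidueField A) :=
  LieAlgebra.ExtendScalars.map (IsScalarTower.toAlgHom ℂ A (IsLocalRing.ResidueField A)) LieHom.id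

variable {𝔤} (M : Type w) [AddCommGroup M] [Module (IsLocalRing.ResidueField A) M]
  [LieRingModule (AffineOver 𝔤 (IsLocalRing.ResidueField A)) M]
  [LieModule (IsLocalRing.ResidueField A) (AffineOver 𝔤 (IsLocalRing.ResidueField A)) M]

instance : AddCommGroup (Res A M) := inferInstanceAs (AddCommGroup M)

instance : Module A (Res A M) :=
  let _ : Module (IsLocalRing.ResidueField A) (Res A M) :=
    inferInstanceAs (Module (IsLocalRing.ResidueField A) M)
  Module.compHom (Res A M) (IsLocalRing.residue A)

instance : LieRingModule (AffineOver 𝔤 A) (Res A M) :=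
  let _ : LieRingModule (AffineOver 𝔤 (IsLocalRing.ResidueField A)) (Res A M) :=
    inferInstanceAs (LieRingModule (AffineOver 𝔤 (IsLocalRing.ResidueField A)) M)
  LieRingModule.compLieHom (Res A M) (toResidue 𝔤 A)

lemma Res.smul_def (a : A) (m : M) :
    (a • (show Res A M from m) : Res A M) = (IsLocalRing.residue A a • m : M) := rfl

lemma Res.lie_def (x : AffineOver 𝔤 A) (m : M) :
    (⁅x, (show Res A M from m)⁆ : Res A M) = (⁅toResidue 𝔤 A x, m⁆ : M) := rfl

lemma toResidue_smul (a : A) (x : AffineOver 𝔤 A) :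
    toResidue 𝔤 A (a • x) = IsLocalRing.residue A a • toResidue 𝔤 A x := by
  induction x using TensorProduct.induction_on with
  | zero => simp
  | tmul b y =>
    simp [toResidue, TensorProduct.smul_tmul']
  | add x y hx hy => rw [smul_add, map_add, map_add, smul_add, hx, hy]

instance : LieModule A (AffineOver 𝔤 A) (Res A M) where
  smul_lie a x m := by
    have := smul_lie (IsLocalRing.residue A a) (toResidue 𝔤 A x) (show M from m)
    rw [← toResidue_smul] at this
    exact this
  lie_smul a x m := lie_smul (IsLocalRing.residue A a) (toResidue 𝔤 A x) (show M from m)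

variable (H 𝔟 : LieSubalgebra ℂ 𝔤)
  [Algebra (SymmetricAlgebra ℂ H) A] [IsScalarTower ℂ (SymmetricAlgebra ℂ H) A]

/-- The simple object `L_A(ν)` of `𝒪_A`: the simple quotient `L_K(ν)` of the Verma module `Δ_K(ν)`
over the residue field `K` of `A`, viewed as a `ĝ_A`-module. -/
abbrev Simple (ν : Wt H) : Type (max u v) :=
  Res A (Verma H 𝔟 (IsLocalRing.ResidueField A) ν ⧸ vermaRad H 𝔟 (IsLocalRing.ResidueField A) ν)

end Simple

/-! ### Projective covers -/

section Projective

variable {𝔤 : Type v} [LieRing 𝔤] [LieAlgebra ℂ 𝔤] (H 𝔟 : LieSubalgebra ℂ 𝔤)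
  (A : Type u) [CommRing A] [Algebra ℂ A]
  [Algebra (SymmetricAlgebra ℂ H) A] [IsScalarTower ℂ (SymmetricAlgebra ℂ H) A]
  (J : Set (Wt H))

/-- `P` is a projective object of `𝒪_A^J`: it is an object of `𝒪_A^J`, and every homomorphism from
`P` to an object `N` lifts along every surjective homomorphism of objects `M → N`. The objects `M`
and `N` range over the modules in `Type w`. -/
def IsProjectiveInOJ (P : Type w₁) [AddCommGroup P] [Module A P]
    [LieRingModule (AffineOver 𝔤 A) P] [LieModule A (AffineOver 𝔤 A) P] : Prop :=
  InOJ H 𝔟 A P J ∧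
    ∀ (M N : Type w) [AddCommGroup M] [Module A M] [LieRingModule (AffineOver 𝔤 A) M]
      [LieModule A (AffineOver 𝔤 A) M] [AddCommGroup N] [Module A N]
      [LieRingModule (AffineOver 𝔤 A) N] [LieModule A (AffineOver 𝔤 A) N],
      InOJ H 𝔟 A M J → InOJ H 𝔟 A N J →
      ∀ f : M →ₗ⁅A, AffineOver 𝔤 A⁆ N, Function.Surjective f →
      ∀ h : P →ₗ⁅A, AffineOver 𝔤 A⁆ N, ∃ k : P →ₗ⁅A, AffineOver 𝔤 A⁆ M, f.comp k = h

/-- `c : P → L` is a projective cover in `𝒪_A^J`: `P` is projective in `𝒪_A^J`, `c` is surjective,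
and a homomorphism `g` from an object `M` of `𝒪_A^J` to `P` is surjective as soon as `c ∘ g` is.
The objects `M` range over the modules in `Type w`. -/
structure IsProjectiveCover {P : Type w₁} [AddCommGroup P] [Module A P]
    [LieRingModule (AffineOver 𝔤 A) P] [LieModule A (AffineOver 𝔤 A) P]
    {L : Type w₂} [AddCommGroup L] [Module A L]
    [LieRingModule (AffineOver 𝔤 A) L] [LieModule A (AffineOver 𝔤 A) L]
    (c : P →ₗ⁅A, AffineOver 𝔤 A⁆ L) : Prop where
  isProjective : IsProjectiveInOJ.{u, v, w} H 𝔟 A J P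
  mem_target : InOJ H 𝔟 A L J
  surjective : Function.Surjective c
  essential : ∀ (M : Type w) [AddCommGroup M] [Module A M] [LieRingModule (AffineOver 𝔤 A) M]
    [LieModule A (AffineOver 𝔤 A) M], InOJ H 𝔟 A M J →
    ∀ g : M →ₗ⁅A, AffineOver 𝔤 A⁆ P, Function.Surjective (c.comp g) → Function.Surjective g

end Projective

end AffineO

end

noncomputable section

set_option linter.unusedSectionVars false

namespace AffineO

/-! ### Positive functionals -/

section Gordan

/-! The functor sending `M` to its weight space `M_μ` is exact, because distinct weights differ by a
unit of `A`. On the truncated category it is represented by a cyclic module Q = `WeightObj`: the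
quotient of the enveloping algebra by the relations that give the generator weight `μ` and kill
every vector whose weight lies outside `J`. So Q is projective once it is known to be an object.
This holds because the height of a weight grows by at least one along each positive affine root:
only finitely many positive words act nontrivially on the generator, negative words span the rest,
and each weight space of Q is a finitely generated `A`-module (`inOJ_of_cyclic`). The height comes
from a regular element of the Cartan subalgebra that cuts out the Borel subalgebra
(`exists_eq_parabolic`).

The generator of Q maps to the highest weight vector of L(μ), and the cover is found as a direct
summand of Q. Induct on the finite number of weights of `J` above `μ`. Among the idempotents e of Q
with c₀ ∘ e = c₀, choose one whose kernel in Q_μ is maximal; it exists because Q_μ is a Noetherian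
`A`-module. Suppose a proper submodule of eQ still maps onto L(μ). A maximal submodule containing it
gives a simple quotient of eQ. This quotient has a highest weight γ ≥ μ, and it maps onto L(γ) by
Schur's lemma and a Nakayama argument; moreover γ ≠ μ, since L(μ)_μ is spanned by one vector. By
induction P(γ) exists, it splits off eQ inside the kernel of c₀, and removing it enlarges the kernel
of e, a contradiction (`exists_smaller_idempotent`). No lifting of idempotents is used, so `A` need
not be complete or Henselian.

The Poincaré-Birkhoff-Witt theorem is avoided as well: spanning by words replaces bases, and L(γ) is
shown to be nonzero only where an actual highest weight vector of weight γ is at hand. -/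

/-- Gordan's alternative: a finite family of vectors without a nontrivial nonnegative relation
lies in an open half space. -/
theorem exists_dual_pos {ι : Type*} (s : Finset ι) :
    ∀ {V : Type w} [AddCommGroup V] [Module ℚ V] (v : ι → V),
      (∀ c : ι → ℚ, (∀ i ∈ s, 0 ≤ c i) → ∑ i ∈ s, c i • v i = 0 → ∀ i ∈ s, c i = 0) →
      ∃ f : Module.Dual ℚ V, ∀ i ∈ s, 0 < f (v i) := by
  classical
  induction s using Finset.induction_on with
  | empty => intro V _ _ v _; exact ⟨0, by simp⟩
  | insert a s ha ih =>
    intro V _ _ v h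
    have hs : ∀ c : ι → ℚ, (∀ i ∈ s, 0 ≤ c i) → ∀ t : ℚ, 0 ≤ t →
        t • v a + ∑ i ∈ s, c i • v i = 0 → t = 0 ∧ ∀ i ∈ s, c i = 0 := by
      intro c hc t ht h0
      have hne : ∀ i ∈ s, i ≠ a := fun i hi hia => ha (hia ▸ hi)
      have := h (Function.update c a t) ?_ ?_
      · refine ⟨by simpa using this a (by simp), fun i hi => ?_⟩
        simpa [hne i hi] using this i (by simp [hi])
      · intro i hi
        rcases Finset.mem_insert.1 hi with rfl | hi
        · simpa
        · simpa [hne i hi] using hc i hi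
      · rw [Finset.sum_insert ha, ← h0]
        simp only [Function.update_self, add_right_inj]
        exact Finset.sum_congr rfl fun i hi => by simp [hne i hi]
    -- If `s` stays free of relations modulo the line of `v a`, a functional from the quotient is
    -- positive on `s` and vanishes at `v a`; a large multiple of it absorbs a correction that makes
    -- `v a` positive. Otherwise some positive multiple of `v a` is a nonnegative combination of
    -- `s`, and any functional positive on `s` works.
    by_cases hq : ∀ c : ι → ℚ, (∀ i ∈ s, 0 ≤ c i) →
        ∑ i ∈ s, c i • (Submodule.span ℚ {v a}).mkQ (v i) = 0 → ∀ i ∈ s, c i = 0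
    · obtain ⟨f, hf⟩ := ih (fun i => (Submodule.span ℚ {v a}).mkQ (v i)) hq
      have hva : v a ≠ 0 := fun h0 => one_ne_zero (hs 0 (by simp) 1 zero_le_one (by simp [h0])).1
      obtain ⟨g, hg⟩ := Module.Projective.exists_dual_ne_zero ℚ hva
      have hN : ∀ᶠ N : ℚ in Filter.atTop, ∀ i ∈ s,
          0 < N * f ((Submodule.span ℚ {v a}).mkQ (v i)) + (g (v a))⁻¹ * g (v i) := by
        rw [Filter.eventually_all_finset]
        intro i hi
        filter_upwards [Filter.eventually_gt_atTop
          (-((g (v a))⁻¹ * g (v i)) / f ((Submodule.span ℚ {v a}).mkQ (v i)))] with N hN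
        rw [div_lt_iff₀ (hf i hi)] at hN
        linarith
      obtain ⟨N, hN⟩ := hN.exists
      refine ⟨N • (f ∘ₗ (Submodule.span ℚ {v a}).mkQ) + (g (v a))⁻¹ • g, fun i hi => ?_⟩
      rcases Finset.mem_insert.1 hi with rfl | hi
      · have : (Submodule.span ℚ {v i}).mkQ (v i) = 0 := by
          simp [Submodule.mem_span_singleton_self]
        simp only [LinearMap.add_apply, LinearMap.smul_apply, LinearMap.comp_apply, this]
        simp [hg]
      · simpa using hN i hi
    · push Not at hq
      obtain ⟨c, hc, h0, j, hj, hcj⟩ := hq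
      have hmem : ∑ i ∈ s, c i • v i ∈ Submodule.span ℚ {v a} := by
        rw [← Submodule.ker_mkQ (Submodule.span ℚ {v a}), LinearMap.mem_ker, map_sum]
        simpa only [map_smul] using h0
      obtain ⟨t, ht⟩ := Submodule.mem_span_singleton.1 hmem
      have htpos : 0 < t := by
        by_contra hle
        refine hcj ((hs c hc (-t) (by linarith) ?_).2 j hj)
        rw [← ht, neg_smul, neg_add_cancel]
      obtain ⟨f, hf⟩ := ih v fun c hc h0 => (hs c hc 0 le_rfl (by simpa using h0)).2
      refine ⟨f, fun i hi => ?_⟩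
      rcases Finset.mem_insert.1 hi with rfl | hi
      · have h1 : t * f (v i) = ∑ j ∈ s, c j * f (v j) := by
          have := congrArg f ht
          simpa using this
        have h2 : 0 < ∑ j ∈ s, c j * f (v j) :=
          Finset.sum_pos' (fun j hj => mul_nonneg (hc j hj) (hf j hj).le)
            ⟨j, hj, mul_pos (lt_of_le_of_ne (hc j hj) (Ne.symm hcj)) (hf j hj)⟩
        rw [← h1] at h2
        exact (mul_pos_iff_of_pos_left htpos).1 h2
      · exact hf i hi

end Gordan

section Roots

open LieAlgebra LieModule LieAlgebra.IsKilling

variable {𝔤 : Type v} [LieRing 𝔤] [LieAlgebra ℂ 𝔤] [FiniteDimensional ℂ 𝔤] [IsKilling ℂ 𝔤]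
  {H : LieSubalgebra ℂ 𝔤} [H.IsCartanSubalgebra]

/-- A vector of weight `β` killed by `e` would be primitive for the sl₂-triple of `α`, and the
eigenvalue of a primitive vector is a natural number. -/
lemma lie_ne_zero_of_apply_coroot_neg {α β : Weight ℂ H 𝔤} (hα : α.IsNonZero)
    (hneg : (β (coroot α)).re < 0) :
    ∃ e ∈ rootSpace H α, ∃ x ∈ rootSpace H β, ⁅e, x⁆ ≠ 0 := by
  obtain ⟨h, e, f, ht, he, hf⟩ := exists_isSl2Triple_of_weight_isNonZero hα
  obtain ⟨x, hx, hx0⟩ := β.exists_ne_zero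
  refine ⟨e, he, x, hx, fun h0 => ?_⟩
  have P : ht.HasPrimitiveVectorWith x (β (coroot α)) :=
    { ne_zero := hx0
      lie_h := by
        rw [ht.h_eq_coroot hα he hf]
        exact lie_eq_smul_of_mem_rootSpace hx _
      lie_e := h0 }
  obtain ⟨n, hn⟩ := P.exists_nat
  rw [hn, Complex.natCast_re] at hneg
  exact (Nat.cast_nonneg n).not_gt hneg

lemma rootSpace_le_of_mem {α : Weight ℂ H 𝔤} (hα : α.IsNonZero) {p : Submodule ℂ 𝔤} {x : 𝔤}
    (hx : x ∈ rootSpace H α) (hx0 : x ≠ 0) (hxp : x ∈ p) : (rootSpace H α).toSubmodule ≤ p := by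
  intro y hy
  obtain ⟨c, hc⟩ := (finrank_eq_one_iff_of_nonzero' (⟨x, hx⟩ : rootSpace H α)
    (by simpa using hx0)).1 (finrank_rootSpace_eq_one α hα) ⟨y, hy⟩
  rw [← show c • x = y from congrArg Subtype.val hc]
  exact p.smul_mem c hxp

/-- sl₂ is perfect: each of `h`, `e`, `f` is a multiple of a bracket of two of them, so they survive
in every term of the derived series. -/
lemma not_isSl2Triple_of_isSolvable {𝔟 : LieSubalgebra ℂ 𝔤} [hs : LieAlgebra.IsSolvable 𝔟]
    {h e f : 𝔤} (ht : IsSl2Triple h e f) (he : e ∈ 𝔟) (hf : f ∈ 𝔟) : False := by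
  have hh : h ∈ 𝔟 := ht.lie_e_f ▸ 𝔟.lie_mem he hf
  have key : ∀ k, (⟨h, hh⟩ : 𝔟) ∈ derivedSeries ℂ 𝔟 k ∧ (⟨e, he⟩ : 𝔟) ∈ derivedSeries ℂ 𝔟 k ∧
      (⟨f, hf⟩ : 𝔟) ∈ derivedSeries ℂ 𝔟 k := by
    intro k
    induction k with
    | zero => simp
    | succ k ih =>
      obtain ⟨h1, h2, h3⟩ := ih
      rw [derivedSeries_def] at h1 h2 h3 ⊢
      rw [derivedSeriesOfIdeal_succ]
      refine ⟨?_, ?_, ?_⟩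
      · convert LieSubmodule.lie_mem_lie h2 h3 using 1
        exact Subtype.ext ht.lie_e_f.symm
      · have : (⟨e, he⟩ : 𝔟) = (2⁻¹ : ℂ) • ⁅(⟨h, hh⟩ : 𝔟), (⟨e, he⟩ : 𝔟)⁆ := by
          refine Subtype.ext ?_
          change e = (2⁻¹ : ℂ) • ⁅h, e⁆
          rw [ht.lie_h_e_smul ℂ, smul_smul]; norm_num
        rw [this]
        exact Submodule.smul_mem _ _ (LieSubmodule.lie_mem_lie h1 h2)
      · have : (⟨f, hf⟩ : 𝔟) = (-2⁻¹ : ℂ) • ⁅(⟨h, hh⟩ : 𝔟), (⟨f, hf⟩ : 𝔟)⁆ := by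
          refine Subtype.ext ?_
          change f = (-2⁻¹ : ℂ) • ⁅h, f⁆
          rw [ht.lie_lie_smul_f ℂ, smul_neg, smul_smul]; norm_num
        rw [this]
        exact Submodule.smul_mem _ _ (LieSubmodule.lie_mem_lie h1 h3)
  obtain ⟨k, hk⟩ := IsSolvable.solvable (R := ℂ) (L := 𝔟)
  have := (key k).2.1
  rw [hk, LieSubmodule.mem_bot] at this
  exact ht.e_ne_zero (congrArg Subtype.val this)

/-- A sum of roots of a solvable subalgebra does not vanish. -/
lemma sum_apply_coroot_ne_zero (𝔟 : LieSubalgebra ℂ 𝔤) [LieAlgebra.IsSolvable 𝔟] :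
    ∀ (n : ℕ) (m : Multiset (Weight ℂ H 𝔤)), m.card = n → m ≠ 0 →
      (∀ α ∈ m, α.IsNonZero ∧ (rootSpace H α).toSubmodule ≤ 𝔟.toSubmodule) →
      ¬ ∀ β : Weight ℂ H 𝔤, (m.map fun α => α (coroot β)).sum = 0 := by
  intro n
  induction n using Nat.strong_induction_on with
  | _ n ih =>
  intro m hcard hm0 hm hsum
  obtain ⟨α, hα⟩ := Multiset.exists_mem_of_ne_zero hm0
  obtain ⟨m, rfl⟩ := Multiset.exists_cons_of_mem hα
  have h2 := hsum α
  rw [Multiset.map_cons, Multiset.sum_cons, root_apply_coroot (hm α hα).1] at h2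
  -- Pairing with the coroot of `α`, the term `α` contributes 2, so another term must be negative
  -- for the sum to vanish.
  obtain ⟨β, hβ, hneg⟩ : ∃ β ∈ m, (β (coroot α)).re < 0 := by
    by_contra! hge
    have h3 : 0 ≤ (m.map fun γ : Weight ℂ H 𝔤 => (γ (coroot α)).re).sum := by
      refine Multiset.sum_nonneg fun x hx => ?_
      obtain ⟨γ, hγ, rfl⟩ := Multiset.mem_map.1 hx
      exact hge γ hγ
    have h4 : (m.map fun γ : Weight ℂ H 𝔤 => γ (coroot α)).sum.re =
        (m.map fun γ : Weight ℂ H 𝔤 => (γ (coroot α)).re).sum := by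
      have := map_multiset_sum Complex.reAddGroupHom (m.map fun γ => γ (coroot α))
      simpa [Multiset.map_map, Function.comp_def] using this
    have h5 := congrArg Complex.re h2
    rw [Complex.add_re, h4] at h5
    norm_num at h5
    linarith
  obtain ⟨m, rfl⟩ := Multiset.exists_cons_of_mem hβ
  have hβm : β ∈ α ::ₘ β ::ₘ m := by simp
  obtain ⟨e, he, x, hx, hne⟩ := lie_ne_zero_of_apply_coroot_neg (hm α hα).1 hneg
  have hmem : ⁅e, x⁆ ∈ 𝔟 := 𝔟.lie_mem ((hm α hα).2 he) ((hm β hβm).2 hx)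
  have hroot : ⁅e, x⁆ ∈ rootSpace H (α + β : H → ℂ) :=
    lie_mem_genWeightSpace_of_mem_genWeightSpace he hx
  let γ : Weight ℂ H 𝔤 := ⟨α + β, fun h0 => hne (by simpa [h0] using hroot)⟩
  have hγ : (γ : H → ℂ) = α + β := rfl
  -- If `α + β = 0`, the subalgebra contains the root spaces of `±α` and hence an sl₂-triple.
  -- Otherwise `α + β` is a root whose root space lies in `𝔟`, and replacing the pair by it keeps
  -- the sum and shortens the multiset.
  by_cases hγ0 : γ.IsZero
  · obtain ⟨h, e', f', ht, he', hf'⟩ := exists_isSl2Triple_of_weight_isNonZero (hm α hα).1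
    have hβα : (β : H → ℂ) = -α := by
      have : (γ : H → ℂ) = 0 := hγ0
      rw [hγ] at this
      exact eq_neg_of_add_eq_zero_right this
    exact not_isSl2Triple_of_isSolvable ht ((hm α hα).2 he') ((hm β hβm).2 (by rwa [hβα]))
  · refine ih (Multiset.card (γ ::ₘ m)) (by simp [← hcard]) (γ ::ₘ m) rfl (by simp) ?_ ?_
    · intro δ hδ
      rcases Multiset.mem_cons.1 hδ with rfl | hδ
      · exact ⟨hγ0, rootSpace_le_of_mem hγ0 hroot hne hmem⟩
      · exact hm δ (by simp [hδ])
    · intro δ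
      have := hsum δ
      simp only [Multiset.map_cons, Multiset.sum_cons] at this ⊢
      rw [← this, hγ, Pi.add_apply, add_assoc]

end Roots

/-! ### Regular elements and the Borel subalgebras they define -/

section Roots

open LieAlgebra LieModule LieAlgebra.IsKilling

variable {𝔤 : Type v} [LieRing 𝔤] [LieAlgebra ℂ 𝔤] [FiniteDimensional ℂ 𝔤] [IsKilling ℂ 𝔤]
  {H : LieSubalgebra ℂ 𝔤} [H.IsCartanSubalgebra]

/-- Clearing denominators turns a nonnegative rational relation into a multiset of roots with
vanishing sum, to which `sum_apply_coroot_ne_zero` applies. -/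
lemma eq_zero_of_sum_smul_eq_zero (𝔟 : LieSubalgebra ℂ 𝔤) [LieAlgebra.IsSolvable 𝔟]
    (s : Finset (Weight ℂ H 𝔤))
    (hs : ∀ α ∈ s, α.IsNonZero ∧ (rootSpace H α).toSubmodule ≤ 𝔟.toSubmodule)
    (c : Weight ℂ H 𝔤 → ℚ) (hc : ∀ α ∈ s, 0 ≤ c α)
    (h0 : ∀ β : Weight ℂ H 𝔤, ∑ α ∈ s, (c α : ℂ) * α (coroot β) = 0) :
    ∀ α ∈ s, c α = 0 := by
  classical
  obtain ⟨b, hb⟩ := IsLocalization.exist_integer_multiples (nonZeroDivisors ℤ) s c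
  have hb0 : (b : ℤ) ≠ 0 := nonZeroDivisors.coe_ne_zero b
  choose! z hz using hb
  simp only [eq_intCast, zsmul_eq_mul] at hz
  have hn : ∀ α ∈ s, ((z α).natAbs : ℚ) = |(b : ℤ)| * c α := by
    intro α hα
    rw [Nat.cast_natAbs, Int.cast_abs, hz α hα, abs_mul, abs_of_nonneg (hc α hα), Int.cast_abs]
  let m : Multiset (Weight ℂ H 𝔤) := ∑ α ∈ s, Multiset.replicate (z α).natAbs α
  have hsum : ∀ g : Weight ℂ H 𝔤 → ℂ, (m.map g).sum = ∑ α ∈ s, ((z α).natAbs : ℂ) * g α := by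
    intro g
    have := map_sum (Multiset.sumAddMonoidHom.comp (Multiset.mapAddMonoidHom g))
      (fun α => Multiset.replicate (z α).natAbs α) s
    simp only [AddMonoidHom.comp_apply, Multiset.coe_mapAddMonoidHom,
      Multiset.coe_sumAddMonoidHom] at this
    rw [this]
    exact Finset.sum_congr rfl fun α _ => by
      rw [Multiset.map_replicate, Multiset.sum_replicate, nsmul_eq_mul]
  by_contra! hne
  obtain ⟨α, hα, hα0⟩ := hne
  refine sum_apply_coroot_ne_zero (H := H) 𝔟 _ m rfl ?_ ?_ ?_
  · intro hm
    have h1 : α ∈ m := by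
      refine Multiset.mem_sum.2 ⟨α, hα, Multiset.mem_replicate.2 ⟨?_, rfl⟩⟩
      intro h
      have := hn α hα
      rw [h] at this
      simp only [Nat.cast_zero, zero_eq_mul, Int.cast_eq_zero, abs_eq_zero] at this
      tauto
    simp [hm] at h1
  · intro β hβ
    obtain ⟨γ, hγ, hβγ⟩ := Multiset.mem_sum.1 hβ
    rw [Multiset.eq_of_mem_replicate hβγ]
    exact hs γ hγ
  · intro β
    rw [hsum]
    have h1 : ∀ α ∈ s, ((z α).natAbs : ℂ) * α (coroot β) =
        (|(b : ℤ)| : ℤ) * ((c α : ℂ) * α (coroot β)) := by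
      intro α hα
      have := congrArg (fun q : ℚ => (q : ℂ)) (hn α hα)
      rw [Rat.cast_mul, Rat.cast_natCast, Rat.cast_intCast] at this
      rw [this, mul_assoc]
    rw [Finset.sum_congr rfl h1, ← Finset.mul_sum, h0, mul_zero]

/-- There is a regular element of the Cartan subalgebra on which the roots of a given solvable
subalgebra are positive. -/
lemma exists_regular_element (H : LieSubalgebra ℂ 𝔤) [H.IsCartanSubalgebra]
    (𝔟 : LieSubalgebra ℂ 𝔤) [LieAlgebra.IsSolvable 𝔟] :
    ∃ ρ : H, ∀ α : Weight ℂ H 𝔤, α.IsNonZero → 1 ≤ |(α ρ).re| ∧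
      ((rootSpace H α).toSubmodule ≤ 𝔟.toSubmodule → 0 < (α ρ).re) := by
  classical
  have := Fintype.ofFinite (Weight ℂ H 𝔤)
  -- The values of a root at all coroots are integers, so a root becomes a rational vector and
  -- Gordan's alternative can be used over ℚ.
  let v : Weight ℂ H 𝔤 → Weight ℂ H 𝔤 → ℚ := fun α β =>
    ((chainBotCoeff β α - chainTopCoeff β α : ℤ) : ℚ)
  have hv : ∀ α β, α (coroot β) = ((v α β : ℚ) : ℂ) := by
    intro α β
    rw [apply_coroot_eq_cast β α]; simp [v]
  let s : Finset (Weight ℂ H 𝔤) :=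
    {α | α.IsNonZero ∧ (rootSpace H α).toSubmodule ≤ 𝔟.toSubmodule}
  obtain ⟨f, hf⟩ := exists_dual_pos s v fun c hc h0 =>
    eq_zero_of_sum_smul_eq_zero 𝔟 s (by simp [s]) c hc fun β => by
      have := congrArg (fun q : ℚ => (q : ℂ)) (congrFun h0 β)
      simpa [hv] using this
  -- `f` may vanish on roots outside `s`. A functional `y` that is nonzero on every root repairs
  -- this: `N • f + y` is nonzero on all roots and positive on `s` for large `N`. The factor `M`
  -- then pushes all absolute values up to 1.
  obtain ⟨y, hy⟩ := Module.exists_dual_forall_apply_ne_zero (K := ℚ)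
    (fun α : {α : Weight ℂ H 𝔤 // α.IsNonZero} => v α) fun α h0 => by
      have h1 := hv α α
      rw [h0, root_apply_coroot α.2] at h1
      simp at h1
  have hN : ∀ᶠ N : ℚ in Filter.atTop, ∀ α : {α : Weight ℂ H 𝔤 // α.IsNonZero},
      N * f (v α) + y (v α) ≠ 0 ∧ (α.1 ∈ s → 0 < N * f (v α) + y (v α)) := by
    rw [Filter.eventually_all]
    intro α
    rcases eq_or_ne (f (v α)) 0 with h0 | h0
    · refine Filter.Eventually.of_forall fun N => ⟨by simpa [h0] using hy α, fun hα => ?_⟩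
      exact absurd h0 (hf _ hα).ne'
    · filter_upwards [Filter.eventually_gt_atTop (-(y (v α)) / f (v α))] with N hN
      refine ⟨fun h => hN.ne' ?_, fun hα => ?_⟩
      · rw [eq_div_iff h0]; linarith
      · rw [div_lt_iff₀ (hf _ hα)] at hN
        linarith
  obtain ⟨N, hN⟩ := hN.exists
  have hM : ∀ᶠ M : ℚ in Filter.atTop, ∀ α : {α : Weight ℂ H 𝔤 // α.IsNonZero},
      1 ≤ M * |N * f (v α) + y (v α)| := by
    rw [Filter.eventually_all]
    intro α
    filter_upwards [Filter.eventually_ge_atTop (1 / |N * f (v α) + y (v α)|)] with M hM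
    rwa [div_le_iff₀ (abs_pos.2 (hN α).1)] at hM
  obtain ⟨M, hM, hMpos⟩ := (hM.and (Filter.eventually_gt_atTop 0)).exists
  let F : Module.Dual ℚ (Weight ℂ H 𝔤 → ℚ) := M • (N • f + y)
  -- The coordinates of `F` serve as coefficients of the coroots, so that evaluating `α` gives
  -- exactly `F (v α)`.
  refine ⟨∑ β, (F (Pi.single β 1) : ℂ) • coroot β, fun α hα => ?_⟩
  have hre : α (∑ β, (F (Pi.single β 1) : ℂ) • coroot β) = ((F (v α) : ℚ) : ℂ) := by
    rw [← Weight.toLinear_apply, map_sum]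
    simp only [map_smul, Weight.toLinear_apply, hv, smul_eq_mul]
    conv_rhs => rw [LinearMap.pi_apply_eq_sum_univ F (v α)]
    push_cast
    refine Finset.sum_congr rfl fun β _ => ?_
    rw [mul_comm, smul_eq_mul]
    push_cast
    congr 3
    ext γ
    simp [Pi.single_apply, eq_comm]
  have hF : F (v α) = M * (N * f (v α) + y (v α)) := by simp [F, mul_add]
  rw [hre, Complex.ratCast_re, hF]
  refine ⟨?_, fun h => ?_⟩
  · have := hM ⟨α, hα⟩
    rw [← abs_of_pos hMpos, ← abs_mul] at this
    exact_mod_cast this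
  · have := mul_pos hMpos ((hN ⟨α, hα⟩).2 (Finset.mem_filter.2 ⟨Finset.mem_univ _, hα, h⟩))
    exact_mod_cast this

/-- The sum of the root spaces (including the Cartan subalgebra) on which `ρ` has real part at
least `c`. -/
def rootFiltration (ρ : H) (c : ℝ) : Submodule ℂ 𝔤 :=
  ⨆ χ : {χ : Weight ℂ H 𝔤 // c ≤ (χ ρ).re}, (rootSpace H χ.1).toSubmodule

/-- The bound by `e` is required only where a bracket is nonzero. This lets the first derived step
of `parabolic ρ` jump from level 0 to level 1, although two elements of the Cartan subalgebra have
total weight 0. -/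
lemma lie_mem_rootFiltration {ρ : H} {c d e : ℝ}
    (h : ∀ χ ψ : Weight ℂ H 𝔤, c ≤ (χ ρ).re → d ≤ (ψ ρ).re →
      ∀ x ∈ rootSpace H χ, ∀ y ∈ rootSpace H ψ, ⁅x, y⁆ ≠ 0 → e ≤ (χ ρ).re + (ψ ρ).re)
    {x y : 𝔤} (hx : x ∈ rootFiltration ρ c) (hy : y ∈ rootFiltration ρ d) :
    ⁅x, y⁆ ∈ rootFiltration ρ e := by
  refine Submodule.iSup_induction _ (motive := fun x => ⁅x, y⁆ ∈ rootFiltration ρ e) hx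
    (fun χ x hx => ?_) (by simp) (fun a b ha hb => by rw [add_lie]; exact add_mem ha hb)
  refine Submodule.iSup_induction _ (motive := fun y => ⁅x, y⁆ ∈ rootFiltration ρ e) hy
    (fun ψ y hy => ?_) (by simp) (fun a b ha hb => by rw [lie_add]; exact add_mem ha hb)
  by_cases hne : ⁅x, y⁆ = 0
  · rw [hne]; exact zero_mem _
  have hroot : ⁅x, y⁆ ∈ rootSpace H (χ.1 + ψ.1 : H → ℂ) :=
    lie_mem_genWeightSpace_of_mem_genWeightSpace hx hy
  let γ : Weight ℂ H 𝔤 := ⟨χ.1 + ψ.1, fun h0 => hne (by simpa [h0] using hroot)⟩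
  have hγ : e ≤ (γ ρ).re := h χ ψ χ.2 ψ.2 x hx y hy hne
  exact Submodule.mem_iSup_of_mem (p := fun χ : {χ : Weight ℂ H 𝔤 // e ≤ (χ ρ).re} =>
    (rootSpace H χ.1).toSubmodule) ⟨γ, hγ⟩ hroot

lemma mem_rootFiltration {ρ : H} {c : ℝ} {χ : Weight ℂ H 𝔤} (hχ : c ≤ (χ ρ).re) {x : 𝔤}
    (hx : x ∈ rootSpace H χ) : x ∈ rootFiltration ρ c :=
  Submodule.mem_iSup_of_mem (p := fun χ : {χ : Weight ℂ H 𝔤 // c ≤ (χ ρ).re} =>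
    (rootSpace H χ.1).toSubmodule) ⟨χ, hχ⟩ hx

lemma rootFiltration_mono {ρ : H} {c d : ℝ} (h : c ≤ d) :
    rootFiltration ρ d ≤ rootFiltration ρ c :=
  iSup_le fun χ _ hx => mem_rootFiltration (h.trans χ.2) hx

lemma lie_mem_rootFiltration_add {ρ : H} {c d : ℝ} {x y : 𝔤} (hx : x ∈ rootFiltration ρ c)
    (hy : y ∈ rootFiltration ρ d) : ⁅x, y⁆ ∈ rootFiltration ρ (c + d) :=
  lie_mem_rootFiltration (fun _ _ hχ hψ _ _ _ _ _ => add_le_add hχ hψ) hx hy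

/-- The subalgebra of `𝔤` spanned by the root spaces on which `ρ` has nonnegative real part. -/
def parabolic (ρ : H) : LieSubalgebra ℂ 𝔤 :=
  { rootFiltration ρ 0 with
    lie_mem' := fun hx hy => by simpa using lie_mem_rootFiltration_add hx hy }

/-- The ideal of `parabolic ρ` given by the root filtration. -/
def rootFiltrationIdeal (ρ : H) (c : ℝ) : LieIdeal ℂ (parabolic ρ) :=
  { (rootFiltration ρ c).comap (parabolic ρ).toSubmodule.subtype with
    lie_mem := fun {x y} hy => by
      have := lie_mem_rootFiltration_add x.2 hy
      rwa [zero_add] at this }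

lemma mem_rootFiltrationIdeal {ρ : H} {c : ℝ} {x : parabolic ρ} :
    x ∈ rootFiltrationIdeal ρ c ↔ (x : 𝔤) ∈ rootFiltration ρ c := Iff.rfl

/-- The derived series climbs the root filtration, which vanishes eventually since there are
finitely many weights. -/
lemma isSolvable_parabolic {ρ : H}
    (hρ : ∀ α : Weight ℂ H 𝔤, α.IsNonZero → 1 ≤ |(α ρ).re|) :
    LieAlgebra.IsSolvable (parabolic ρ) := by
  have step : ∀ k : ℕ, derivedSeries ℂ (parabolic ρ) (k + 1) ≤
      rootFiltrationIdeal ρ (k + 1 : ℕ) := by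
    intro k
    induction k with
    | zero =>
      rw [derivedSeries_def, derivedSeriesOfIdeal_succ, LieSubmodule.lie_le_iff]
      intro x _ y _
      rw [mem_rootFiltrationIdeal]
      refine lie_mem_rootFiltration (fun χ ψ hχ hψ x hx y hy hne => ?_) x.2 y.2
      by_contra! hlt
      -- A gap in the spectrum of `ρ`: no weight has real part strictly between 0 and 1. A bracket
      -- of level below 1 therefore involves only elements of the abelian Cartan subalgebra and
      -- vanishes.
      have hz : ∀ α : Weight ℂ H 𝔤, 0 ≤ (α ρ).re → (α ρ).re < 1 → α.IsZero := by
        intro α h0 h1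
        by_contra hα
        have := hρ α hα
        rw [abs_of_nonneg h0] at this
        linarith
      have hχ0 : (χ : H → ℂ) = 0 := hz χ hχ (by push_cast at hlt; linarith)
      have hψ0 : (ψ : H → ℂ) = 0 := hz ψ hψ (by push_cast at hlt; linarith)
      rw [hχ0, rootSpace_zero_eq] at hx
      rw [hψ0] at hy
      refine hne ?_
      simpa using lie_eq_smul_of_mem_rootSpace hy ⟨x, hx⟩
    | succ k ih =>
      rw [derivedSeries_def] at ih ⊢
      rw [derivedSeriesOfIdeal_succ, LieSubmodule.lie_le_iff]
      intro x hx y hy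
      have := lie_mem_rootFiltration_add (ih hx) (ih hy)
      refine rootFiltration_mono ?_ this
      push_cast
      linarith [(Nat.cast_nonneg k : (0 : ℝ) ≤ k)]
  obtain ⟨B, hB⟩ : ∃ B : ℝ, ∀ χ : Weight ℂ H 𝔤, (χ ρ).re ≤ B := by
    obtain ⟨B, hB⟩ := (Set.finite_range fun χ : Weight ℂ H 𝔤 => (χ ρ).re).bddAbove
    exact ⟨B, fun χ => hB ⟨χ, rfl⟩⟩
  obtain ⟨k, hk⟩ := exists_nat_gt B
  refine IsSolvable.mk (R := ℂ) (k := k + 1) ?_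
  rw [eq_bot_iff]
  intro x hx
  have hx' := step k hx
  rw [mem_rootFiltrationIdeal, rootFiltration] at hx'
  have : IsEmpty {χ : Weight ℂ H 𝔤 // ((k + 1 : ℕ) : ℝ) ≤ (χ ρ).re} :=
    ⟨fun χ => by have := χ.2; have := hB χ.1; push_cast at *; linarith⟩
  rw [iSup_of_empty, Submodule.mem_bot] at hx'
  rw [LieSubmodule.mem_bot]
  exact Subtype.ext hx'

/-- A Borel subalgebra containing the Cartan subalgebra is determined by a regular element. -/
lemma exists_eq_parabolic {𝔟 : LieSubalgebra ℂ 𝔤} (h𝔟 : IsBorel 𝔟) (hH : H ≤ 𝔟) :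
    ∃ ρ : H, (∀ α : Weight ℂ H 𝔤, α.IsNonZero → 1 ≤ |(α ρ).re|) ∧ 𝔟 = parabolic ρ ∧
      ∀ α : Weight ℂ H 𝔤, α.IsNonZero →
        ((rootSpace H α).toSubmodule ≤ 𝔟.toSubmodule ↔ 0 < (α ρ).re) := by
  have hsol : LieAlgebra.IsSolvable 𝔟 := h𝔟.prop
  obtain ⟨ρ, hρ⟩ := exists_regular_element H 𝔟
  -- Being stable under `H`, the subalgebra `𝔟` is the sum of its intersections with the root
  -- spaces; these spaces are lines for nonzero roots, so each intersection is zero or everything.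
  -- Maximality of `𝔟` turns the resulting inclusion into an equality.
  let N : LieSubmodule ℂ H 𝔤 :=
    { 𝔟.toSubmodule with lie_mem := fun {h x} hx => 𝔟.lie_mem (hH h.2) hx }
  have hle : 𝔟 ≤ parabolic ρ := by
    intro x hx
    have hx' : x ∈ N := hx
    rw [eq_iSup_inf_genWeightSpace (N := N)] at hx'
    refine LieSubmodule.iSup_induction _ (motive := fun x => x ∈ parabolic ρ) hx' ?_
      (zero_mem _) (fun a b ha hb => add_mem ha hb)
    rintro χ y ⟨hy1, hy2⟩
    rcases eq_or_ne y 0 with rfl | hy0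
    · exact zero_mem _
    refine mem_rootFiltration (χ := χ) ?_ hy2
    by_cases hχ : χ.IsZero
    · have : (χ : H → ℂ) = 0 := hχ
      simp [this]
    · exact ((hρ χ hχ).2 (rootSpace_le_of_mem hχ hy2 hy0 hy1)).le
  have heq : 𝔟 = parabolic ρ :=
    h𝔟.eq_of_le (isSolvable_parabolic fun α hα => (hρ α hα).1) hle
  refine ⟨ρ, fun α hα => (hρ α hα).1, heq, fun α hα => ⟨(hρ α hα).2, fun h x hx => ?_⟩⟩
  rw [heq]
  exact mem_rootFiltration h.le hx

end Roots

/-- A triangular decomposition: a finite spanning family of weight vectors of `𝔤`, adapted to the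
Borel subalgebra `𝔟`, and an element `ρ` of `𝔥` on which the positive roots are positive. -/
structure Triangular {𝔤 : Type v} [LieRing 𝔤] [LieAlgebra ℂ 𝔤] (H 𝔟 : LieSubalgebra ℂ 𝔤)
    [LieRing.IsNilpotent H] where
  /-- the index type of the family -/
  ι : Type v
  finite_ι : Finite ι
  /-- the weight vectors -/
  vec : ι → 𝔤
  /-- the weights of the vectors -/
  wt : ι → Module.Dual ℂ H
  /-- the element of the Cartan subalgebra defining the height -/
  ρ : H
  span_vec : Submodule.span ℂ (Set.range vec) = ⊤
  lie_vec : ∀ (h : H) (i : ι), ⁅(h : 𝔤), vec i⁆ = wt i h • vec i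
  trichotomy : ∀ i, (wt i = 0 ∧ vec i ∈ H) ∨ wt i ∈ posRoots H 𝔟 ∨ -wt i ∈ posRoots H 𝔟
  vec_mem : ∀ i, wt i ∈ posRoots H 𝔟 → vec i ∈ 𝔟
  borel_le : 𝔟.toSubmodule ≤
    Submodule.span ℂ (vec '' {i | (wt i = 0 ∧ vec i ∈ H) ∨ wt i ∈ posRoots H 𝔟})
  one_le : ∀ α ∈ posRoots H 𝔟, 1 ≤ (α ρ).re
  /-- the value of `δ` at the element of the affine Cartan subalgebra defining the height -/
  period : ℕ
  one_le_period : 1 ≤ period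
  abs_add_one_le : ∀ α ∈ roots H, |(α ρ).re| + 1 ≤ period
  neg_mem_roots : ∀ α ∈ roots H, -α ∈ roots H
  cartan_le : H ≤ 𝔟

/-! ### The triangular decomposition attached to a Borel subalgebra -/

section Roots

open LieAlgebra LieModule LieAlgebra.IsKilling

variable {𝔤 : Type v} [LieRing 𝔤] [LieAlgebra ℂ 𝔤] [FiniteDimensional ℂ 𝔤] [IsKilling ℂ 𝔤]
  {H : LieSubalgebra ℂ 𝔤} [H.IsCartanSubalgebra]

lemma toLinear_mem_roots {χ : Weight ℂ H 𝔤} (hχ : χ.IsNonZero) :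
    χ.toLinear ∈ roots H :=
  ⟨fun h => hχ (by ext x; exact LinearMap.congr_fun h x), χ.genWeightSpace_ne_bot⟩

lemma exists_weight_of_mem_roots {α : Module.Dual ℂ H} (hα : α ∈ roots H) :
    ∃ χ : Weight ℂ H 𝔤, χ.IsNonZero ∧ χ.toLinear = α := by
  refine ⟨⟨α, hα.2⟩, fun h => hα.1 ?_, rfl⟩
  ext x
  exact congrFun h x

/-- The family collects bases of all weight spaces of `𝔤`, the Cartan subalgebra being the one of
weight 0; the period is a natural number bounding `|Re χ(ρ)| + 1` for every weight χ. -/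
theorem exists_triangular {𝔟 : LieSubalgebra ℂ 𝔤} (h𝔟 : IsBorel 𝔟) (hH : H ≤ 𝔟) :
    Nonempty (Triangular H 𝔟) := by
  obtain ⟨ρ, hρ, h𝔟ρ, hpos⟩ := exists_eq_parabolic h𝔟 hH
  have hposR : ∀ χ : Weight ℂ H 𝔤, χ.IsNonZero →
      (χ.toLinear ∈ posRoots H 𝔟 ↔ 0 < (χ ρ).re) := fun χ hχ =>
    ⟨fun h => (hpos χ hχ).1 h.2, fun h => ⟨toLinear_mem_roots hχ, (hpos χ hχ).2 h⟩⟩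
  obtain ⟨N, hN⟩ : ∃ N : ℕ, 1 ≤ N ∧ ∀ χ : Weight ℂ H 𝔤, |(χ ρ).re| + 1 ≤ N := by
    obtain ⟨C, hC⟩ := (Set.finite_range fun χ : Weight ℂ H 𝔤 => |(χ ρ).re| + 1).bddAbove
    obtain ⟨N, hN⟩ := exists_nat_ge (max C 1)
    exact ⟨N, by exact_mod_cast (le_max_right C 1).trans hN,
      fun χ => (hC ⟨χ, rfl⟩).trans ((le_max_left C 1).trans hN)⟩
  let B := fun χ : Weight ℂ H 𝔤 => Module.finBasis ℂ (rootSpace H χ)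
  have hspan : ∀ χ : Weight ℂ H 𝔤, ∀ x ∈ rootSpace H χ,
      x ∈ Submodule.span ℂ (Set.range fun i => (B χ i : 𝔤)) := by
    intro χ x hx
    have h1 := (B χ).mem_span ⟨x, hx⟩
    have h2 := Submodule.mem_map_of_mem (f := (rootSpace H χ).toSubmodule.subtype) h1
    rw [Submodule.map_span, ← Set.range_comp] at h2
    exact h2
  have hzero : ∀ χ : Weight ℂ H 𝔤, χ.IsZero → ∀ i, χ.toLinear = 0 ∧ (B χ i : 𝔤) ∈ H := by
    intro χ hχ i
    have h0 : (χ : H → ℂ) = 0 := hχ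
    have h1 : ∀ x ∈ rootSpace H χ, x ∈ H := by
      rw [h0, rootSpace_zero_eq]
      exact fun x hx => hx
    exact ⟨LinearMap.ext fun x => congrFun h0 x, h1 _ (B χ i).2⟩
  refine ⟨⟨Σ χ : Weight ℂ H 𝔤, Fin (Module.finrank ℂ (rootSpace H χ)), inferInstance,
    fun i => B i.1 i.2, fun i => i.1.toLinear, ρ, ?_, ?_, ?_, ?_, ?_, ?_, N, hN.1, ?_, ?_, hH⟩⟩
  · rw [eq_top_iff]
    intro x _
    have hx : x ∈ ⨆ χ : Weight ℂ H 𝔤, genWeightSpace 𝔤 χ := by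
      rw [iSup_genWeightSpace_eq_top']; trivial
    refine LieSubmodule.iSup_induction _ (motive := fun x => x ∈ Submodule.span ℂ _) hx (fun χ y hy => ?_) (zero_mem _)
      (fun a b ha hb => add_mem ha hb)
    refine Submodule.span_mono ?_ (hspan χ y hy)
    rintro _ ⟨i, rfl⟩
    exact ⟨⟨χ, i⟩, rfl⟩
  · intro h i
    exact lie_eq_smul_of_mem_rootSpace (B i.1 i.2).2 h
  · rintro ⟨χ, i⟩
    by_cases hχ : χ.IsZero
    · exact Or.inl (hzero χ hχ i)
    · right
      have h1 := hρ χ hχ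
      rcases le_abs.1 h1 with h | h
      · exact Or.inl ((hposR χ hχ).2 (by linarith))
      · refine Or.inr ((hposR (-χ) (Weight.IsNonZero.neg hχ)).2 ?_)
        rw [Weight.coe_neg, Pi.neg_apply, Complex.neg_re]
        linarith
  · rintro ⟨χ, i⟩ hχ
    exact hχ.2 _ (B χ i).2
  · intro x hx
    rw [h𝔟ρ] at hx
    refine Submodule.iSup_induction _ (motive := fun x => x ∈ Submodule.span ℂ _) hx (fun χ y hy => ?_) (zero_mem _)
      (fun a b ha hb => add_mem ha hb)
    refine Submodule.span_mono ?_ (hspan χ y hy)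
    rintro _ ⟨i, rfl⟩
    refine ⟨⟨χ, i⟩, ?_, rfl⟩
    by_cases hχ : χ.1.IsZero
    · exact Or.inl (hzero χ.1 hχ i)
    · refine Or.inr ((hposR χ.1 hχ).2 (lt_of_le_of_ne χ.2 fun h0 => ?_))
      have := hρ χ.1 hχ
      rw [← h0] at this
      norm_num at this
  · intro α hα
    obtain ⟨χ, hχ, rfl⟩ := exists_weight_of_mem_roots hα.1
    have h1 := (hposR χ hχ).1 hα
    have h2 := hρ χ hχ
    rwa [abs_of_pos h1] at h2
  · intro α hα
    obtain ⟨χ, hχ, rfl⟩ := exists_weight_of_mem_roots hα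
    exact hN.2 χ
  · intro α hα
    obtain ⟨χ, hχ, rfl⟩ := exists_weight_of_mem_roots hα
    exact toLinear_mem_roots (χ := -χ) (Weight.IsNonZero.neg hχ)

end Roots

/-! ### Root vectors of the affine algebra and the height of weights -/

lemma finite_lists {α : Type*} {S : Set α} (hS : S.Finite) (n : ℕ) :
    {w : List α | (∀ l ∈ w, l ∈ S) ∧ w.length ≤ n}.Finite := by
  have := hS.to_subtype
  refine ((List.finite_length_le S n).image (List.map Subtype.val)).subset fun w hw => ?_
  refine ⟨w.attach.map fun l => (⟨l.1, hw.1 l.1 l.2⟩ : S), ?_, ?_⟩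
  · change (w.attach.map _).length ≤ n
    rw [List.length_map, List.length_attach]
    exact hw.2
  · rw [List.map_map]
    exact w.attach_map_subtype_val

section Letters

variable {𝔤 : Type v} [LieRing 𝔤] [LieAlgebra ℂ 𝔤] {H 𝔟 : LieSubalgebra ℂ 𝔤}
  [LieRing.IsNilpotent H]

lemma WtLE.refl (μ : Wt H) : WtLE H 𝔟 μ μ := by
  rw [WtLE, sub_self]; exact zero_mem _

lemma WtLE.trans {μ ν κ : Wt H} (h₁ : WtLE H 𝔟 μ ν) (h₂ : WtLE H 𝔟 ν κ) : WtLE H 𝔟 μ κ := by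
  have := add_mem h₁ h₂
  rwa [sub_add_sub_cancel'] at this

/-- The element `x ⊗ tⁿ` of the affine algebra. -/
def Affine.mono (n : ℤ) : 𝔤 →ₗ[ℂ] Affine 𝔤 where
  toFun x := ⟨Finsupp.single n x, 0, 0⟩
  map_add' x y := by ext1 <;> simp
  map_smul' c x := by ext1 <;> simp

lemma Affine.mono_apply (n : ℤ) (x : 𝔤) :
    Affine.mono n x = ⟨Finsupp.single n x, 0, 0⟩ := rfl

lemma Affine.sum_mono (f : Loop 𝔤) :
    (⟨f, 0, 0⟩ : Affine 𝔤) = f.sum fun n x => Affine.mono n x := by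
  induction f using Finsupp.induction_linear with
  | zero => rfl
  | add a b ha hb =>
    rw [Finsupp.sum_add_index' (by simp) (by simp), ← ha, ← hb]
    ext1 <;> simp
  | single n x => exact (Finsupp.sum_single_index (h := fun n x => Affine.mono n x) (map_zero _)).symm

lemma Affine.eq_sum_mono (H : LieSubalgebra ℂ 𝔤) (x : Affine 𝔤) :
    x = x.loop.sum (fun n y => Affine.mono n y) +
      CartanHat.incl H (0, x.central, x.deg) := by
  rw [← Affine.sum_mono]
  ext1 <;> simp [CartanHat.incl]

namespace Triangular

variable (T : Triangular H 𝔟)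

/-- The index type of the root vectors of the affine algebra. -/
abbrev Letter := T.ι × ℤ

/-- The root vectors of the affine algebra. -/
def letter (l : T.Letter) : Affine 𝔤 := Affine.mono l.2 (T.vec l.1)

/-- The weights of the root vectors. -/
def letterWt (l : T.Letter) : Wt H := finWt H (T.wt l.1) + l.2 • delta H

/-- The root vector belongs to the positive part of the affine algebra. -/
def Pos (l : T.Letter) : Prop := 0 < l.2 ∨ l.2 = 0 ∧ T.wt l.1 ∈ posRoots H 𝔟

/-- The root vector belongs to the negative part of the affine algebra. -/
def Neg (l : T.Letter) : Prop := l.2 < 0 ∨ l.2 = 0 ∧ -T.wt l.1 ∈ posRoots H 𝔟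

lemma lie_incl_letter (h : CartanHat H) (l : T.Letter) :
    ⁅CartanHat.incl H h, T.letter l⁆ = T.letterWt l h • T.letter l := by
  have hl := T.lie_vec h.1 l.1
  ext1
  · simp [CartanHat.incl, letter, Affine.mono_apply, letterWt, finWt, delta, hl, mul_comm, add_smul,
      mul_smul]
  · simp [CartanHat.incl, letter, Affine.mono_apply]
  · simp [CartanHat.incl, letter, Affine.mono_apply]

lemma pos_or_neg_or_mem (l : T.Letter) :
    T.Pos l ∨ T.Neg l ∨ ∃ h : CartanHat H, T.letter l = CartanHat.incl H h := by
  rcases lt_trichotomy l.2 0 with h | h | h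
  · exact Or.inr (Or.inl (Or.inl h))
  · rcases T.trichotomy l.1 with h' | h' | h'
    · refine Or.inr (Or.inr ⟨(⟨_, h'.2⟩, 0, 0), ?_⟩)
      rw [letter, h]; rfl
    · exact Or.inl (Or.inr ⟨h, h'⟩)
    · exact Or.inr (Or.inl (Or.inr ⟨h, h'⟩))
  · exact Or.inl (Or.inl h)

lemma neg_neg_mem_roots (T : Triangular H 𝔟) {α : Module.Dual ℂ H} (h : -α ∈ roots H) : α ∈ roots H := by
  simpa using T.neg_mem_roots _ h

lemma wt_mem_roots (i : T.ι) : T.wt i = 0 ∨ T.wt i ∈ roots H := by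
  rcases T.trichotomy i with h | h | h
  · exact Or.inl h.1
  · exact Or.inr h.1
  · exact Or.inr (T.neg_neg_mem_roots h.1)

lemma letterWt_mem_of_pos {l : T.Letter} (hl : T.Pos l) :
    T.letterWt l ∈ posAffineRoots H 𝔟 := by
  rcases hl with h | ⟨h, h'⟩
  · obtain ⟨n, hn⟩ := Int.eq_ofNat_of_zero_le h.le
    have hn0 : 0 < n := by omega
    have hw : T.letterWt l = finWt H (T.wt l.1) + n • delta H := by
      rw [letterWt, hn, natCast_zsmul]
    rcases T.wt_mem_roots l.1 with h0 | h0
    · refine Or.inr (Or.inr ⟨n, hn0, ?_⟩)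
      rw [hw, h0]; simp [finWt]
    · exact Or.inr (Or.inl ⟨_, h0, n, hn0, hw⟩)
  · refine Or.inl ⟨_, h', ?_⟩
    rw [letterWt, h, zero_smul, add_zero]

lemma neg_letterWt_mem_of_neg {l : T.Letter} (hl : T.Neg l) :
    -T.letterWt l ∈ posAffineRoots H 𝔟 := by
  rcases hl with h | ⟨h, h'⟩
  · obtain ⟨n, hn⟩ := Int.eq_ofNat_of_zero_le (neg_pos.2 h).le
    have hn0 : 0 < n := by omega
    have hw : -T.letterWt l = finWt H (-T.wt l.1) + n • delta H := by
      rw [letterWt, neg_add, ← neg_smul, hn, natCast_zsmul]; rfl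
    rcases T.wt_mem_roots l.1 with h0 | h0
    · refine Or.inr (Or.inr ⟨n, hn0, ?_⟩)
      rw [hw, h0]; simp [finWt]
    · exact Or.inr (Or.inl ⟨_, T.neg_mem_roots _ h0, n, hn0, hw⟩)
  · refine Or.inl ⟨_, h', ?_⟩
    rw [letterWt, h, zero_smul, add_zero]; rfl

lemma letter_mem_borelHat {l : T.Letter} (hl : T.Pos l) : T.letter l ∈ borelHat 𝔟 := by
  rcases hl with h | ⟨h, h'⟩
  · refine ⟨fun n hn => ?_, ?_⟩
    · simp [letter, Affine.mono_apply, show l.2 ≠ n by omega]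
    · simp [letter, Affine.mono_apply, h.ne']
  · refine ⟨fun n hn => ?_, ?_⟩
    · simp [letter, Affine.mono_apply, show l.2 ≠ n by omega]
    · simpa [letter, Affine.mono_apply, h] using T.vec_mem _ h'

lemma incl_mem_borelHat (T : Triangular H 𝔟) (h : CartanHat H) : CartanHat.incl H h ∈ borelHat 𝔟 := by
  refine ⟨fun n hn => ?_, ?_⟩
  · simp [CartanHat.incl, hn.ne']
  · simpa [CartanHat.incl] using T.cartan_le h.1.2

lemma mono_mem_span (n : ℤ) (x : 𝔤) :
    Affine.mono n x ∈ Submodule.span ℂ (Set.range fun i => T.letter (i, n)) := by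
  have hx : x ∈ Submodule.span ℂ (Set.range T.vec) := by rw [T.span_vec]; trivial
  have := Submodule.mem_map_of_mem (f := Affine.mono n) hx
  rw [Submodule.map_span, ← Set.range_comp] at this
  exact this

/-- The span of the Cartan subalgebra and a set of root vectors. -/
def cartanSpan (s : Set T.Letter) : Submodule ℂ (Affine 𝔤) :=
  Submodule.span ℂ (T.letter '' s ∪ Set.range (CartanHat.incl H))

lemma mem_cartanSpan_of_loop {s : Set T.Letter} {x : Affine 𝔤}
    (h : ∀ n, Affine.mono n (x.loop n) ∈ T.cartanSpan s) : x ∈ T.cartanSpan s := by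
  rw [Affine.eq_sum_mono H x]
  exact add_mem (sum_mem fun n _ => h n) (Submodule.subset_span (Or.inr ⟨_, rfl⟩))

lemma mono_mem_cartanSpan {s : Set T.Letter} {n : ℤ} (hs : ∀ i, (i, n) ∈ s) (x : 𝔤) :
    Affine.mono n x ∈ T.cartanSpan s := by
  refine Submodule.span_mono ?_ (T.mono_mem_span n x)
  rintro _ ⟨i, rfl⟩
  exact Or.inl ⟨_, hs i, rfl⟩

lemma mem_cartanSpan_univ (x : Affine 𝔤) : x ∈ T.cartanSpan Set.univ :=
  T.mem_cartanSpan_of_loop fun _ => T.mono_mem_cartanSpan (fun _ => Set.mem_univ _) _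

lemma mem_cartanSpan_of_mem_borelHat {x : Affine 𝔤} (hx : x ∈ borelHat 𝔟) :
    x ∈ T.cartanSpan {l | T.Pos l} := by
  refine T.mem_cartanSpan_of_loop fun n => ?_
  rcases lt_trichotomy n 0 with h | rfl | h
  · rw [hx.1 n h, map_zero]; exact zero_mem _
  · have := Submodule.mem_map_of_mem (f := Affine.mono 0) (T.borel_le hx.2)
    rw [Submodule.map_span] at this
    refine Submodule.span_le.2 ?_ this
    rintro _ ⟨_, ⟨i, hi, rfl⟩, rfl⟩
    rcases hi with hi | hi
    · exact Submodule.subset_span (Or.inr ⟨(⟨_, hi.2⟩, 0, 0), rfl⟩)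
    · exact Submodule.subset_span (Or.inl ⟨(i, 0), Or.inr ⟨rfl, hi⟩, rfl⟩)
  · exact T.mono_mem_cartanSpan (fun i => Or.inl h) _

lemma mem_cartanSpan_of_forall_lt {k : ℤ} {x : Affine 𝔤} (hx : ∀ n < k, x.loop n = 0) :
    x ∈ T.cartanSpan {l | k ≤ l.2} := by
  refine T.mem_cartanSpan_of_loop fun n => ?_
  rcases lt_or_ge n k with h | h
  · rw [hx n h, map_zero]; exact zero_mem _
  · exact T.mono_mem_cartanSpan (fun i => h) _

/-- The height of a weight, the real part of its value at a suitable element of the affine Cartan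
subalgebra. -/
def ht : Wt H →+ ℝ where
  toFun ν := (ν (T.ρ, 0, (T.period : ℂ))).re
  map_zero' := by simp
  map_add' x y := by simp

lemma ht_apply (ν : Wt H) : T.ht ν = (ν (T.ρ, 0, (T.period : ℂ))).re := rfl

lemma ht_finWt_add (α : Module.Dual ℂ H) (n : ℤ) :
    T.ht (finWt H α + n • delta H) = (α T.ρ).re + n * T.period := by
  simp [ht_apply, finWt, delta]

/-- For `α + nδ` with `n ≥ 1` the period outweighs a negative value of `α` at `ρ`; this is what
`abs_add_one_le` is for. -/
lemma one_le_ht {β : Wt H} (hβ : β ∈ posAffineRoots H 𝔟) : 1 ≤ T.ht β := by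
  have hp : (1 : ℝ) ≤ T.period := by exact_mod_cast T.one_le_period
  rcases hβ with ⟨α, hα, rfl⟩ | ⟨α, hα, n, hn, rfl⟩ | ⟨n, hn, rfl⟩
  · have := T.ht_finWt_add α 0
    simp only [zero_smul, add_zero, Int.cast_zero, zero_mul] at this
    rw [this]; exact T.one_le α hα
  · have := T.ht_finWt_add α n
    rw [natCast_zsmul] at this
    rw [this]
    have h1 := T.abs_add_one_le α hα
    have h2 := neg_abs_le (α T.ρ).re
    have h3 : (1 : ℝ) ≤ n := by exact_mod_cast hn
    push_cast
    nlinarith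
  · have := T.ht_finWt_add 0 n
    rw [natCast_zsmul] at this
    simp only [LinearMap.zero_apply, Complex.zero_re, zero_add] at this
    have h4 : finWt H (0 : Module.Dual ℂ H) = 0 := by simp [finWt]
    rw [h4, zero_add] at this
    rw [this]
    have h3 : (1 : ℝ) ≤ n := by exact_mod_cast hn
    push_cast
    nlinarith

lemma one_le_ht_of_pos {l : T.Letter} (hl : T.Pos l) : 1 ≤ T.ht (T.letterWt l) :=
  T.one_le_ht (T.letterWt_mem_of_pos hl)

lemma ht_le_of_neg {l : T.Letter} (hl : T.Neg l) : T.ht (T.letterWt l) ≤ -1 := by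
  have := T.one_le_ht (T.neg_letterWt_mem_of_neg hl)
  rw [map_neg] at this
  linarith

lemma eq_zero_or_one_le_ht {β : Wt H} (hβ : β ∈ AddSubmonoid.closure (posAffineRoots H 𝔟)) :
    β = 0 ∨ 1 ≤ T.ht β := by
  refine AddSubmonoid.closure_induction (motive := fun β _ => β = 0 ∨ 1 ≤ T.ht β)
    (fun β hβ => Or.inr (T.one_le_ht hβ)) (Or.inl rfl) ?_ hβ
  rintro x y - - (rfl | hx) (rfl | hy)
  · exact Or.inl (add_zero 0)
  · exact Or.inr (by rwa [zero_add])
  · exact Or.inr (by rwa [add_zero])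
  · right
    rw [map_add]; linarith

lemma eq_or_ht_lt {μ ν : Wt H} (h : WtLE H 𝔟 μ ν) : μ = ν ∨ T.ht μ < T.ht ν := by
  rcases T.eq_zero_or_one_le_ht h with h | h
  · exact Or.inl (sub_eq_zero.1 h).symm
  · right
    rw [map_sub] at h; linarith

lemma ht_le_ht {μ ν : Wt H} (h : WtLE H 𝔟 μ ν) : T.ht μ ≤ T.ht ν := by
  rcases T.eq_or_ht_lt h with rfl | h
  · exact le_rfl
  · exact h.le

lemma wtLE_antisymm (T : Triangular H 𝔟) {μ ν : Wt H} (h₁ : WtLE H 𝔟 μ ν) (h₂ : WtLE H 𝔟 ν μ) : μ = ν := by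
  rcases T.eq_or_ht_lt h₁ with h | h
  · exact h
  · exact absurd (T.ht_le_ht h₂) h.not_ge

lemma finite_letters_of_mem_Icc (a b : ℤ) : {l : T.Letter | l.2 ∈ Set.Icc a b}.Finite := by
  have := T.finite_ι
  refine ((Set.finite_univ (α := T.ι)).prod (Set.finite_Icc a b)).subset fun l hl => ?_
  exact ⟨trivial, hl⟩

lemma finite_letters (C : ℝ) : {l : T.Letter | |T.ht (T.letterWt l)| ≤ C}.Finite := by
  -- A degree of absolute value above `C + 1` would contribute more than `C + period` to the height,
  -- while the finite part changes the height by at most the period.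
  obtain ⟨N, hN⟩ := exists_nat_ge (C + 1)
  refine (T.finite_letters_of_mem_Icc (-N) N).subset fun l hl => ?_
  have hp : (1 : ℝ) ≤ T.period := by exact_mod_cast T.one_le_period
  have hl' : |((T.wt l.1) T.ρ).re + l.2 * T.period| ≤ C := by
    rw [← T.ht_finWt_add]; exact hl
  have hw : |((T.wt l.1) T.ρ).re| ≤ T.period := by
    rcases T.wt_mem_roots l.1 with h | h
    · rw [h]; simp
    · linarith [T.abs_add_one_le _ h]
  have h1 : |(l.2 : ℝ)| * T.period ≤ C + T.period := by
    have h2 : |(l.2 : ℝ)| * T.period = |(l.2 : ℝ) * T.period| := by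
      rw [abs_mul, abs_of_nonneg (by linarith : (0 : ℝ) ≤ T.period)]
    rw [h2]
    calc |(l.2 : ℝ) * T.period|
        = |(((T.wt l.1) T.ρ).re + l.2 * T.period) - ((T.wt l.1) T.ρ).re| := by ring_nf
      _ ≤ _ := (abs_sub _ _).trans (add_le_add hl' hw)
  have hC : 0 ≤ C := (abs_nonneg _).trans hl'
  have h3 : |(l.2 : ℝ)| ≤ N := by
    by_contra! hlt
    nlinarith
  have h4 := abs_le.1 h3
  exact ⟨by exact_mod_cast h4.1, by exact_mod_cast h4.2⟩

/-- The weight of a word in the root vectors. -/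
def wordWt (w : List T.Letter) : Wt H := (w.map T.letterWt).sum

@[simp] lemma wordWt_nil : T.wordWt [] = 0 := rfl

@[simp] lemma wordWt_cons (l : T.Letter) (w : List T.Letter) :
    T.wordWt (l :: w) = T.letterWt l + T.wordWt w := by simp [wordWt]

lemma wordWt_mem_closure {w : List T.Letter} (hw : ∀ l ∈ w, T.Pos l) :
    T.wordWt w ∈ AddSubmonoid.closure (posAffineRoots H 𝔟) := by
  induction w with
  | nil => exact zero_mem _
  | cons l w ih =>
    rw [wordWt_cons]
    exact add_mem (AddSubmonoid.subset_closure (T.letterWt_mem_of_pos (hw l (by simp))))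
      (ih fun l' hl' => hw l' (by simp [hl']))

lemma neg_wordWt_mem_closure {w : List T.Letter} (hw : ∀ l ∈ w, T.Neg l) :
    -T.wordWt w ∈ AddSubmonoid.closure (posAffineRoots H 𝔟) := by
  induction w with
  | nil => rw [wordWt_nil, neg_zero]; exact zero_mem _
  | cons l w ih =>
    rw [wordWt_cons, neg_add]
    exact add_mem (AddSubmonoid.subset_closure (T.neg_letterWt_mem_of_neg (hw l (by simp))))
      (ih fun l' hl' => hw l' (by simp [hl']))

/-- The sign `σ` treats positive and negative words at once. No cancellation occurs among the
heights, so the total bounds both the length and every letter. -/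
lemma length_le_and_abs_le {σ : ℝ} (hσ : |σ| = 1) (w : List T.Letter)
    (hw : ∀ l ∈ w, 1 ≤ σ * T.ht (T.letterWt l)) :
    (w.length : ℝ) ≤ σ * T.ht (T.wordWt w) ∧
      ∀ l ∈ w, |T.ht (T.letterWt l)| ≤ σ * T.ht (T.wordWt w) := by
  induction w with
  | nil => simp
  | cons l w ih =>
    obtain ⟨h1, h2⟩ := ih fun l' hl' => hw l' (by simp [hl'])
    have h3 := hw l (by simp)
    have h4 : |T.ht (T.letterWt l)| = σ * T.ht (T.letterWt l) := by
      rw [← abs_of_nonneg (by linarith : 0 ≤ σ * T.ht (T.letterWt l)), abs_mul, hσ, one_mul]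
    have h5 : (0 : ℝ) ≤ w.length := Nat.cast_nonneg _
    rw [wordWt_cons, map_add, mul_add]
    refine ⟨by push_cast [List.length_cons]; linarith, fun l' hl' => ?_⟩
    rcases List.mem_cons.1 hl' with rfl | hl'
    · linarith
    · linarith [h2 l' hl']

/-- There are only finitely many words of bounded height in letters on which a given sign times
the height is at least one. -/
lemma finite_words {σ : ℝ} (hσ : |σ| = 1) (C : ℝ) :
    {w : List T.Letter | (∀ l ∈ w, 1 ≤ σ * T.ht (T.letterWt l)) ∧
      σ * T.ht (T.wordWt w) ≤ C}.Finite := by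
  obtain ⟨n, hn⟩ := exists_nat_ge C
  refine (finite_lists (T.finite_letters C) n).subset fun w hw => ?_
  obtain ⟨h1, h2⟩ := T.length_le_and_abs_le hσ w hw.1
  exact ⟨fun l hl => (h2 l hl).trans hw.2, by exact_mod_cast (h1.trans hw.2).trans hn⟩

end Triangular

end Letters

/-! ### Modules over the affine algebra -/

section Action

variable {𝔤 : Type v} [LieRing 𝔤] [LieAlgebra ℂ 𝔤] (A : Type u) [CommRing A] [Algebra ℂ A]
  (M : Type w) [AddCommGroup M] [Module A M] [LieRingModule (AffineOver 𝔤 A) M]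
  [LieModule A (AffineOver 𝔤 A) M]

/-- The action of an element of the affine algebra, as an `A`-linear map. -/
def act (x : Affine 𝔤) : M →ₗ[A] M :=
  LieModule.toEnd A (AffineOver 𝔤 A) M ((1 : A) ⊗ₜ[ℂ] x)

variable {M}

lemma act_apply (x : Affine 𝔤) (m : M) : act A M x m = ⁅(1 : A) ⊗ₜ[ℂ] x, m⁆ := rfl

lemma act_add (x y : Affine 𝔤) (m : M) : act A M (x + y) m = act A M x m + act A M y m := by
  simp only [act_apply, TensorProduct.tmul_add, add_lie]

lemma act_zero (m : M) : act A M (0 : Affine 𝔤) m = 0 := by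
  simp only [act_apply, TensorProduct.tmul_zero, zero_lie]

lemma tmul_lie (a : A) (x : Affine 𝔤) (m : M) : ⁅a ⊗ₜ[ℂ] x, m⁆ = a • act A M x m := by
  rw [act_apply, ← smul_lie, TensorProduct.smul_tmul', smul_eq_mul, mul_one]

lemma act_smul (c : ℂ) (x : Affine 𝔤) (m : M) :
    act A M (c • x) m = algebraMap ℂ A c • act A M x m := by
  rw [act_apply, ← tmul_lie, ← TensorProduct.smul_tmul, Algebra.smul_def, mul_one]

lemma act_act (x y : Affine 𝔤) (m : M) :
    act A M x (act A M y m) = act A M ⁅x, y⁆ m + act A M y (act A M x m) := by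
  have := leibniz_lie ((1 : A) ⊗ₜ[ℂ] x) ((1 : A) ⊗ₜ[ℂ] y) m
  rwa [LieAlgebra.ExtendScalars.bracket_tmul, mul_one] at this

/-- The elements of the affine algebra that map one submodule to another. -/
def transporter (N N' : Submodule A M) : Submodule ℂ (Affine 𝔤) where
  carrier := {x | ∀ n ∈ N, act A M x n ∈ N'}
  add_mem' hx hy n hn := by rw [act_add]; exact add_mem (hx n hn) (hy n hn)
  zero_mem' n _ := by rw [act_zero]; exact zero_mem _
  smul_mem' c x hx n hn := by rw [act_smul]; exact N'.smul_mem _ (hx n hn)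

variable {A}

/-- A submodule that is stable under the affine algebra is a Lie submodule. -/
def lieSubmoduleOfAct (N : Submodule A M) (h : ∀ x : Affine 𝔤, ∀ n ∈ N, act A M x n ∈ N) :
    LieSubmodule A (AffineOver 𝔤 A) M :=
  { N with
    lie_mem := fun {x n} hn => by
      induction x using TensorProduct.induction_on with
      | zero => rw [zero_lie]; exact N.zero_mem
      | tmul a x => rw [tmul_lie]; exact N.smul_mem _ (h x n hn)
      | add x y hx hy => rw [add_lie]; exact N.add_mem hx hy }

@[simp] lemma mem_lieSubmoduleOfAct {N : Submodule A M}
    {h : ∀ x : Affine 𝔤, ∀ n ∈ N, act A M x n ∈ N} {m : M} :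
    m ∈ lieSubmoduleOfAct N h ↔ m ∈ N := Iff.rfl

lemma act_mem (N : LieSubmodule A (AffineOver 𝔤 A) M) (x : Affine 𝔤) {n : M} (hn : n ∈ N) :
    act A M x n ∈ N := N.lie_mem hn

variable {N : Type*} [AddCommGroup N] [Module A N] [LieRingModule (AffineOver 𝔤 A) N]
  [LieModule A (AffineOver 𝔤 A) N]

lemma map_act (f : M →ₗ⁅A, AffineOver 𝔤 A⁆ N) (x : Affine 𝔤) (m : M) :
    f (act A M x m) = act A N x (f m) := LieModuleHom.map_lie f _ _

/-- A linear map that commutes with the affine algebra is a homomorphism of Lie modules. -/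
def lieModuleHomOfAct (f : M →ₗ[A] N)
    (h : ∀ (x : Affine 𝔤) (m : M), f (act A M x m) = act A N x (f m)) :
    M →ₗ⁅A, AffineOver 𝔤 A⁆ N :=
  { f with
    map_lie' := fun {x m} => by
      change f ⁅x, m⁆ = ⁅x, f m⁆
      induction x using TensorProduct.induction_on with
      | zero => rw [zero_lie, zero_lie, map_zero]
      | tmul a x => rw [tmul_lie, tmul_lie, map_smul, h]
      | add x y hx hy => rw [add_lie, add_lie, map_add, hx, hy] }

end Action

/-! ### Weight spaces over a deformation algebra -/

section WeightSpaces

variable {𝔤 : Type v} [LieRing 𝔤] [LieAlgebra ℂ 𝔤] {H : LieSubalgebra ℂ 𝔤}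
  {A : Type u} [CommRing A] [Algebra ℂ A]
  [Algebra (SymmetricAlgebra ℂ H) A] [IsScalarTower ℂ (SymmetricAlgebra ℂ H) A]
  {M : Type w} [AddCommGroup M] [Module A M] [LieRingModule (AffineOver 𝔤 A) M]
  [LieModule A (AffineOver 𝔤 A) M]
  {N : Type*} [AddCommGroup N] [Module A N] [LieRingModule (AffineOver 𝔤 A) N]
  [LieModule A (AffineOver 𝔤 A) N]

lemma mem_weightSpace {ν : Wt H} {m : M} : m ∈ weightSpace H A M ν ↔
    ∀ h : CartanHat H, act A M (CartanHat.incl H h) m = char H A ν h • m := Iff.rfl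

lemma char_add (β ν : Wt H) (h : CartanHat H) :
    char H A (β + ν) h = algebraMap ℂ A (β h) + char H A ν h := by
  simp [char, add_assoc]

lemma act_mem_weightSpace {x : Affine 𝔤} {β ν : Wt H}
    (hx : ∀ h : CartanHat H, ⁅CartanHat.incl H h, x⁆ = β h • x) {m : M}
    (hm : m ∈ weightSpace H A M ν) : act A M x m ∈ weightSpace H A M (β + ν) := by
  intro h
  have h1 := act_act A (CartanHat.incl H h) x m
  rw [mem_weightSpace.1 hm h, hx, act_smul, map_smul, ← add_smul, ← char_add] at h1
  exact h1

lemma map_mem_weightSpace (f : M →ₗ⁅A, AffineOver 𝔤 A⁆ N) {ν : Wt H} {m : M}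
    (hm : m ∈ weightSpace H A M ν) : f m ∈ weightSpace H A N ν := by
  intro h
  have := congrArg f (hm h)
  rwa [LieModuleHom.map_lie, map_smul] at this

lemma mem_weightSpace_of_injective (f : M →ₗ⁅A, AffineOver 𝔤 A⁆ N)
    (hf : Function.Injective f) {ν : Wt H} {m : M} (hm : f m ∈ weightSpace H A N ν) :
    m ∈ weightSpace H A M ν := by
  intro h
  apply hf
  rw [LieModuleHom.map_lie, map_smul]
  exact hm h

/-- The deformation `τ` cancels in the difference, leaving a nonzero complex number. Eigenspace
arguments over a field thus carry over to any `A`. -/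
lemma exists_sub_isUnit {ν ν' : Wt H} (h : ν ≠ ν') :
    ∃ x : CartanHat H, IsUnit (char H A ν x - char H A ν' x) := by
  obtain ⟨x, hx⟩ : ∃ x, ν x ≠ ν' x := by
    by_contra! hx
    exact h (LinearMap.ext hx)
  refine ⟨x, ?_⟩
  have : char H A ν x - char H A ν' x = algebraMap ℂ A (ν x - ν' x) := by
    simp [char]
  rw [this]
  exact (IsUnit.mk0 _ (sub_ne_zero.2 hx)).map _

/-- A submodule that is stable under the affine Cartan subalgebra contains the homogeneous
components of its elements. -/
lemma mem_of_add_sum_mem {P : Submodule A M}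
    (hP : ∀ (h : CartanHat H), ∀ n ∈ P, act A M (CartanHat.incl H h) n ∈ P) {ν : Wt H}
    (F : Finset (Wt H)) : ∀ (m₀ : M) (m : Wt H → M), ν ∉ F → m₀ ∈ weightSpace H A M ν →
      (∀ ν', m ν' ∈ weightSpace H A M ν') → m₀ + ∑ ν' ∈ F, m ν' ∈ P → m₀ ∈ P := by
  classical
  induction F using Finset.induction_on with
  | empty => intro m₀ m _ _ _ h; simpa using h
  | insert κ F hκ ih =>
    intro m₀ m hν hm₀ hm hmem
    obtain ⟨x, hx⟩ := exists_sub_isUnit (A := A) (show ν ≠ κ by rintro rfl; simp at hν)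
    -- Apply `x` minus the scalar by which it acts in weight `κ`: the `κ`-component disappears and
    -- `m₀` is multiplied by a unit.
    have key : (char H A ν x - char H A κ x) • m₀ ∈ P := by
      refine ih _ (fun ν' => (char H A ν' x - char H A κ x) • m ν')
        (fun h => hν (Finset.mem_insert_of_mem h)) (Submodule.smul_mem _ _ hm₀)
        (fun ν' => Submodule.smul_mem _ _ (hm ν')) ?_
      have h1 := P.sub_mem (hP x _ hmem) (P.smul_mem (char H A κ x) hmem)
      rw [Finset.sum_insert hκ] at h1
      simp only [map_add, map_sum, smul_add, Finset.smul_sum, mem_weightSpace.1 hm₀ x,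
        mem_weightSpace.1 (hm _) x] at h1
      convert h1 using 1
      simp only [sub_smul, Finset.sum_sub_distrib]
      abel
    obtain ⟨u, hu⟩ := hx
    rw [← hu] at key
    have := P.smul_mem (↑u⁻¹ : A) key
    rwa [smul_smul, Units.inv_mul, one_smul] at this

lemma iSupIndep_weightSpace : iSupIndep fun ν : Wt H => weightSpace H A M ν := by
  classical
  intro ν
  rw [Submodule.disjoint_def]
  intro x hx hx'
  obtain ⟨f, hf, rfl⟩ := (Submodule.mem_iSup_iff_exists_finsupp _ _).1 hx'
  have hf' : ∀ κ, f κ ∈ weightSpace H A M κ := fun κ => by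
    by_cases h : κ = ν
    · have := hf κ; simp [h] at this; rw [h, this]; exact zero_mem _
    · have := hf κ; simpa [h] using this
  have hν : ν ∉ f.support := by
    have := hf ν; simp at this; simpa using this
  have := mem_of_add_sum_mem (P := (⊥ : Submodule A M)) (fun h n hn => by
      rw [Submodule.mem_bot] at hn ⊢; rw [hn, map_zero]) f.support (-(f.sum fun _ m => m)) f hν
      (Submodule.neg_mem _ hx) hf' (by rw [Finsupp.sum]; simp)
  simpa using this

lemma isWeightModule_iff : IsWeightModule H A M ↔ ⨆ ν : Wt H, weightSpace H A M ν = ⊤ := by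
  classical
  have : IsWeightModule H A M ↔ DirectSum.IsInternal fun ν : Wt H => weightSpace H A M ν := by
    unfold IsWeightModule; convert Iff.rfl
  rw [this, DirectSum.isInternal_submodule_iff_iSupIndep_and_iSup_eq_top]
  exact and_iff_right iSupIndep_weightSpace

lemma IsWeightModule.exists_sum (hM : IsWeightModule H A M) (m : M) :
    ∃ f : Wt H →₀ M, (∀ ν, f ν ∈ weightSpace H A M ν) ∧ ∑ ν ∈ f.support, f ν = m := by
  have : m ∈ ⨆ ν : Wt H, weightSpace H A M ν := by rw [isWeightModule_iff.1 hM]; trivial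
  exact (Submodule.mem_iSup_iff_exists_finsupp _ _).1 this

lemma mem_of_sum_mem {P : Submodule A M}
    (hP : ∀ (h : CartanHat H), ∀ n ∈ P, act A M (CartanHat.incl H h) n ∈ P)
    {F : Finset (Wt H)} {m : Wt H → M} (hm : ∀ ν, m ν ∈ weightSpace H A M ν)
    (h : ∑ ν ∈ F, m ν ∈ P) {ν : Wt H} (hν : ν ∈ F) : m ν ∈ P := by
  classical
  rw [← Finset.add_sum_erase F m hν] at h
  exact mem_of_add_sum_mem hP (F.erase ν) (m ν) m (Finset.notMem_erase _ _) (hm ν) hm h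

/-- Weight vectors lift along surjections from weight modules. -/
lemma IsWeightModule.exists_lift (hM : IsWeightModule H A M) (f : M →ₗ⁅A, AffineOver 𝔤 A⁆ N)
    (hf : Function.Surjective f) {ν : Wt H} {n : N} (hn : n ∈ weightSpace H A N ν) :
    ∃ m ∈ weightSpace H A M ν, f m = n := by
  classical
  obtain ⟨x, rfl⟩ := hf n
  obtain ⟨g, hg, rfl⟩ := hM.exists_sum x
  refine ⟨g ν, hg ν, ?_⟩
  have h0 : f (g ν) - f (∑ ν ∈ g.support, g ν) ∈ (⊥ : Submodule A N) := by
    refine mem_of_add_sum_mem (H := H) (fun h n hn => ?_) (g.support.erase ν) _ (fun κ => f (g κ))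
      (Finset.notMem_erase _ _)
      (Submodule.sub_mem _ (map_mem_weightSpace f (hg ν)) hn)
      (fun κ => map_mem_weightSpace f (hg κ)) ?_
    · rw [Submodule.mem_bot] at hn ⊢; rw [hn, map_zero]
    · by_cases hν : ν ∈ g.support
      · rw [← Finset.add_sum_erase _ _ hν, map_add, map_sum]
        simp
      · have : g ν = 0 := by simpa using hν
        rw [this, Finset.erase_eq_of_notMem hν, map_sum]
        simp
  exact sub_eq_zero.1 h0

lemma IsWeightModule.of_surjective (hM : IsWeightModule H A M) (f : M →ₗ⁅A, AffineOver 𝔤 A⁆ N)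
    (hf : Function.Surjective f) : IsWeightModule H A N := by
  rw [isWeightModule_iff, eq_top_iff]
  intro n _
  obtain ⟨m, rfl⟩ := hf n
  obtain ⟨g, hg, rfl⟩ := hM.exists_sum m
  rw [map_sum]
  exact sum_mem fun ν _ => Submodule.mem_iSup_of_mem ν (map_mem_weightSpace f (hg ν))

/-- The range is stable under the Cartan subalgebra, so it contains the homogeneous components of
its elements; these pull back to weight vectors. -/
lemma IsWeightModule.of_injective (hN : IsWeightModule H A N) (f : M →ₗ⁅A, AffineOver 𝔤 A⁆ N)
    (hf : Function.Injective f) : IsWeightModule H A M := by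
  rw [isWeightModule_iff, eq_top_iff]
  intro m _
  obtain ⟨g, hg, hgm⟩ := hN.exists_sum (f m)
  have hmem : ∀ ν ∈ g.support, g ν ∈ f.range.toSubmodule := fun ν hν =>
    mem_of_sum_mem (H := H) (fun h n hn => act_mem f.range _ hn) hg (hgm ▸ ⟨m, rfl⟩) hν
  choose! y hy using hmem
  have : m = ∑ ν ∈ g.support, y ν := by
    apply hf
    rw [map_sum, ← hgm]
    exact Finset.sum_congr rfl fun ν hν => (hy ν hν).symm
  rw [this]
  refine sum_mem fun ν hν => Submodule.mem_iSup_of_mem ν (mem_weightSpace_of_injective f hf ?_)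
  have h1 : f (y ν) = g ν := hy ν hν
  rw [h1]
  exact hg ν

variable {𝔟 : LieSubalgebra ℂ 𝔤} {J : Set (Wt H)}

lemma InOJ.of_surjective (hM : InOJ H 𝔟 A M J) (f : M →ₗ⁅A, AffineOver 𝔤 A⁆ N)
    (hf : Function.Surjective f) : InOJ H 𝔟 A N J where
  isWeightModule := hM.isWeightModule.of_surjective f hf
  isLocallyBorelFinite n := by
    obtain ⟨m, rfl⟩ := hf n
    obtain ⟨P, hmP, hfg, hP⟩ := hM.isLocallyBorelFinite m
    refine ⟨P.map (f : M →ₗ[A] N), ⟨m, hmP, rfl⟩, hfg.map _, ?_⟩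
    rintro x hx _ ⟨p, hp, rfl⟩
    exact ⟨_, hP x hx p hp, LieModuleHom.map_lie f _ _⟩
  weight_mem ν hν := by
    obtain ⟨n, hn, hn0⟩ := (Submodule.ne_bot_iff _).1 hν
    obtain ⟨m, hm, rfl⟩ := hM.isWeightModule.exists_lift f hf hn
    refine hM.weight_mem ν ((Submodule.ne_bot_iff _).2 ⟨m, hm, fun h => hn0 ?_⟩)
    rw [h, map_zero]

/-- The Noetherian hypothesis makes the intersection of a finitely generated stable submodule with
the image finitely generated again. -/
lemma InOJ.of_injective [IsNoetherianRing A] (hN : InOJ H 𝔟 A N J)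
    (f : M →ₗ⁅A, AffineOver 𝔤 A⁆ N) (hf : Function.Injective f) : InOJ H 𝔟 A M J where
  isWeightModule := hN.isWeightModule.of_injective f hf
  isLocallyBorelFinite m := by
    obtain ⟨P, hmP, hfg, hP⟩ := hN.isLocallyBorelFinite (f m)
    refine ⟨P.comap (f : M →ₗ[A] N), hmP, ?_, ?_⟩
    · have := isNoetherian_of_fg_of_noetherian P hfg
      refine Submodule.fg_of_fg_map_injective (f : M →ₗ[A] N) hf ?_
      exact Submodule.FG.of_le hfg (Submodule.map_comap_le _ _)
    · intro x hx p hp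
      have := hP x hx _ hp
      rw [Submodule.mem_comap]
      change f _ ∈ P
      rw [LieModuleHom.map_lie]
      exact this
  weight_mem ν hν := by
    obtain ⟨m, hm, hm0⟩ := (Submodule.ne_bot_iff _).1 hν
    exact hN.weight_mem ν ((Submodule.ne_bot_iff _).2
      ⟨f m, map_mem_weightSpace f hm, fun h => hm0 (hf (by rw [h, map_zero]))⟩)

end WeightSpaces

/-! ### Finiteness properties of cyclic modules -/

section Finiteness

variable {𝔤 : Type v} [LieRing 𝔤] [LieAlgebra ℂ 𝔤] {H 𝔟 : LieSubalgebra ℂ 𝔤}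
  [LieRing.IsNilpotent H] (T : Triangular H 𝔟)
  {A : Type u} [CommRing A] [Algebra ℂ A]
  [Algebra (SymmetricAlgebra ℂ H) A] [IsScalarTower ℂ (SymmetricAlgebra ℂ H) A]
  {M : Type w} [AddCommGroup M] [Module A M] [LieRingModule (AffineOver 𝔤 A) M]
  [LieModule A (AffineOver 𝔤 A) M]

/-- The `D`-components contribute the Euler derivatives of `x` and `y`, whose degrees are bounded
below only by `a` and `b`; the signs of `a` and `b` make `a + b` a bound for these too. -/
lemma Affine.loop_lie_eq_zero {x y : Affine 𝔤} {a b : ℤ} (ha : a ≤ 0) (hb : b ≤ 0)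
    (hx : ∀ n < a, x.loop n = 0) (hy : ∀ n < b, y.loop n = 0) :
    ∀ n < a + b, ⁅x, y⁆.loop n = 0 := by
  intro n hn
  have h1 : Loop.br 𝔤 x.loop y.loop n = 0 := by
    rw [Loop.br_apply]
    refine Finset.sum_eq_zero fun i _ => Finset.sum_eq_zero fun j _ => ?_
    split_ifs with h
    · rcases (by omega : i < a ∨ j < b) with h' | h'
      · rw [hx i h', zero_lie]
      · rw [hy j h', lie_zero]
    · rfl
  simp [Loop.euler_apply, h1, hx n (by omega), hy n (by omega)]

/-- If `M` is spanned by weight vectors, then its weight spaces are spanned by those of the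
appropriate weight. -/
lemma weightSpace_le_span {κ : Type*} {g : κ → M} {d : κ → Wt H}
    (hg : ∀ k, g k ∈ weightSpace H A M (d k)) (hspan : Submodule.span A (Set.range g) = ⊤)
    (ν : Wt H) : weightSpace H A M ν ≤ Submodule.span A (g '' {k | d k = ν}) := by
  classical
  intro m hm
  let P : Wt H → Submodule A M := fun κ => Submodule.span A (g '' {k | d k = κ})
  have hP : ∀ κ, P κ ≤ weightSpace H A M κ := fun κ => Submodule.span_le.2 (by
    rintro _ ⟨k, rfl, rfl⟩; exact hg k)
  have htop : m ∈ ⨆ κ, P κ := by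
    have : Submodule.span A (Set.range g) ≤ ⨆ κ, P κ := Submodule.span_le.2 (by
      rintro _ ⟨k, rfl⟩
      exact Submodule.mem_iSup_of_mem (d k) (Submodule.subset_span ⟨k, rfl, rfl⟩))
    exact this (hspan ▸ Submodule.mem_top)
  obtain ⟨f, hf, rfl⟩ := (Submodule.mem_iSup_iff_exists_finsupp _ _).1 htop
  have h0 : f.sum (fun _ m => m) - f ν ∈ (⊥ : Submodule A M) := by
    refine mem_of_add_sum_mem (H := H) (fun h n hn => ?_) (f.support.erase ν) _
      (fun κ => -f κ) (Finset.notMem_erase _ _)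
      (Submodule.sub_mem _ hm (hP _ (hf ν))) (fun κ => Submodule.neg_mem _ (hP _ (hf κ))) ?_
    · rw [Submodule.mem_bot] at hn ⊢; rw [hn, map_zero]
    · rw [Finset.sum_neg_distrib, Submodule.mem_bot, Finsupp.sum]
      by_cases hν : ν ∈ f.support
      · rw [← Finset.add_sum_erase _ _ hν]; abel
      · have : f ν = 0 := by simpa using hν
        rw [this, Finset.erase_eq_of_notMem hν]; abel
  rw [sub_eq_zero.1 ((Submodule.mem_bot A).1 h0)]
  exact hf ν

lemma isWeightModule_of_span {κ : Type*} {g : κ → M} {d : κ → Wt H}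
    (hg : ∀ k, g k ∈ weightSpace H A M (d k)) (hspan : Submodule.span A (Set.range g) = ⊤) :
    IsWeightModule H A M := by
  rw [isWeightModule_iff, eq_top_iff, ← hspan, Submodule.span_le]
  rintro _ ⟨k, rfl⟩
  exact Submodule.mem_iSup_of_mem (d k) (hg k)

namespace Triangular

variable (A M) in
/-- The action of a word in the root vectors. -/
def word (w : List T.Letter) : M →ₗ[A] M :=
  (w.map fun l => act A M (T.letter l)).prod

lemma word_nil (m : M) : T.word A M [] m = m := by simp [word]

lemma word_cons (l : T.Letter) (w : List T.Letter) (m : M) :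
    T.word A M (l :: w) m = act A M (T.letter l) (T.word A M w m) := by simp [word]

lemma word_mem_weightSpace (w : List T.Letter) {ν : Wt H} {m : M}
    (hm : m ∈ weightSpace H A M ν) : T.word A M w m ∈ weightSpace H A M (T.wordWt w + ν) := by
  induction w with
  | nil => simpa [word_nil] using hm
  | cons l w ih =>
    rw [word_cons, wordWt_cons, add_assoc]
    exact act_mem_weightSpace (fun h => T.lie_incl_letter h l) ih

lemma cartanSpan_le {s : Set T.Letter} {P : Submodule ℂ (Affine 𝔤)}
    (h₁ : ∀ l ∈ s, T.letter l ∈ P) (h₂ : ∀ h, CartanHat.incl H h ∈ P) : T.cartanSpan s ≤ P := by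
  refine Submodule.span_le.2 ?_
  rintro _ (⟨l, hl, rfl⟩ | ⟨h, rfl⟩)
  exacts [h₁ l hl, h₂ h]

lemma act_mem_of_mem_borelHat {N : Submodule A M}
    (h₁ : ∀ l, T.Pos l → ∀ n ∈ N, act A M (T.letter l) n ∈ N)
    (h₂ : ∀ h, ∀ n ∈ N, act A M (CartanHat.incl H h) n ∈ N) {x : Affine 𝔤}
    (hx : x ∈ borelHat 𝔟) : ∀ n ∈ N, act A M x n ∈ N :=
  T.cartanSpan_le (P := transporter A N N) h₁ h₂ (T.mem_cartanSpan_of_mem_borelHat hx)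

lemma act_mem_span_of_forall {s : Set M} (x : Affine 𝔤) {N : Submodule A M}
    (h : ∀ m ∈ s, act A M x m ∈ N) : ∀ m ∈ Submodule.span A s, act A M x m ∈ N := by
  intro m hm
  have : Submodule.span A s ≤ N.comap (act A M x) := Submodule.span_le.2 h
  exact this hm

/-- A module generated by weight vectors with `𝔟`-stable span is spanned by their images under
the words in the negative root vectors. -/
lemma span_neg_words {κ : Type*} {n : κ → M}
    (hN : ∀ x ∈ borelHat 𝔟, ∀ m ∈ Submodule.span A (Set.range n),
      act A M x m ∈ Submodule.span A (Set.range n))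
    (hgen : LieSubmodule.lieSpan A (AffineOver 𝔤 A) (Set.range n) = ⊤) :
    Submodule.span A (Set.range fun p : {w : List T.Letter // ∀ l ∈ w, T.Neg l} × κ =>
      T.word A M p.1.1 (n p.2)) = ⊤ := by
  set S := Submodule.span A (Set.range fun p : {w : List T.Letter // ∀ l ∈ w, T.Neg l} × κ =>
      T.word A M p.1.1 (n p.2)) with hS
  have hword : ∀ w : List T.Letter, (∀ l ∈ w, T.Neg l) →
      ∀ m ∈ Submodule.span A (Set.range n), T.word A M w m ∈ S := by
    intro w hw m hm
    have : Submodule.span A (Set.range n) ≤ S.comap (T.word A M w) := by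
      refine Submodule.span_le.2 ?_
      rintro _ ⟨k, rfl⟩
      exact Submodule.subset_span ⟨(⟨w, hw⟩, k), rfl⟩
    exact this hm
  have hneg : ∀ l, T.Neg l → ∀ m ∈ S, act A M (T.letter l) m ∈ S := by
    intro l hl
    refine act_mem_span_of_forall _ ?_
    rintro _ ⟨⟨⟨w, hw⟩, k⟩, rfl⟩
    rw [← word_cons]
    refine Submodule.subset_span ⟨(⟨l :: w, ?_⟩, k), rfl⟩
    intro l' hl'
    rcases List.mem_cons.1 hl' with rfl | h
    exacts [hl, hw _ h]
  -- Moving `x` past a negative letter produces a commutator that is some other element of the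
  -- affine algebra. Keeping `x` arbitrary in the induction on the word absorbs it, and no ordered
  -- monomials are needed.
  have key : ∀ w : List T.Letter, (∀ l ∈ w, T.Neg l) → ∀ (x : Affine 𝔤),
      ∀ m ∈ Submodule.span A (Set.range n), act A M x (T.word A M w m) ∈ S := by
    intro w
    induction w with
    | nil =>
      intro _ x
      have : ∀ x : Affine 𝔤, x ∈ transporter A (Submodule.span A (Set.range n)) S := by
        intro x
        refine T.cartanSpan_le (fun l _ => ?_) (fun h => ?_) (T.mem_cartanSpan_univ x)
        · have hb : ∀ y ∈ borelHat 𝔟, y ∈ transporter A (Submodule.span A (Set.range n)) S := by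
            intro y hy m hm
            simpa [word_nil] using hword [] (by simp) _ (hN y hy m hm)
          rcases T.pos_or_neg_or_mem l with hl | hl | ⟨h, hl⟩
          · exact hb _ (T.letter_mem_borelHat hl)
          · intro m hm
            simpa [word_nil] using hneg l hl _ (hword [] (by simp) m hm)
          · rw [hl]; exact hb _ (T.incl_mem_borelHat h)
        · intro m hm
          simpa [word_nil] using hword [] (by simp) _ (hN _ (T.incl_mem_borelHat h) m hm)
      intro m hm
      rw [word_nil]
      exact this x m hm
    | cons l w ih =>
      intro hw x m hm
      have hw' : ∀ l ∈ w, T.Neg l := fun l' hl' => hw l' (by simp [hl'])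
      rw [word_cons, act_act]
      exact add_mem (ih hw' _ m hm) (hneg l (hw l (by simp)) _ (ih hw' x m hm))
  have hstab : ∀ x : Affine 𝔤, ∀ m ∈ S, act A M x m ∈ S := by
    intro x
    refine act_mem_span_of_forall _ ?_
    rintro _ ⟨⟨⟨w, hw⟩, k⟩, rfl⟩
    exact key w hw x _ (Submodule.subset_span ⟨k, rfl⟩)
  have hle : LieSubmodule.lieSpan A (AffineOver 𝔤 A) (Set.range n) ≤
      lieSubmoduleOfAct S hstab := by
    refine LieSubmodule.lieSpan_le.2 ?_
    rintro _ ⟨k, rfl⟩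
    simpa [word_nil] using hword [] (by simp) _ (Submodule.subset_span ⟨k, rfl⟩)
  rw [hgen] at hle
  exact eq_top_iff.2 fun m _ => hle (LieSubmodule.mem_top m)

section Generated

variable {κ : Type*} {n : κ → M} {d : κ → Wt H}

lemma isWeightModule_of_generated (T : Triangular H 𝔟)
    (hn : ∀ k, n k ∈ weightSpace H A M (d k))
    (hN : ∀ x ∈ borelHat 𝔟, ∀ m ∈ Submodule.span A (Set.range n),
      act A M x m ∈ Submodule.span A (Set.range n))
    (hgen : LieSubmodule.lieSpan A (AffineOver 𝔤 A) (Set.range n) = ⊤) :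
    IsWeightModule H A M :=
  isWeightModule_of_span
    (d := fun p : {w : List T.Letter // ∀ l ∈ w, T.Neg l} × κ => T.wordWt p.1.1 + d p.2)
    (fun p => T.word_mem_weightSpace _ (hn p.2)) (T.span_neg_words hN hgen)

lemma weightSpace_le_of_generated
    (hn : ∀ k, n k ∈ weightSpace H A M (d k))
    (hN : ∀ x ∈ borelHat 𝔟, ∀ m ∈ Submodule.span A (Set.range n),
      act A M x m ∈ Submodule.span A (Set.range n))
    (hgen : LieSubmodule.lieSpan A (AffineOver 𝔤 A) (Set.range n) = ⊤) (ν : Wt H) :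
    weightSpace H A M ν ≤ Submodule.span A
      ((fun p : {w : List T.Letter // ∀ l ∈ w, T.Neg l} × κ => T.word A M p.1.1 (n p.2)) ''
        {p | T.wordWt p.1.1 + d p.2 = ν}) :=
  weightSpace_le_span
    (d := fun p : {w : List T.Letter // ∀ l ∈ w, T.Neg l} × κ => T.wordWt p.1.1 + d p.2)
    (fun p => T.word_mem_weightSpace _ (hn p.2)) (T.span_neg_words hN hgen) ν

lemma exists_wtLE_of_generated (T : Triangular H 𝔟)
    (hn : ∀ k, n k ∈ weightSpace H A M (d k))
    (hN : ∀ x ∈ borelHat 𝔟, ∀ m ∈ Submodule.span A (Set.range n),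
      act A M x m ∈ Submodule.span A (Set.range n))
    (hgen : LieSubmodule.lieSpan A (AffineOver 𝔤 A) (Set.range n) = ⊤) {ν : Wt H}
    (hν : weightSpace H A M ν ≠ ⊥) : ∃ k, WtLE H 𝔟 ν (d k) := by
  by_contra! h
  refine hν (eq_bot_iff.2 ((T.weightSpace_le_of_generated hn hN hgen ν).trans ?_))
  rw [Submodule.span_le]
  rintro _ ⟨⟨⟨w, hw⟩, k⟩, hwk, rfl⟩
  refine absurd ?_ (h k)
  rw [WtLE, ← hwk]
  simpa using T.neg_wordWt_mem_closure hw

/-- Each negative letter lowers the height by at least one, and the starting heights are bounded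
because `κ` is finite. -/
lemma finite_neg_words [Finite κ] (d : κ → Wt H) (ν : Wt H) :
    {p : {w : List T.Letter // ∀ l ∈ w, T.Neg l} × κ | T.wordWt p.1.1 + d p.2 = ν}.Finite := by
  obtain ⟨C, hC⟩ := (Set.finite_range fun k => T.ht (d k)).bddAbove
  have hfin := T.finite_words (σ := -1) (by simp) (C - T.ht ν)
  have hfin' := hfin.prod (Set.finite_univ (α := κ))
  refine Set.Finite.of_finite_image (f := fun p => (p.1.1, p.2)) (hfin'.subset ?_) ?_
  · rintro _ ⟨⟨⟨w, hw⟩, k⟩, hwk, rfl⟩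
    refine ⟨⟨fun l hl => ?_, ?_⟩, Set.mem_univ _⟩
    · linarith [T.ht_le_of_neg (hw l hl)]
    · have h1 : T.ht (T.wordWt w) + T.ht (d k) = T.ht ν := by
        rw [← map_add]; exact congrArg T.ht hwk
      have h2 : T.ht (d k) ≤ C := hC ⟨k, rfl⟩
      change -1 * T.ht (T.wordWt w) ≤ _
      linarith
  · rintro ⟨⟨w, hw⟩, k⟩ _ ⟨⟨w', hw'⟩, k'⟩ _ h
    simp only [Prod.mk.injEq] at h
    obtain ⟨rfl, rfl⟩ := h
    rfl

lemma weightSpace_fg_of_generated [Finite κ] [IsNoetherianRing A] (T : Triangular H 𝔟)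
    (hn : ∀ k, n k ∈ weightSpace H A M (d k))
    (hN : ∀ x ∈ borelHat 𝔟, ∀ m ∈ Submodule.span A (Set.range n),
      act A M x m ∈ Submodule.span A (Set.range n))
    (hgen : LieSubmodule.lieSpan A (AffineOver 𝔤 A) (Set.range n) = ⊤) (ν : Wt H) :
    (weightSpace H A M ν).FG :=
  Submodule.FG.of_le (Submodule.fg_span ((T.finite_neg_words d ν).image _))
    (T.weightSpace_le_of_generated hn hN hgen ν)

end Generated

/-- A weight vector in a module with locally bounded weights generates a finite `𝔟`-module. -/
lemma exists_finite_borel_span {J : Set (Wt H)} (hJb : IsLocallyBounded H 𝔟 J)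
    (hM : ∀ ν, weightSpace H A M ν ≠ ⊥ → ν ∈ J) {μ : Wt H} {v : M}
    (hv : v ∈ weightSpace H A M μ) :
    ∃ W : Set (List T.Letter), W.Finite ∧
      v ∈ Submodule.span A (Set.range fun w : W => T.word A M w.1 v) ∧
      ∀ x ∈ borelHat 𝔟, ∀ m ∈ Submodule.span A (Set.range fun w : W => T.word A M w.1 v),
        act A M x m ∈ Submodule.span A (Set.range fun w : W => T.word A M w.1 v) := by
  set W : Set (List T.Letter) := {w | (∀ l ∈ w, T.Pos l) ∧ T.word A M w v ≠ 0} with hW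
  obtain ⟨C, hC⟩ := ((hJb μ).image T.ht).bddAbove
  -- A positive word not killing `v` leads to a weight in `J` above `μ`. Local boundedness leaves
  -- finitely many such weights, hence a bound on the height of the word.
  have hfin : W.Finite := by
    refine (T.finite_words (σ := 1) (by simp) (C - T.ht μ)).subset fun w hw => ?_
    refine ⟨fun l hl => by linarith [T.one_le_ht_of_pos (hw.1 l hl)], ?_⟩
    have h1 : T.ht (T.wordWt w + μ) ≤ C := by
      refine hC ⟨_, ⟨?_, ?_⟩, rfl⟩
      · exact hM _ ((Submodule.ne_bot_iff _).2 ⟨_, T.word_mem_weightSpace w hv, hw.2⟩)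
      · rw [WtLE, add_sub_cancel_right]
        exact T.wordWt_mem_closure hw.1
    rw [map_add] at h1
    linarith
  have hmem : ∀ w : List T.Letter, (∀ l ∈ w, T.Pos l) →
      T.word A M w v ∈ Submodule.span A (Set.range fun w : W => T.word A M w.1 v) := by
    intro w hw
    by_cases h0 : T.word A M w v = 0
    · rw [h0]; exact zero_mem _
    · exact Submodule.subset_span ⟨⟨w, hw, h0⟩, rfl⟩
  refine ⟨W, hfin, by simpa [word_nil] using hmem [] (by simp), fun x hx => ?_⟩
  refine T.act_mem_of_mem_borelHat (fun l hl => ?_) (fun h => ?_) hx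
  · refine act_mem_span_of_forall _ ?_
    rintro _ ⟨⟨w, hw⟩, rfl⟩
    rw [← word_cons]
    refine hmem _ fun l' hl' => ?_
    rcases List.mem_cons.1 hl' with rfl | h
    exacts [hl, hw.1 _ h]
  · refine act_mem_span_of_forall _ ?_
    rintro _ ⟨⟨w, hw⟩, rfl⟩
    rw [mem_weightSpace.1 (T.word_mem_weightSpace w hv) h]
    exact Submodule.smul_mem _ _ (Submodule.subset_span ⟨⟨w, hw⟩, rfl⟩)

variable (A M) in
/-- The elements that lie in a finitely generated submodule stable under the affine Borel
subalgebra form a Lie submodule. -/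
def locallyFinite : LieSubmodule A (AffineOver 𝔤 A) M :=
  let _ := T
  lieSubmoduleOfAct
  { carrier := {m | ∃ N : Submodule A M, m ∈ N ∧ N.FG ∧
      ∀ x ∈ borelHat 𝔟, ∀ n ∈ N, act A M x n ∈ N}
    add_mem' := by
      rintro a b ⟨N, haN, hfg, hN⟩ ⟨N', hbN', hfg', hN'⟩
      refine ⟨N ⊔ N', Submodule.add_mem_sup haN hbN', hfg.sup hfg', fun x hx n hn => ?_⟩
      obtain ⟨y, hy, z, hz, rfl⟩ := Submodule.mem_sup.1 hn
      rw [map_add]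
      exact Submodule.add_mem_sup (hN x hx y hy) (hN' x hx z hz)
    zero_mem' := ⟨⊥, zero_mem _, Submodule.fg_bot, fun x _ n hn => by
      rw [Submodule.mem_bot] at hn ⊢; rw [hn, map_zero]⟩
    smul_mem' := fun c m ⟨N, hm, hfg, hN⟩ => ⟨N, N.smul_mem c hm, hfg, hN⟩ } <| by
    rintro y m ⟨N, hm, hfg, hN⟩
    obtain ⟨k, hk0, hk⟩ : ∃ k : ℤ, k ≤ 0 ∧ ∀ n < k, y.loop n = 0 := by
      obtain ⟨k, hk⟩ := y.loop.support.finite_toSet.bddBelow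
      refine ⟨min k 0, min_le_right _ _, fun n hn => ?_⟩
      by_contra h0
      have := hk (Finsupp.mem_support_iff.2 h0)
      have := lt_min_iff.1 hn
      omega
    let F : Set T.Letter := {l | l.2 ∈ Set.Icc k 0}
    have hF : F.Finite := T.finite_letters_of_mem_Icc k 0
    -- `y` has no component below degree `k`. Letters of degree above 0 preserve `N` already, so
    -- finitely many letters, those of degree in `[k, 0]`, suffice to build a stable submodule
    -- containing `y` applied to `m`.
    let N' : Submodule A M := N ⊔ ⨆ l ∈ F, N.map (act A M (T.letter l))
    have hNN' : N ≤ N' := le_sup_left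
    have htr : ∀ x : Affine 𝔤, (∀ n < k, x.loop n = 0) → ∀ n ∈ N, act A M x n ∈ N' := by
      intro x hx
      have hx' := T.mem_cartanSpan_of_forall_lt hx
      refine T.cartanSpan_le (P := transporter A N N') (fun l hl => ?_) (fun h => ?_) hx'
      · rcases le_or_gt l.2 0 with h0 | h0
        · intro n hn
          refine Submodule.mem_sup_right (Submodule.mem_iSup_of_mem l
            (Submodule.mem_iSup_of_mem ⟨hl, h0⟩ ⟨n, hn, rfl⟩))
        · exact fun n hn => hNN' (hN _ (T.letter_mem_borelHat (Or.inl h0)) n hn)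
      · exact fun n hn => hNN' (hN _ (T.incl_mem_borelHat h) n hn)
    refine ⟨N', htr y hk m hm, ?_, fun x hx => ?_⟩
    · have := hfg.sup (Submodule.fg_biSup hF.toFinset _ fun l _ => hfg.map (act A M (T.letter l)))
      simpa only [N', Set.Finite.mem_toFinset] using this
    · have hle : N' ≤ N'.comap (act A M x) := by
        refine sup_le (fun n hn => hNN' (hN x hx n hn)) (iSup₂_le fun l hl => ?_)
        rintro _ ⟨n, hn, rfl⟩
        have hletter : ∀ j < k, (T.letter l).loop j = 0 := fun j hj => by
          have := hl.1
          simp [letter, Affine.mono_apply, show l.2 ≠ j by omega]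
        -- The commutator of `x` in the Borel subalgebra with a letter of degree at least `k` again
        -- lives in degrees at least `k`, so both terms fall under `htr`.
        rw [Submodule.mem_comap, act_act]
        refine add_mem (htr _ (fun j hj => ?_) n hn) (htr _ (fun j hj => ?_) _ (hN x hx n hn))
        · exact Affine.loop_lie_eq_zero le_rfl hk0 hx.1 hletter j (by omega)
        · exact hletter j hj
      exact hle

lemma isLocallyBorelFinite_of_generated (T : Triangular H 𝔟) {v : M} {N : Submodule A M}
    (hv : v ∈ N) (hfg : N.FG) (hN : ∀ x ∈ borelHat 𝔟, ∀ n ∈ N, act A M x n ∈ N)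
    (hgen : LieSubmodule.lieSpan A (AffineOver 𝔤 A) {v} = ⊤) : IsLocallyBorelFinite 𝔟 A M := by
  have hle : LieSubmodule.lieSpan A (AffineOver 𝔤 A) {v} ≤ T.locallyFinite A M := by
    refine LieSubmodule.lieSpan_le.2 ?_
    rintro _ rfl
    exact ⟨N, hv, hfg, hN⟩
  rw [hgen] at hle
  intro m
  exact hle (LieSubmodule.mem_top m)

/-- A module generated by a weight vector with locally bounded weights in `J` is an object of the
truncated category, and its weight spaces are finitely generated. -/
theorem inOJ_of_cyclic [IsNoetherianRing A] (T : Triangular H 𝔟) {J : Set (Wt H)}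
    (hJb : IsLocallyBounded H 𝔟 J)
    (hM : ∀ ν, weightSpace H A M ν ≠ ⊥ → ν ∈ J) {μ : Wt H} {v : M}
    (hv : v ∈ weightSpace H A M μ) (hgen : LieSubmodule.lieSpan A (AffineOver 𝔤 A) {v} = ⊤) :
    InOJ H 𝔟 A M J ∧ ∀ ν, (weightSpace H A M ν).FG := by
  obtain ⟨W, hfin, hvW, hW⟩ := T.exists_finite_borel_span hJb hM hv
  have := hfin.to_subtype
  have hn : ∀ w : W, T.word A M w.1 v ∈ weightSpace H A M (T.wordWt w.1 + μ) :=
    fun w => T.word_mem_weightSpace w.1 hv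
  have hgen' : LieSubmodule.lieSpan A (AffineOver 𝔤 A)
      (Set.range fun w : W => T.word A M w.1 v) = ⊤ := by
    rw [eq_top_iff, ← hgen, LieSubmodule.lieSpan_le]
    rintro _ rfl
    exact LieSubmodule.submodule_span_le_lieSpan hvW
  refine ⟨⟨⟨T.isWeightModule_of_generated hn hW hgen', ?_⟩, hM⟩,
    T.weightSpace_fg_of_generated hn hW hgen'⟩
  exact T.isLocallyBorelFinite_of_generated hvW (Submodule.fg_span (Set.finite_range _)) hW hgen

section HighestWeight

variable {γ : Wt H} {v : M}

lemma act_mem_span_singleton (hv : v ∈ weightSpace H A M γ)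
    (hpos : ∀ l, T.Pos l → act A M (T.letter l) v = 0) :
    ∀ x ∈ borelHat 𝔟, ∀ m ∈ Submodule.span A (Set.range fun _ : Unit => v),
      act A M x m ∈ Submodule.span A (Set.range fun _ : Unit => v) := by
  intro x hx
  refine T.act_mem_of_mem_borelHat (fun l hl => ?_) (fun h => ?_) hx
  · refine act_mem_span_of_forall _ ?_
    rintro _ ⟨_, rfl⟩
    simp only [hpos l hl]
    exact zero_mem _
  · refine act_mem_span_of_forall _ ?_
    rintro _ ⟨_, rfl⟩
    rw [mem_weightSpace.1 hv h]
    exact Submodule.smul_mem _ _ (Submodule.subset_span ⟨(), rfl⟩)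

/-- A nonempty negative word strictly lowers the height, so only the empty word returns to weight
`γ`. -/
lemma weightSpace_le_of_highestWeight (hv : v ∈ weightSpace H A M γ)
    (hpos : ∀ l, T.Pos l → act A M (T.letter l) v = 0)
    (hgen : LieSubmodule.lieSpan A (AffineOver 𝔤 A) {v} = ⊤) :
    weightSpace H A M γ ≤ Submodule.span A {v} := by
  have h1 := T.weightSpace_le_of_generated (n := fun _ : Unit => v) (d := fun _ => γ)
    (fun _ => hv) (T.act_mem_span_singleton hv hpos) (by rwa [Set.range_const]) γ
  refine h1.trans (Submodule.span_mono ?_)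
  rintro _ ⟨⟨⟨w, hw⟩, _⟩, hwγ, rfl⟩
  have h0 : T.wordWt w = 0 := by simpa using hwγ
  cases w with
  | nil => exact word_nil T v
  | cons l w =>
    have h2 := T.length_le_and_abs_le (σ := -1) (by simp) (l :: w) fun l' hl' => by
      linarith [T.ht_le_of_neg (hw l' hl')]
    have h3 := h2.1
    rw [h0, map_zero, mul_zero] at h3
    simp only [List.length_cons] at h3
    push_cast at h3
    linarith [(Nat.cast_nonneg w.length : (0 : ℝ) ≤ w.length)]

theorem inOJ_of_highestWeight (T : Triangular H 𝔟) {J : Set (Wt H)} (hJ : IsOpenWt H 𝔟 J)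
    (hγ : γ ∈ J) (hv : v ∈ weightSpace H A M γ)
    (hpos : ∀ l, T.Pos l → act A M (T.letter l) v = 0)
    (hgen : LieSubmodule.lieSpan A (AffineOver 𝔤 A) {v} = ⊤) :
    InOJ H 𝔟 A M J ∧ ∀ ν, weightSpace H A M ν ≠ ⊥ → WtLE H 𝔟 ν γ := by
  have hN := T.act_mem_span_singleton hv hpos
  have hgen' : LieSubmodule.lieSpan A (AffineOver 𝔤 A) (Set.range fun _ : Unit => v) = ⊤ := by
    rwa [Set.range_const]
  have hle : ∀ ν, weightSpace H A M ν ≠ ⊥ → WtLE H 𝔟 ν γ := fun ν hν =>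
    (T.exists_wtLE_of_generated (d := fun _ => γ) (fun _ => hv) hN hgen' hν).choose_spec
  refine ⟨⟨⟨T.isWeightModule_of_generated (d := fun _ => γ) (fun _ => hv) hN hgen', ?_⟩,
    fun ν hν => hJ γ hγ ν (hle ν hν)⟩, hle⟩
  exact T.isLocallyBorelFinite_of_generated (N := Submodule.span A (Set.range fun _ : Unit => v))
    (Submodule.subset_span ⟨(), rfl⟩) (Submodule.fg_span (Set.finite_range _)) hN hgen

end HighestWeight

end Triangular

end Finiteness

/-! ### Cyclic modules -/

section Cyclic

variable (𝔤 : Type v) [LieRing 𝔤] [LieAlgebra ℂ 𝔤] (A : Type u) [CommRing A] [Algebra ℂ A]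

/-- The universal enveloping algebra of the affine algebra over `A`. -/
abbrev EnvAlg : Type (max u v) := UniversalEnvelopingAlgebra A (AffineOver 𝔤 A)

variable {𝔤 A}

/-- The cyclic module `U / I`. -/
def Cyc (I : Submodule (EnvAlg 𝔤 A) (EnvAlg 𝔤 A)) : Type (max u v) := EnvAlg 𝔤 A ⧸ I

namespace Cyc

variable (I : Submodule (EnvAlg 𝔤 A) (EnvAlg 𝔤 A))

instance : AddCommGroup (Cyc I) := inferInstanceAs (AddCommGroup (_ ⧸ I))

instance : Module (EnvAlg 𝔤 A) (Cyc I) := inferInstanceAs (Module _ (_ ⧸ I))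

instance : Module A (Cyc I) := Module.compHom _ (algebraMap A (EnvAlg 𝔤 A))

lemma smul_def (a : A) (m : Cyc I) : a • m = algebraMap A (EnvAlg 𝔤 A) a • m := rfl

instance : LieRingModule (AffineOver 𝔤 A) (Cyc I) where
  bracket x m := UniversalEnvelopingAlgebra.ι A x • m
  add_lie x y m := by
    change UniversalEnvelopingAlgebra.ι A (x + y) • m = _
    rw [map_add, add_smul]
  lie_add x m n := smul_add _ m n
  leibniz_lie x y m := by
    change UniversalEnvelopingAlgebra.ι A x • UniversalEnvelopingAlgebra.ι A y • m =
      UniversalEnvelopingAlgebra.ι A ⁅x, y⁆ • m +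
        UniversalEnvelopingAlgebra.ι A y • UniversalEnvelopingAlgebra.ι A x • m
    let _ : LieRing (EnvAlg 𝔤 A) := LieRing.ofAssociativeRing
    rw [LieHom.map_lie, LieRing.of_associative_ring_bracket, sub_smul, mul_smul, mul_smul]
    exact (sub_add_cancel _ _).symm

lemma lie_def (x : AffineOver 𝔤 A) (m : Cyc I) :
    ⁅x, m⁆ = UniversalEnvelopingAlgebra.ι A x • m := rfl

instance : LieModule A (AffineOver 𝔤 A) (Cyc I) where
  smul_lie a x m := by
    rw [lie_def, lie_def, smul_def, map_smul, Algebra.smul_def, mul_smul]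
  lie_smul a x m := by
    rw [lie_def, lie_def, smul_def, smul_def, ← mul_smul, ← mul_smul, Algebra.commutes]

/-- The canonical generator. -/
def gen : Cyc I := Submodule.Quotient.mk (p := I) 1

lemma smul_gen (u : EnvAlg 𝔤 A) : u • gen I = Submodule.Quotient.mk (p := I) u := by
  change Submodule.Quotient.mk (p := I) (u • 1) = _
  rw [smul_eq_mul, mul_one]

variable {I}

lemma smul_gen_eq_zero {u : EnvAlg 𝔤 A} : u • gen I = 0 ↔ u ∈ I := by
  rw [smul_gen]; exact Submodule.Quotient.mk_eq_zero I

lemma exists_smul_gen (m : Cyc I) : ∃ u : EnvAlg 𝔤 A, m = u • gen I := by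
  obtain ⟨u, rfl⟩ := Submodule.Quotient.mk_surjective I m
  exact ⟨u, (smul_gen I u).symm⟩

end Cyc

variable (M : Type w) [AddCommGroup M] [Module A M] [LieRingModule (AffineOver 𝔤 A) M]
  [LieModule A (AffineOver 𝔤 A) M]

/-- The action of the universal enveloping algebra on a module over the affine algebra. -/
def envAct : EnvAlg 𝔤 A →ₐ[A] Module.End A M :=
  UniversalEnvelopingAlgebra.lift A (LieModule.toEnd A (AffineOver 𝔤 A) M)

variable {M}

lemma envAct_ι (x : AffineOver 𝔤 A) (m : M) :
    envAct M (UniversalEnvelopingAlgebra.ι A x) m = ⁅x, m⁆ := by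
  rw [envAct, UniversalEnvelopingAlgebra.lift_ι_apply]; rfl

lemma envAct_mul (a b : EnvAlg 𝔤 A) (m : M) :
    envAct M (a * b) m = envAct M a (envAct M b m) := by rw [map_mul]; rfl

lemma envAct_algebraMap (a : A) (m : M) :
    envAct M (algebraMap A (EnvAlg 𝔤 A) a) m = a • m := by
  rw [AlgHom.commutes]; rfl

/-- The subalgebra generated by the affine algebra is everything. -/
lemma EnvAlg.induction {p : EnvAlg 𝔤 A → Prop} (hA : ∀ a, p (algebraMap A _ a))
    (hι : ∀ x, p (UniversalEnvelopingAlgebra.ι A x)) (hmul : ∀ a b, p a → p b → p (a * b))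
    (hadd : ∀ a b, p a → p b → p (a + b)) (u : EnvAlg 𝔤 A) : p u := by
  let S : Subalgebra A (EnvAlg 𝔤 A) :=
    { carrier := {u | p u}
      mul_mem' := fun {a b} ha hb => hmul a b ha hb
      add_mem' := fun {a b} ha hb => hadd a b ha hb
      algebraMap_mem' := hA }
  let _ : LieRing S := LieRing.ofAssociativeRing
  let _ : LieRing (EnvAlg 𝔤 A) := LieRing.ofAssociativeRing
  let f : AffineOver 𝔤 A →ₗ⁅A⁆ S :=
    { toFun := fun x => ⟨UniversalEnvelopingAlgebra.ι A x, hι x⟩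
      map_add' := fun x y => Subtype.ext (map_add _ x y)
      map_smul' := fun c x => Subtype.ext (map_smul _ c x)
      map_lie' := fun {x y} => Subtype.ext (LieHom.map_lie _ x y) }
  -- Both algebra maps fix the affine algebra, so they agree by the universal property; the identity
  -- then factors through `S`.
  have h : S.val.comp (UniversalEnvelopingAlgebra.lift A f) = AlgHom.id A _ := by
    ext x
    simp [f]
  have := congrArg (fun g : EnvAlg 𝔤 A →ₐ[A] EnvAlg 𝔤 A => g u) h
  rw [← show _ = u from this]
  exact (UniversalEnvelopingAlgebra.lift A f u).2

lemma map_envAct {N : Type*} [AddCommGroup N] [Module A N] [LieRingModule (AffineOver 𝔤 A) N]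
    [LieModule A (AffineOver 𝔤 A) N] (f : M →ₗ⁅A, AffineOver 𝔤 A⁆ N) (u : EnvAlg 𝔤 A) :
    ∀ m : M, f (envAct M u m) = envAct N u (f m) := by
  induction u using EnvAlg.induction with
  | hA a => intro m; rw [envAct_algebraMap, envAct_algebraMap, map_smul]
  | hι x => intro m; rw [envAct_ι, envAct_ι, LieModuleHom.map_lie]
  | hmul a b ha hb => intro m; rw [envAct_mul, envAct_mul, ha, hb]
  | hadd a b ha hb =>
    intro m
    rw [map_add, map_add, LinearMap.add_apply, LinearMap.add_apply, map_add, ha, hb]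

lemma envAct_mem (N : LieSubmodule A (AffineOver 𝔤 A) M) (u : EnvAlg 𝔤 A) :
    ∀ m ∈ N, envAct M u m ∈ N := by
  induction u using EnvAlg.induction with
  | hA a => intro m hm; rw [envAct_algebraMap]; exact N.smul_mem a hm
  | hι x => intro m hm; rw [envAct_ι]; exact N.lie_mem hm
  | hmul a b ha hb => intro m hm; rw [envAct_mul]; exact ha _ (hb _ hm)
  | hadd a b ha hb =>
    intro m hm
    rw [map_add, LinearMap.add_apply]
    exact add_mem (ha m hm) (hb m hm)

lemma Cyc.envAct_eq_smul {I : Submodule (EnvAlg 𝔤 A) (EnvAlg 𝔤 A)} (u : EnvAlg 𝔤 A) :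
    ∀ m : Cyc I, envAct (Cyc I) u m = u • m := by
  induction u using EnvAlg.induction with
  | hA a => intro m; rw [envAct_algebraMap]; rfl
  | hι x => intro m; rw [envAct_ι]; rfl
  | hmul a b ha hb => intro m; rw [envAct_mul, ha, hb, mul_smul]
  | hadd a b ha hb =>
    intro m
    rw [map_add, LinearMap.add_apply, ha, hb, add_smul]

lemma Cyc.lieSpan_gen (I : Submodule (EnvAlg 𝔤 A) (EnvAlg 𝔤 A)) :
    LieSubmodule.lieSpan A (AffineOver 𝔤 A) {gen I} = ⊤ := by
  rw [eq_top_iff]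
  intro m _
  obtain ⟨u, rfl⟩ := exists_smul_gen m
  rw [← envAct_eq_smul]
  exact envAct_mem _ u _ (LieSubmodule.subset_lieSpan rfl)

/-- The left ideal of elements annihilating `m`. -/
def annihilator (m : M) : Submodule (EnvAlg 𝔤 A) (EnvAlg 𝔤 A) where
  carrier := {u | envAct M u m = 0}
  add_mem' {a b} ha hb := by
    change envAct M (a + b) m = 0
    rw [map_add, LinearMap.add_apply, show envAct M a m = 0 from ha,
      show envAct M b m = 0 from hb, add_zero]
  zero_mem' := by
    change envAct M 0 m = 0
    rw [map_zero]; rfl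
  smul_mem' c a ha := by
    change envAct M (c * a) m = 0
    rw [envAct_mul, show envAct M a m = 0 from ha, map_zero]

/-- A homomorphism from the cyclic module `U / I` is given by an element killed by `I`. -/
def Cyc.lift (I : Submodule (EnvAlg 𝔤 A) (EnvAlg 𝔤 A)) (m : M)
    (h : I ≤ annihilator m) : Cyc I →ₗ⁅A, AffineOver 𝔤 A⁆ M :=
  let f : Cyc I →+ M := QuotientAddGroup.lift I.toAddSubgroup
    { toFun := fun u => envAct M u m
      map_zero' := by simp
      map_add' := fun a b => by simp } fun _ hu => h hu
  have hf : ∀ u : EnvAlg 𝔤 A, f (u • gen I) = envAct M u m := fun u => by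
    rw [smul_gen]; rfl
  { toFun := f
    map_add' := map_add f
    map_smul' := fun a x => by
      obtain ⟨u, rfl⟩ := exists_smul_gen x
      rw [RingHom.id_apply, smul_def, ← mul_smul, hf, hf, envAct_mul, envAct_algebraMap]
    map_lie' := fun {x y} => by
      obtain ⟨u, rfl⟩ := exists_smul_gen y
      rw [lie_def, ← mul_smul, hf, hf, envAct_mul, envAct_ι] }

lemma Cyc.lift_gen (I : Submodule (EnvAlg 𝔤 A) (EnvAlg 𝔤 A)) (m : M)
    (h : I ≤ annihilator m) : Cyc.lift I m h (gen I) = m := by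
  change envAct M 1 m = m
  rw [map_one]; rfl

/-- Homomorphisms that agree on a generator are equal. -/
lemma hom_ext_of_lieSpan {N : Type*} [AddCommGroup N] [Module A N]
    [LieRingModule (AffineOver 𝔤 A) N] [LieModule A (AffineOver 𝔤 A) N] {v : M}
    (hv : LieSubmodule.lieSpan A (AffineOver 𝔤 A) {v} = ⊤)
    {f g : M →ₗ⁅A, AffineOver 𝔤 A⁆ N} (h : f v = g v) : f = g := by
  have hle : LieSubmodule.lieSpan A (AffineOver 𝔤 A) {v} ≤ (f - g).ker := by
    rw [LieSubmodule.lieSpan_le, Set.singleton_subset_iff]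
    change f v - g v = 0
    rw [h, sub_self]
  rw [hv] at hle
  ext m
  exact sub_eq_zero.1 (hle (LieSubmodule.mem_top m))

lemma lieSpan_map_of_surjective {N : Type*} [AddCommGroup N] [Module A N]
    [LieRingModule (AffineOver 𝔤 A) N] [LieModule A (AffineOver 𝔤 A) N] {v : M}
    (hv : LieSubmodule.lieSpan A (AffineOver 𝔤 A) {v} = ⊤)
    (f : M →ₗ⁅A, AffineOver 𝔤 A⁆ N) (hf : Function.Surjective f) :
    LieSubmodule.lieSpan A (AffineOver 𝔤 A) {f v} = ⊤ := by
  have hle : LieSubmodule.lieSpan A (AffineOver 𝔤 A) {v} ≤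
      (LieSubmodule.lieSpan A (AffineOver 𝔤 A) {f v}).comap f := by
    rw [LieSubmodule.lieSpan_le, Set.singleton_subset_iff]
    exact LieSubmodule.subset_lieSpan rfl
  rw [hv] at hle
  rw [eq_top_iff]
  intro n _
  obtain ⟨m, rfl⟩ := hf n
  exact hle (LieSubmodule.mem_top m)

lemma surjective_of_mem_range {N : Type*} [AddCommGroup N] [Module A N]
    [LieRingModule (AffineOver 𝔤 A) N] [LieModule A (AffineOver 𝔤 A) N] {n : N}
    (hn : LieSubmodule.lieSpan A (AffineOver 𝔤 A) {n} = ⊤)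
    (f : M →ₗ⁅A, AffineOver 𝔤 A⁆ N) (h : n ∈ f.range) : Function.Surjective f := by
  have hle : LieSubmodule.lieSpan A (AffineOver 𝔤 A) {n} ≤ f.range := by
    rw [LieSubmodule.lieSpan_le, Set.singleton_subset_iff]
    exact h
  rw [hn] at hle
  intro y
  exact hle (LieSubmodule.mem_top y)

end Cyclic

/-! ### The object representing a weight space functor -/

section WeightObject

variable {𝔤 : Type v} [LieRing 𝔤] [LieAlgebra ℂ 𝔤] {H 𝔟 : LieSubalgebra ℂ 𝔤}
  {A : Type u} [CommRing A] [Algebra ℂ A]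
  [Algebra (SymmetricAlgebra ℂ H) A] [IsScalarTower ℂ (SymmetricAlgebra ℂ H) A]
  {M : Type w} [AddCommGroup M] [Module A M] [LieRingModule (AffineOver 𝔤 A) M]
  [LieModule A (AffineOver 𝔤 A) M]
  {N : Type w₁} [AddCommGroup N] [Module A N] [LieRingModule (AffineOver 𝔤 A) N]
  [LieModule A (AffineOver 𝔤 A) N]

/-- Root vectors shift weights, so the sum of the weight spaces is a submodule. No finiteness is
assumed, and the statement applies to the module presented by `weightIdeal`, before truncation. -/
lemma isWeightModule_of_lieSpan [LieRing.IsNilpotent H] (T : Triangular H 𝔟) {μ : Wt H} {m : M}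
    (hm : m ∈ weightSpace H A M μ) (hgen : LieSubmodule.lieSpan A (AffineOver 𝔤 A) {m} = ⊤) :
    IsWeightModule H A M := by
  rw [isWeightModule_iff]
  set P := ⨆ ν : Wt H, weightSpace H A M ν with hP
  have hstab : ∀ x : Affine 𝔤, ∀ n ∈ P, act A M x n ∈ P := by
    intro x
    refine T.cartanSpan_le (P := transporter A P P) (fun l _ => ?_) (fun h => ?_)
      (T.mem_cartanSpan_univ x)
    · have : P ≤ P.comap (act A M (T.letter l)) := iSup_le fun ν n hn =>
        Submodule.mem_iSup_of_mem (T.letterWt l + ν)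
          (act_mem_weightSpace (fun h => T.lie_incl_letter h l) hn)
      exact this
    · have : P ≤ P.comap (act A M (CartanHat.incl H h)) := iSup_le fun ν n hn => by
        rw [Submodule.mem_comap, mem_weightSpace.1 hn h]
        exact P.smul_mem _ (Submodule.mem_iSup_of_mem ν hn)
      exact this
  have hle : LieSubmodule.lieSpan A (AffineOver 𝔤 A) {m} ≤ lieSubmoduleOfAct P hstab := by
    rw [LieSubmodule.lieSpan_le, Set.singleton_subset_iff]
    exact Submodule.mem_iSup_of_mem μ hm
  rw [hgen] at hle
  exact eq_top_iff.2 fun n _ => hle (LieSubmodule.mem_top n)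

variable (H A) in
/-- The left ideal expressing that the generator has weight `μ`. -/
def weightIdeal (μ : Wt H) : Submodule (EnvAlg 𝔤 A) (EnvAlg 𝔤 A) :=
  Submodule.span _ (Set.range fun h : CartanHat H =>
    UniversalEnvelopingAlgebra.ι A ((1 : A) ⊗ₜ[ℂ] CartanHat.incl H h) -
      algebraMap A _ (char H A μ h))

lemma envAct_sub_eq_zero {μ : Wt H} {m : M} (hm : m ∈ weightSpace H A M μ) (h : CartanHat H) :
    envAct M (UniversalEnvelopingAlgebra.ι A ((1 : A) ⊗ₜ[ℂ] CartanHat.incl H h) -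
      algebraMap A _ (char H A μ h)) m = 0 := by
  rw [map_sub, LinearMap.sub_apply, envAct_ι, envAct_algebraMap, hm h, sub_self]

lemma gen_mem_weightSpace {μ : Wt H} {I : Submodule (EnvAlg 𝔤 A) (EnvAlg 𝔤 A)}
    (hI : ∀ h : CartanHat H,
      UniversalEnvelopingAlgebra.ι A ((1 : A) ⊗ₜ[ℂ] CartanHat.incl H h) -
        algebraMap A _ (char H A μ h) ∈ I) :
    Cyc.gen I ∈ weightSpace H A (Cyc I) μ := by
  intro h
  have := Cyc.smul_gen_eq_zero.2 (hI h)
  rw [sub_smul, sub_eq_zero] at this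
  exact this

lemma weightIdeal_le_annihilator {μ : Wt H} {m : M} (hm : m ∈ weightSpace H A M μ) :
    weightIdeal H A μ ≤ annihilator m := by
  refine Submodule.span_le.2 ?_
  rintro _ ⟨h, rfl⟩
  exact envAct_sub_eq_zero hm h

lemma gen_weightIdeal_mem (μ : Wt H) :
    Cyc.gen (weightIdeal H A μ) ∈ weightSpace H A (Cyc (weightIdeal H A μ)) μ :=
  gen_mem_weightSpace fun h => Submodule.subset_span ⟨h, rfl⟩

variable (H A) in
/-- The left ideal expressing that the generator has weight `μ` and that all weights of the
cyclic module lie in `J`. -/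
def truncatedIdeal (J : Set (Wt H)) (μ : Wt H) : Submodule (EnvAlg 𝔤 A) (EnvAlg 𝔤 A) :=
  weightIdeal H A μ ⊔ Submodule.span _ {u | ∃ ν ∉ J,
    u • Cyc.gen (weightIdeal H A μ) ∈ weightSpace H A (Cyc (weightIdeal H A μ)) ν}

variable (H A) in
/-- The object of the truncated category that represents the functor `M ↦ M_μ`. -/
abbrev WeightObj (J : Set (Wt H)) (μ : Wt H) : Type (max u v) := Cyc (truncatedIdeal H A J μ)

lemma gen_mem_weightObj (J : Set (Wt H)) (μ : Wt H) :
    Cyc.gen (truncatedIdeal H A J μ) ∈ weightSpace H A (WeightObj H A J μ) μ :=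
  gen_mem_weightSpace fun h => Submodule.mem_sup_left (Submodule.subset_span ⟨h, rfl⟩)

lemma truncatedIdeal_le_annihilator {J : Set (Wt H)} {μ : Wt H}
    (hM : ∀ ν, weightSpace H A M ν ≠ ⊥ → ν ∈ J) {m : M} (hm : m ∈ weightSpace H A M μ) :
    truncatedIdeal H A J μ ≤ annihilator m := by
  refine sup_le (weightIdeal_le_annihilator hm) (Submodule.span_le.2 ?_)
  rintro u ⟨ν, hν, hu⟩
  have hbot : weightSpace H A M ν = ⊥ := by
    by_contra h
    exact hν (hM ν h)
  have h1 := map_mem_weightSpace (Cyc.lift _ m (weightIdeal_le_annihilator hm)) hu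
  rw [hbot, Submodule.mem_bot, ← Cyc.envAct_eq_smul, map_envAct, Cyc.lift_gen] at h1
  exact h1

/-- A vector of weight outside `J` lifts to a vector of the same weight in the untruncated cyclic
module, and such lifts are among the generators of the truncated ideal. Truncating creates no new
weights. -/
lemma weight_mem_of_weightObj [LieRing.IsNilpotent H] (T : Triangular H 𝔟) {J : Set (Wt H)}
    {μ ν : Wt H} (hν : weightSpace H A (WeightObj H A J μ) ν ≠ ⊥) : ν ∈ J := by
  by_contra hJ
  refine hν (eq_bot_iff.2 fun m hm => ?_)
  have hw : IsWeightModule H A (Cyc (weightIdeal H A μ)) :=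
    isWeightModule_of_lieSpan T (gen_weightIdeal_mem μ) (Cyc.lieSpan_gen _)
  have hgen : weightIdeal H A μ ≤ annihilator (Cyc.gen (truncatedIdeal H A J μ)) :=
    weightIdeal_le_annihilator (gen_mem_weightObj J μ)
  let f := Cyc.lift (weightIdeal H A μ) (Cyc.gen (truncatedIdeal H A J μ)) hgen
  have hfg : f (Cyc.gen _) = Cyc.gen _ := Cyc.lift_gen _ _ _
  have hf : Function.Surjective f :=
    surjective_of_mem_range (Cyc.lieSpan_gen _) f ⟨Cyc.gen _, hfg⟩
  obtain ⟨x, hx, rfl⟩ := hw.exists_lift f hf hm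
  obtain ⟨u, rfl⟩ := Cyc.exists_smul_gen x
  rw [Submodule.mem_bot, ← Cyc.envAct_eq_smul, map_envAct, hfg, Cyc.envAct_eq_smul,
    Cyc.smul_gen_eq_zero]
  exact Submodule.mem_sup_right (Submodule.subset_span ⟨ν, hJ, hx⟩)

theorem weightObj_inOJ [LieRing.IsNilpotent H] [IsNoetherianRing A] (T : Triangular H 𝔟)
    {J : Set (Wt H)} (hJb : IsLocallyBounded H 𝔟 J) (μ : Wt H) :
    InOJ H 𝔟 A (WeightObj H A J μ) J ∧ ∀ ν, (weightSpace H A (WeightObj H A J μ) ν).FG :=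
  T.inOJ_of_cyclic hJb (fun _ hν => weight_mem_of_weightObj T hν) (gen_mem_weightObj J μ)
    (Cyc.lieSpan_gen _)

lemma exists_hom_weightObj {J : Set (Wt H)} {μ : Wt H} (hM : InOJ H 𝔟 A M J) {m : M}
    (hm : m ∈ weightSpace H A M μ) :
    ∃ f : WeightObj H A J μ →ₗ⁅A, AffineOver 𝔤 A⁆ M, f (Cyc.gen _) = m :=
  ⟨Cyc.lift _ m (truncatedIdeal_le_annihilator hM.weight_mem hm), Cyc.lift_gen _ _ _⟩

/-- Projectivity: a map out of the representing object is a vector of weight `μ`, and weight vectors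
lift along surjections. -/
lemma exists_lift_weightObj {J : Set (Wt H)} {μ : Wt H} (hM : InOJ H 𝔟 A M J)
    (f : M →ₗ⁅A, AffineOver 𝔤 A⁆ N) (hf : Function.Surjective f)
    (h : WeightObj H A J μ →ₗ⁅A, AffineOver 𝔤 A⁆ N) :
    ∃ k : WeightObj H A J μ →ₗ⁅A, AffineOver 𝔤 A⁆ M, f.comp k = h := by
  obtain ⟨m, hm, hmn⟩ := hM.isWeightModule.exists_lift f hf
    (map_mem_weightSpace h (gen_mem_weightObj J μ))
  obtain ⟨k, hk⟩ := exists_hom_weightObj hM hm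
  refine ⟨k, hom_ext_of_lieSpan (Cyc.lieSpan_gen _) ?_⟩
  rw [LieModuleHom.comp_apply, hk, hmn]

end WeightObject

/-! ### Verma modules and their simple quotients -/

/-- A homomorphism factors through a surjection as soon as it kills its kernel. -/
lemma LieModuleHom.exists_factor {R L M N P : Type*} [CommRing R] [LieRing L]
    [AddCommGroup M] [Module R M] [LieRingModule L M]
    [AddCommGroup N] [Module R N] [LieRingModule L N]
    [AddCommGroup P] [Module R P] [LieRingModule L P]
    (f : M →ₗ⁅R, L⁆ N) (hf : Function.Surjective f) (g : M →ₗ⁅R, L⁆ P)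
    (h : ∀ m, f m = 0 → g m = 0) : ∃ k : N →ₗ⁅R, L⁆ P, ∀ m, k (f m) = g m := by
  have key : ∀ a b, f a = f b → g a = g b := fun a b hab => by
    rw [← sub_eq_zero, ← map_sub]
    exact h _ (by rw [map_sub, hab, sub_self])
  have hs : ∀ m, g (Function.surjInv hf (f m)) = g m := fun m =>
    key _ _ (Function.surjInv_eq hf _)
  refine ⟨{ toFun := fun n => g (Function.surjInv hf n), map_add' := ?_, map_smul' := ?_,
            map_lie' := ?_ }, hs⟩
  · intro a b
    rw [← map_add]
    exact key _ _ (by rw [map_add]; simp only [Function.surjInv_eq hf])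
  · intro c a
    rw [RingHom.id_apply, ← map_smul]
    exact key _ _ (by rw [map_smul]; simp only [Function.surjInv_eq hf])
  · intro x a
    rw [← LieModuleHom.map_lie]
    exact key _ _ (by rw [LieModuleHom.map_lie]; simp only [Function.surjInv_eq hf])

section Verma

variable {𝔤 : Type v} [LieRing 𝔤] [LieAlgebra ℂ 𝔤] {H 𝔟 : LieSubalgebra ℂ 𝔤}
  {A : Type u} [CommRing A] [Algebra ℂ A]
  [Algebra (SymmetricAlgebra ℂ H) A] [IsScalarTower ℂ (SymmetricAlgebra ℂ H) A]

variable (H 𝔟 A) in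
/-- The canonical generator of the Verma module. -/
def Verma.gen (γ : Wt H) : Verma H 𝔟 A γ := Cyc.gen (vermaIdeal H 𝔟 A γ)

lemma Verma.gen_mem_weightSpace (γ : Wt H) :
    Verma.gen H 𝔟 A γ ∈ weightSpace H A (Verma H 𝔟 A γ) γ :=
  AffineO.gen_mem_weightSpace (I := vermaIdeal H 𝔟 A γ)
    fun h => Submodule.subset_span (Or.inl ⟨h, rfl⟩)

lemma Verma.lieSpan_gen (γ : Wt H) :
    LieSubmodule.lieSpan A (AffineOver 𝔤 A) {Verma.gen H 𝔟 A γ} = ⊤ :=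
  Cyc.lieSpan_gen (vermaIdeal H 𝔟 A γ)

lemma Verma.act_lie_gen (γ : Wt H) {x y : Affine 𝔤} (hx : x ∈ borelHat 𝔟) (hy : y ∈ borelHat 𝔟) :
    act A (Verma H 𝔟 A γ) ⁅x, y⁆ (Verma.gen H 𝔟 A γ) = 0 :=
  Cyc.smul_gen_eq_zero.2 (Submodule.subset_span (Or.inr ⟨x, hx, y, hy, rfl⟩))

/-- A positive letter has positive height, hence nonzero weight, so a suitable Cartan element fixes
it under the bracket. It follows that positive letters lie in the commutators that kill the Verma
generator. -/
lemma Triangular.letter_eq_lie [LieRing.IsNilpotent H] (T : Triangular H 𝔟) {l : T.Letter}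
    (hl : T.Pos l) : ∃ x ∈ borelHat 𝔟, T.letter l = ⁅x, T.letter l⁆ := by
  obtain ⟨h, hh⟩ : ∃ h, T.letterWt l h ≠ 0 := by
    by_contra! h0
    have h1 := T.one_le_ht_of_pos hl
    rw [show T.letterWt l = 0 from LinearMap.ext h0, map_zero] at h1
    norm_num at h1
  refine ⟨(T.letterWt l h)⁻¹ • CartanHat.incl H h,
    (borelHat 𝔟).smul_mem _ (T.incl_mem_borelHat h), ?_⟩
  rw [smul_lie, T.lie_incl_letter, smul_smul, inv_mul_cancel₀ hh, one_smul]

lemma Verma.act_letter_gen [LieRing.IsNilpotent H] (T : Triangular H 𝔟) (γ : Wt H)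
    {l : T.Letter} (hl : T.Pos l) :
    act A (Verma H 𝔟 A γ) (T.letter l) (Verma.gen H 𝔟 A γ) = 0 := by
  obtain ⟨x, hx, hxl⟩ := T.letter_eq_lie hl
  rw [hxl]
  exact Verma.act_lie_gen γ hx (T.letter_mem_borelHat hl)

variable {M : Type w} [AddCommGroup M] [Module A M] [LieRingModule (AffineOver 𝔤 A) M]
  [LieModule A (AffineOver 𝔤 A) M]

lemma exists_hom_verma [LieRing.IsNilpotent H] (T : Triangular H 𝔟) {γ : Wt H} {m : M}
    (hm : m ∈ weightSpace H A M γ) (hpos : ∀ l, T.Pos l → act A M (T.letter l) m = 0) :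
    ∃ f : Verma H 𝔟 A γ →ₗ⁅A, AffineOver 𝔤 A⁆ M, f (Verma.gen H 𝔟 A γ) = m := by
  have hN := T.act_mem_span_singleton hm hpos
  rw [Set.range_const] at hN
  have hle : vermaIdeal H 𝔟 A γ ≤ annihilator m := by
    refine Submodule.span_le.2 ?_
    rintro _ (⟨h, rfl⟩ | ⟨x, hx, y, hy, rfl⟩)
    · exact envAct_sub_eq_zero hm h
    · change envAct M _ m = 0
      -- The Borel subalgebra acts on `m` by scalars from the commutative ring `A`, so its
      -- commutators annihilate `m`.
      obtain ⟨a, ha⟩ := Submodule.mem_span_singleton.1 (hN x hx m (Submodule.mem_span_singleton_self m))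
      obtain ⟨b, hb⟩ := Submodule.mem_span_singleton.1 (hN y hy m (Submodule.mem_span_singleton_self m))
      have h1 := act_act A x y m
      rw [← ha, ← hb, map_smul, map_smul, ← ha, ← hb, smul_comm a b] at h1
      rw [envAct_ι]
      exact right_eq_add.1 h1
  exact ⟨Cyc.lift (vermaIdeal H 𝔟 A γ) m hle, Cyc.lift_gen _ _ _⟩

end Verma

section VermaField

variable {𝔤 : Type v} [LieRing 𝔤] [LieAlgebra ℂ 𝔤] {H 𝔟 : LieSubalgebra ℂ 𝔤}
  {K : Type u} [Field K] [Algebra ℂ K]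
  [Algebra (SymmetricAlgebra ℂ H) K] [IsScalarTower ℂ (SymmetricAlgebra ℂ H) K]

/-- The sum of the proper submodules of a nonzero Verma module over a field is proper. -/
lemma vermaRad_ne_top [LieRing.IsNilpotent H] (T : Triangular H 𝔟) {γ : Wt H}
    (h0 : Verma.gen H 𝔟 K γ ≠ 0) : vermaRad H 𝔟 K γ ≠ ⊤ := by
  intro htop
  have hwt : IsWeightModule H K (Verma H 𝔟 K γ) :=
    isWeightModule_of_lieSpan T (Verma.gen_mem_weightSpace γ) (Verma.lieSpan_gen γ)
  have hdim : weightSpace H K (Verma H 𝔟 K γ) γ ≤ Submodule.span K {Verma.gen H 𝔟 K γ} :=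
    T.weightSpace_le_of_highestWeight (Verma.gen_mem_weightSpace γ)
      (fun l hl => Verma.act_letter_gen T γ hl) (Verma.lieSpan_gen γ)
  -- Over a field, a nonzero component of weight `γ` is an invertible multiple of the generator, so
  -- a proper submodule has none. This condition persists under sums.
  have hprop : ∀ N : LieSubmodule K (AffineOver 𝔤 K) (Verma H 𝔟 K γ), N ≠ ⊤ →
      N.toSubmodule ≤ ⨆ (ν : Wt H) (_ : ν ≠ γ), weightSpace H K (Verma H 𝔟 K γ) ν := by
    intro N hN n hn
    obtain ⟨g, hg, rfl⟩ := hwt.exists_sum n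
    refine sum_mem fun ν hν => ?_
    have hgN : g ν ∈ N.toSubmodule :=
      mem_of_sum_mem (H := H) (fun h n hn => act_mem N _ hn) hg hn hν
    refine Submodule.mem_iSup_of_mem ν (Submodule.mem_iSup_of_mem ?_ (hg ν))
    rintro rfl
    obtain ⟨k, hk⟩ := Submodule.mem_span_singleton.1 (hdim (hg ν))
    have hk0 : k ≠ 0 := by
      rintro rfl
      rw [zero_smul] at hk
      exact Finsupp.mem_support_iff.1 hν hk.symm
    refine hN (eq_top_iff.2 ?_)
    rw [← Verma.lieSpan_gen ν, LieSubmodule.lieSpan_le, Set.singleton_subset_iff]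
    have := N.toSubmodule.smul_mem k⁻¹ hgN
    rwa [← hk, smul_smul, inv_mul_cancel₀ hk0, one_smul] at this
  have hle : (vermaRad H 𝔟 K γ).toSubmodule ≤
      ⨆ (ν : Wt H) (_ : ν ≠ γ), weightSpace H K (Verma H 𝔟 K γ) ν := by
    rw [vermaRad, LieSubmodule.sSup_toSubmodule_eq_iSup]
    exact iSup₂_le fun N hN => hprop N hN
  have hmem : Verma.gen H 𝔟 K γ ∈ (vermaRad H 𝔟 K γ).toSubmodule := by
    rw [htop]; trivial
  have hdis := iSupIndep_weightSpace (H := H) (A := K) (M := Verma H 𝔟 K γ) γ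
  exact h0 (Submodule.disjoint_def.1 hdis _ (Verma.gen_mem_weightSpace γ) (hle hmem))

end VermaField

/-! ### Passage between `A` and its residue field -/

section Residue

open IsLocalRing

variable {𝔤 : Type v} [LieRing 𝔤] [LieAlgebra ℂ 𝔤] {A : Type u} [CommRing A] [IsLocalRing A]
  [Algebra ℂ A]

section Res

variable {M : Type w} [AddCommGroup M] [Module (ResidueField A) M]
  [LieRingModule (AffineOver 𝔤 (ResidueField A)) M]
  [LieModule (ResidueField A) (AffineOver 𝔤 (ResidueField A)) M]

lemma Res.act_eq (x : Affine 𝔤) (m : M) :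
    act A (Res A M) x m = (act (ResidueField A) M x m : M) := by
  refine (Res.lie_def A M ((1 : A) ⊗ₜ[ℂ] x) m).trans ?_
  rw [toResidue, LieAlgebra.ExtendScalars.map_apply_tmul, map_one]
  rfl

/-- Submodules over `A` are submodules over the residue field. -/
def Res.toResidueSubmodule (P : LieSubmodule A (AffineOver 𝔤 A) (Res A M)) :
    LieSubmodule (ResidueField A) (AffineOver 𝔤 (ResidueField A)) M :=
  lieSubmoduleOfAct
    { carrier := {m : M | (show Res A M from m) ∈ P}
      add_mem' := fun {a b} ha hb => P.toSubmodule.add_mem ha hb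
      zero_mem' := P.toSubmodule.zero_mem
      smul_mem' := fun c m hm => by
        obtain ⟨a, rfl⟩ := residue_surjective c
        exact P.toSubmodule.smul_mem a hm }
    fun x m hm => by
      have := act_mem P x hm
      rw [Res.act_eq] at this
      exact this

lemma Res.lieSpan_eq_top {m : M}
    (hm : LieSubmodule.lieSpan (ResidueField A) (AffineOver 𝔤 (ResidueField A)) {m} = ⊤) :
    LieSubmodule.lieSpan A (AffineOver 𝔤 A) {(show Res A M from m)} = ⊤ := by
  have hle : LieSubmodule.lieSpan (ResidueField A) (AffineOver 𝔤 (ResidueField A)) {m} ≤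
      Res.toResidueSubmodule (LieSubmodule.lieSpan A (AffineOver 𝔤 A) {(show Res A M from m)}) := by
    rw [LieSubmodule.lieSpan_le, Set.singleton_subset_iff]
    exact LieSubmodule.subset_lieSpan (R := A) (L := AffineOver 𝔤 A)
      (s := {(show Res A M from m)}) rfl
  rw [hm] at hle
  exact eq_top_iff.2 fun n _ => hle (LieSubmodule.mem_top (show M from n))

variable {H 𝔟 : LieSubalgebra ℂ 𝔤}
  [Algebra (SymmetricAlgebra ℂ H) A] [IsScalarTower ℂ (SymmetricAlgebra ℂ H) A]

lemma residue_char (ν : Wt H) (h : CartanHat H) :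
    residue A (char H A ν h) = char H (ResidueField A) ν h := by
  rw [char, char, map_add]
  rfl

lemma Res.mem_weightSpace {ν : Wt H} {m : M} :
    (show Res A M from m) ∈ weightSpace H A (Res A M) ν ↔
      m ∈ weightSpace H (ResidueField A) M ν := by
  rw [AffineO.mem_weightSpace, AffineO.mem_weightSpace]
  refine forall_congr' fun h => ?_
  rw [Res.act_eq, ← residue_char]
  rfl

end Res

end Residue

section ResidueAction

open IsLocalRing

variable {𝔤 : Type v} [LieRing 𝔤] [LieAlgebra ℂ 𝔤] {A : Type u} [CommRing A] [IsLocalRing A]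
  [Algebra ℂ A]
  {S : Type w} [AddCommGroup S] [Module A S] [LieRingModule (AffineOver 𝔤 A) S]
  [LieModule A (AffineOver 𝔤 A) S]

variable (𝔤 A) in
lemma toResidue_surjective : Function.Surjective (toResidue 𝔤 A) := by
  intro x
  induction x using TensorProduct.induction_on with
  | zero => exact ⟨0, map_zero _⟩
  | tmul b y =>
    obtain ⟨a, rfl⟩ := residue_surjective b
    exact ⟨a ⊗ₜ y, by simp [toResidue]⟩
  | add x y hx hy =>
    obtain ⟨x, rfl⟩ := hx
    obtain ⟨y, rfl⟩ := hy
    exact ⟨x + y, map_add _ _ _⟩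

/-- By right exactness of the tensor product, the kernel of the reduction map comes from the maximal
ideal tensored with the affine algebra. -/
lemma lie_eq_zero_of_toResidue_eq_zero (hS : ∀ a ∈ maximalIdeal A, ∀ s : S, a • s = 0)
    {x : AffineOver 𝔤 A} (hx : toResidue 𝔤 A x = 0) (s : S) : ⁅x, s⁆ = 0 := by
  let f : A →ₗ[ℂ] ResidueField A := (IsScalarTower.toAlgHom ℂ A (ResidueField A)).toLinearMap
  have hf : Function.Surjective f := residue_surjective
  have hex : Function.Exact (LinearMap.ker f).subtype f := LinearMap.exact_subtype_ker_map f
  have hx' : f.rTensor (Affine 𝔤) x = 0 := by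
    rw [← hx]
    rfl
  obtain ⟨y, rfl⟩ := (rTensor_exact (Affine 𝔤) hex hf x).1 hx'
  clear hx hx'
  induction y using TensorProduct.induction_on with
  | zero => rw [map_zero, zero_lie]
  | tmul b y =>
    rw [LinearMap.rTensor_tmul, tmul_lie]
    exact hS _ ((residue_eq_zero_iff _).1 b.2) _
  | add x y hx hy =>
    rw [map_add, add_lie, hx, hy, add_zero]

/-- A module that is killed by the maximal ideal is a module over the residue field. -/
lemma exists_residue_structure (hS : ∀ a ∈ maximalIdeal A, ∀ s : S, a • s = 0) :
    ∃ (_ : Module (ResidueField A) S) (_ : LieRingModule (AffineOver 𝔤 (ResidueField A)) S)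
      (_ : LieModule (ResidueField A) (AffineOver 𝔤 (ResidueField A)) S),
      (∀ (a : A) (s : S), residue A a • s = a • s) ∧
        ∀ (x : AffineOver 𝔤 A) (s : S), ⁅toResidue 𝔤 A x, s⁆ = ⁅x, s⁆ := by
  have htor : Module.IsTorsionBySet A S (maximalIdeal A : Set A) := fun s a => hS a a.2 s
  let iM : Module (ResidueField A) S := htor.module
  have hsm : ∀ (a : A) (s : S), residue A a • s = a • s := fun a s =>
    Module.IsTorsionBySet.mk_smul htor a s
  have hsec := Function.rightInverse_surjInv (toResidue_surjective 𝔤 A)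
  -- A merely set-theoretic section; `key` shows that the action does not depend on the choice of
  -- preimages, which yields all the axioms.
  set σ := Function.surjInv (toResidue_surjective 𝔤 A)
  have key : ∀ (x : AffineOver 𝔤 A) (s : S), ⁅σ (toResidue 𝔤 A x), s⁆ = ⁅x, s⁆ := fun x s => by
    rw [← sub_eq_zero, ← sub_lie]
    exact lie_eq_zero_of_toResidue_eq_zero hS (by rw [map_sub, hsec, sub_self]) s
  let iL : LieRingModule (AffineOver 𝔤 (ResidueField A)) S :=
    { bracket := fun x s => ⁅σ x, s⁆
      add_lie := fun x y s => by
        obtain ⟨x, rfl⟩ := toResidue_surjective 𝔤 A x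
        obtain ⟨y, rfl⟩ := toResidue_surjective 𝔤 A y
        change ⁅σ (_ + _), s⁆ = ⁅σ _, s⁆ + ⁅σ _, s⁆
        rw [← map_add, key, key, key, add_lie]
      lie_add := fun x s t => lie_add (σ x) s t
      leibniz_lie := fun x y s => by
        obtain ⟨x, rfl⟩ := toResidue_surjective 𝔤 A x
        obtain ⟨y, rfl⟩ := toResidue_surjective 𝔤 A y
        rw [← LieHom.map_lie, key, key, key, key, key, leibniz_lie] }
  have hL : ∀ (x : AffineOver 𝔤 A) (s : S), ⁅toResidue 𝔤 A x, s⁆ = ⁅x, s⁆ := key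
  refine ⟨iM, iL, ⟨fun a x s => ?_, fun a x s => ?_⟩, hsm, hL⟩
  · obtain ⟨a, rfl⟩ := residue_surjective a
    obtain ⟨x, rfl⟩ := toResidue_surjective 𝔤 A x
    rw [← toResidue_smul, hL, hL, hsm]
    exact smul_lie a x s
  · obtain ⟨a, rfl⟩ := residue_surjective a
    obtain ⟨x, rfl⟩ := toResidue_surjective 𝔤 A x
    rw [hL, hL, hsm, hsm, lie_smul]

/-- A homomorphism over the residue field is a homomorphism over `A`. -/
def Res.hom [Module (ResidueField A) S] [LieRingModule (AffineOver 𝔤 (ResidueField A)) S]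
    [LieModule (ResidueField A) (AffineOver 𝔤 (ResidueField A)) S]
    (hsm : ∀ (a : A) (s : S), residue A a • s = a • s)
    (hact : ∀ (x : Affine 𝔤) (s : S), act (ResidueField A) S x s = act A S x s)
    {M : Type w₁} [AddCommGroup M] [Module (ResidueField A) M]
    [LieRingModule (AffineOver 𝔤 (ResidueField A)) M]
    [LieModule (ResidueField A) (AffineOver 𝔤 (ResidueField A)) M]
    (g : S →ₗ⁅ResidueField A, AffineOver 𝔤 (ResidueField A)⁆ M) :
    S →ₗ⁅A, AffineOver 𝔤 A⁆ Res A M :=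
  lieModuleHomOfAct
    { toFun := fun s => (g s : M)
      map_add' := fun a b => map_add g a b
      map_smul' := fun a b => by
        rw [← hsm]
        exact map_smul g _ _ } fun x m => by
    change (g _ : M) = _
    rw [← hact, map_act]
    exact (Res.act_eq x (g m)).symm

end ResidueAction

/-! ### Simple highest weight objects -/

section SimpleObjects

open IsLocalRing

variable {𝔤 : Type v} [LieRing 𝔤] [LieAlgebra ℂ 𝔤] {H 𝔟 : LieSubalgebra ℂ 𝔤}
  [LieRing.IsNilpotent H] {A : Type u} [CommRing A] [IsLocalRing A] [Algebra ℂ A]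
  [Algebra (SymmetricAlgebra ℂ H) A] [IsScalarTower ℂ (SymmetricAlgebra ℂ H) A]
  {S : Type w} [AddCommGroup S] [Module A S] [LieRingModule (AffineOver 𝔤 A) S]
  [LieModule A (AffineOver 𝔤 A) S]

/-- The quotient map from the Verma module over the residue field to its simple quotient. -/
def Simple.proj (A : Type u) [CommRing A] [IsLocalRing A] [Algebra ℂ A]
    [Algebra (SymmetricAlgebra ℂ H) A] [IsScalarTower ℂ (SymmetricAlgebra ℂ H) A] (γ : Wt H) :
    Verma H 𝔟 (ResidueField A) γ →ₗ⁅ResidueField A, AffineOver 𝔤 (ResidueField A)⁆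
      Verma H 𝔟 (ResidueField A) γ ⧸ vermaRad H 𝔟 (ResidueField A) γ :=
  LieSubmodule.Quotient.mk' _

lemma Simple.proj_surjective (γ : Wt H) : Function.Surjective (Simple.proj (𝔟 := 𝔟) A γ) :=
  LieSubmodule.Quotient.surjective_mk' _

lemma Simple.proj_eq_zero {γ : Wt H} {m : Verma H 𝔟 (ResidueField A) γ} :
    Simple.proj A γ m = 0 ↔ m ∈ vermaRad H 𝔟 (ResidueField A) γ :=
  LieSubmodule.Quotient.mk_eq_zero'

variable (A H 𝔟) in
/-- The image of the highest weight vector. -/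
def Simple.gen (γ : Wt H) : Simple A H 𝔟 γ := Simple.proj A γ (Verma.gen H 𝔟 _ γ)

lemma Simple.gen_mem_weightSpace (γ : Wt H) :
    Simple.gen H 𝔟 A γ ∈ weightSpace H A (Simple A H 𝔟 γ) γ := by
  have h := map_mem_weightSpace (Simple.proj A γ)
    (Verma.gen_mem_weightSpace (𝔟 := 𝔟) (A := ResidueField A) γ)
  exact Res.mem_weightSpace.2 h

lemma Simple.lieSpan_gen (γ : Wt H) :
    LieSubmodule.lieSpan A (AffineOver 𝔤 A) {Simple.gen H 𝔟 A γ} = ⊤ := by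
  have h := lieSpan_map_of_surjective (Verma.lieSpan_gen (𝔟 := 𝔟) (A := ResidueField A) γ)
    (Simple.proj A γ) (Simple.proj_surjective γ)
  exact Res.lieSpan_eq_top (M := Verma H 𝔟 (ResidueField A) γ ⧸ vermaRad H 𝔟 (ResidueField A) γ) h

lemma Simple.act_letter_gen (T : Triangular H 𝔟) (γ : Wt H) {l : T.Letter} (hl : T.Pos l) :
    act A (Simple A H 𝔟 γ) (T.letter l) (Simple.gen H 𝔟 A γ) = 0 := by
  refine (Res.act_eq (T.letter l) (Simple.proj A γ (Verma.gen H 𝔟 _ γ))).trans ?_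
  rw [← map_act, Verma.act_letter_gen T γ hl, map_zero]
  rfl

lemma Simple.inOJ (T : Triangular H 𝔟) {J : Set (Wt H)} (hJ : IsOpenWt H 𝔟 J) {γ : Wt H}
    (hγ : γ ∈ J) : InOJ H 𝔟 A (Simple A H 𝔟 γ) J ∧
      ∀ ν, weightSpace H A (Simple A H 𝔟 γ) ν ≠ ⊥ → WtLE H 𝔟 ν γ :=
  T.inOJ_of_highestWeight hJ hγ (Simple.gen_mem_weightSpace γ)
    (fun _ hl => Simple.act_letter_gen T γ hl) (Simple.lieSpan_gen γ)

lemma Simple.weightSpace_le (T : Triangular H 𝔟) (γ : Wt H) :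
    weightSpace H A (Simple A H 𝔟 γ) γ ≤ Submodule.span A {Simple.gen H 𝔟 A γ} :=
  T.weightSpace_le_of_highestWeight (Simple.gen_mem_weightSpace γ)
    (fun _ hl => Simple.act_letter_gen T γ hl) (Simple.lieSpan_gen γ)

/-- The preimage in the Verma module is everything or, being proper, lies in `vermaRad`. The
quotient is allowed to be zero here; its nonvanishing is tracked separately through `Simple.gen`. -/
lemma Simple.eq_bot_or_eq_top {γ : Wt H} (N : LieSubmodule A (AffineOver 𝔤 A) (Simple A H 𝔟 γ)) :
    N = ⊥ ∨ N = ⊤ := by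
  by_cases h : (Res.toResidueSubmodule N).comap (Simple.proj A γ) = ⊤
  · refine Or.inr (eq_top_iff.2 fun n _ => ?_)
    obtain ⟨m, rfl⟩ := Simple.proj_surjective (A := A) γ n
    have : m ∈ (Res.toResidueSubmodule N).comap (Simple.proj A γ) := h ▸ LieSubmodule.mem_top m
    exact this
  · refine Or.inl (eq_bot_iff.2 fun n hn => ?_)
    obtain ⟨m, rfl⟩ := Simple.proj_surjective (A := A) γ n
    have hle : (Res.toResidueSubmodule N).comap (Simple.proj A γ) ≤
        vermaRad H 𝔟 (ResidueField A) γ := le_sSup h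
    exact Simple.proj_eq_zero.2 (hle hn)

/-- A nonzero module generated by a highest weight vector over the residue field has a simple
quotient of the same highest weight. -/
theorem exists_surjective_simple (T : Triangular H 𝔟)
    (hS : ∀ a ∈ maximalIdeal A, ∀ s : S, a • s = 0) {γ : Wt H} {s : S} (hs0 : s ≠ 0)
    (hs : s ∈ weightSpace H A S γ) (hpos : ∀ l, T.Pos l → act A S (T.letter l) s = 0)
    (hgen : LieSubmodule.lieSpan A (AffineOver 𝔤 A) {s} = ⊤) :
    Simple.gen H 𝔟 A γ ≠ 0 ∧
      ∃ f : S →ₗ⁅A, AffineOver 𝔤 A⁆ Simple A H 𝔟 γ, Function.Surjective f := by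
  obtain ⟨_, _, _, hsm, hlie⟩ := exists_residue_structure (𝔤 := 𝔤) hS
  have hact : ∀ (x : Affine 𝔤) (s : S), act (ResidueField A) S x s = act A S x s := by
    intro x s
    have := hlie ((1 : A) ⊗ₜ x) s
    rw [toResidue, LieAlgebra.ExtendScalars.map_apply_tmul, map_one] at this
    exact this
  have hsK : s ∈ weightSpace H (ResidueField A) S γ := by
    rw [mem_weightSpace] at hs ⊢
    intro h
    rw [hact, hs, ← residue_char, hsm]
  obtain ⟨f, hf⟩ := exists_hom_verma T hsK fun l hl => by rw [hact, hpos l hl]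
  -- The Verma module is nonzero because it maps to the nonzero vector `s`.
  have hgen0 : Verma.gen H 𝔟 (ResidueField A) γ ≠ 0 := by
    intro h
    rw [h, map_zero] at hf
    exact hs0 hf.symm
  have hsurj : Function.Surjective f := by
    let R : LieSubmodule A (AffineOver 𝔤 A) S := lieSubmoduleOfAct (A := A) (M := S)
      { f.range.toSubmodule.toAddSubmonoid with
        smul_mem' := fun a n hn => by
          rw [← hsm]
          exact f.range.smul_mem _ hn } fun x n hn => by
            rw [← hact]
            exact act_mem f.range x hn
    have hR : LieSubmodule.lieSpan A (AffineOver 𝔤 A) {s} ≤ R := by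
      rw [LieSubmodule.lieSpan_le, Set.singleton_subset_iff]
      exact ⟨_, hf⟩
    rw [hgen] at hR
    exact fun n => hR (LieSubmodule.mem_top n)
  have hker : f.ker ≤ vermaRad H 𝔟 (ResidueField A) γ := by
    refine le_sSup fun htop => hs0 ?_
    rw [← hf]
    exact LieModuleHom.mem_ker.1 (htop ▸ LieSubmodule.mem_top _)
  -- `S` is a quotient of the Verma module by a proper submodule, which the radical contains, so the
  -- projection to the simple quotient factors through `S`.
  obtain ⟨g, hg⟩ := LieModuleHom.exists_factor f hsurj (Simple.proj A γ) fun m hm =>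
    Simple.proj_eq_zero.2 (hker hm)
  refine ⟨fun h => vermaRad_ne_top T hgen0 ?_, ?_⟩
  · rw [eq_top_iff, ← Verma.lieSpan_gen, LieSubmodule.lieSpan_le, Set.singleton_subset_iff]
    exact Simple.proj_eq_zero.1 h
  · refine ⟨Res.hom hsm hact g, fun n => ?_⟩
    obtain ⟨m, rfl⟩ := Simple.proj_surjective (A := A) γ n
    exact ⟨f m, hg m⟩

end SimpleObjects

/-! ### Existence of projective covers -/

section SimpleQuotient

variable {𝔤 : Type v} [LieRing 𝔤] [LieAlgebra ℂ 𝔤] {H 𝔟 : LieSubalgebra ℂ 𝔤}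
  [LieRing.IsNilpotent H] {A : Type u} [CommRing A] [Algebra ℂ A]
  [Algebra (SymmetricAlgebra ℂ H) A] [IsScalarTower ℂ (SymmetricAlgebra ℂ H) A]
  {M : Type w} [AddCommGroup M] [Module A M] [LieRingModule (AffineOver 𝔤 A) M]
  [LieModule A (AffineOver 𝔤 A) M] {J : Set (Wt H)}

/-- A proper submodule of a cyclic module lies in a maximal submodule. -/
lemma exists_isCoatom_le {m : M} (hm : LieSubmodule.lieSpan A (AffineOver 𝔤 A) {m} = ⊤)
    {N : LieSubmodule A (AffineOver 𝔤 A) M} (hN : N ≠ ⊤) : ∃ N', IsCoatom N' ∧ N ≤ N' := by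
  have htop : ∀ N : LieSubmodule A (AffineOver 𝔤 A) M, N ≠ ⊤ ↔ m ∉ N := by
    refine fun N => not_congr ⟨fun h => h ▸ LieSubmodule.mem_top m, fun h => ?_⟩
    rw [eq_top_iff, ← hm, LieSubmodule.lieSpan_le, Set.singleton_subset_iff]
    exact h
  obtain ⟨N', hle, hmax⟩ := zorn_le_nonempty₀ {N : LieSubmodule A (AffineOver 𝔤 A) M | N ≠ ⊤}
    (fun c hc hchain y hy => by
      refine ⟨sSup c, (htop _).2 fun h => ?_, fun z hz => le_sSup hz⟩
      rw [← LieSubmodule.mem_toSubmodule, LieSubmodule.sSup_toSubmodule] at h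
      obtain ⟨_, ⟨z, hz, rfl⟩, hmz⟩ := (Submodule.mem_sSup_of_directed
        (s := {x | ∃ s ∈ c, LieSubmodule.toSubmodule s = x}) ⟨_, y, hy, rfl⟩ (by
        rintro _ ⟨a, ha, rfl⟩ _ ⟨b, hb, rfl⟩
        rcases hchain.total ha hb with h | h
        · exact ⟨_, ⟨b, hb, rfl⟩, h, le_rfl⟩
        · exact ⟨_, ⟨a, ha, rfl⟩, le_rfl, h⟩)).1 h
      exact (htop z).1 (hc hz) hmz) N hN
  refine ⟨N', ⟨hmax.1, fun K hK => ?_⟩, hle⟩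
  by_contra h
  exact hK.not_ge (hmax.2 h hK.le)

/-- In a module with locally bounded weights there is a highest weight vector above any weight. -/
lemma exists_highestWeight (T : Triangular H 𝔟) (hJb : IsLocallyBounded H 𝔟 J)
    (hM : ∀ ν, weightSpace H A M ν ≠ ⊥ → ν ∈ J) {μ : Wt H} (hμ : weightSpace H A M μ ≠ ⊥) :
    ∃ γ ∈ J, WtLE H 𝔟 μ γ ∧ ∃ m ∈ weightSpace H A M γ, m ≠ 0 ∧
      ∀ l, T.Pos l → act A M (T.letter l) m = 0 := by
  have hfin : {γ | weightSpace H A M γ ≠ ⊥ ∧ WtLE H 𝔟 μ γ}.Finite :=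
    (hJb μ).subset fun γ hγ => ⟨hM γ hγ.1, hγ.2⟩
  obtain ⟨γ, ⟨hγ, hμγ⟩, hmax⟩ := Set.exists_max_image _ T.ht hfin ⟨μ, hμ, WtLE.refl μ⟩
  obtain ⟨m, hm, hm0⟩ := (Submodule.ne_bot_iff _).1 hγ
  refine ⟨γ, hM γ hγ, hμγ, m, hm, hm0, fun l hl => ?_⟩
  by_contra h
  have h1 := hmax (T.letterWt l + γ) ⟨(Submodule.ne_bot_iff _).2
    ⟨_, act_mem_weightSpace (fun h => T.lie_incl_letter h l) hm, h⟩, hμγ.trans ?_⟩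
  · rw [map_add] at h1
    linarith [T.one_le_ht_of_pos hl]
  · rw [WtLE, add_sub_cancel_right]
    exact AddSubmonoid.subset_closure (T.letterWt_mem_of_pos hl)

/-- Multiplication by a scalar, as a homomorphism. -/
def homSMul (𝔤 : Type v) [LieRing 𝔤] [LieAlgebra ℂ 𝔤] (A : Type u) [CommRing A] [Algebra ℂ A]
    (M : Type w) [AddCommGroup M] [Module A M] [LieRingModule (AffineOver 𝔤 A) M] [LieModule A (AffineOver 𝔤 A) M] (a : A) :
    M →ₗ⁅A, AffineOver 𝔤 A⁆ M :=
  lieModuleHomOfAct (LinearMap.lsmul A M a) fun x m => (map_smul (act A M x) a m).symm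

variable [IsLocalRing A]

/-- Schur and Nakayama: multiplication by `a` is zero or bijective. If bijective, `m = a t` with `t`
of weight `γ`, so `t = b m` and `(1 - ab) m = 0`; but `1 - ab` is a unit. -/
lemma smul_eq_zero_of_simple (T : Triangular H 𝔟)
    (hM : ∀ N : LieSubmodule A (AffineOver 𝔤 A) M, N = ⊥ ∨ N = ⊤) {γ : Wt H} {m : M}
    (hm : m ∈ weightSpace H A M γ) (hm0 : m ≠ 0)
    (hpos : ∀ l, T.Pos l → act A M (T.letter l) m = 0)
    (hgen : LieSubmodule.lieSpan A (AffineOver 𝔤 A) {m} = ⊤) {a : A}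
    (ha : a ∈ IsLocalRing.maximalIdeal A) (n : M) : a • n = 0 := by
  rcases hM (homSMul 𝔤 A M a).ker with h | h
  · exfalso
    have hinj : Function.Injective (homSMul 𝔤 A M a) := (LieModuleHom.ker_eq_bot _).1 h
    rcases hM (homSMul 𝔤 A M a).range with h' | h'
    · have h0 : homSMul 𝔤 A M a m ∈ (homSMul 𝔤 A M a).range := ⟨m, rfl⟩
      rw [h', LieSubmodule.mem_bot] at h0
      exact hm0 (hinj (h0.trans (map_zero _).symm))
    · obtain ⟨t, ht⟩ := (LieModuleHom.range_eq_top _).1 h' m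
      have htγ : t ∈ weightSpace H A M γ := mem_weightSpace_of_injective _ hinj (ht ▸ hm)
      obtain ⟨b, rfl⟩ := Submodule.mem_span_singleton.1
        (T.weightSpace_le_of_highestWeight hm hpos hgen htγ)
      change a • b • m = m at ht
      have hu : IsUnit (1 - a * b) := by
        by_contra hu
        have h2 := Ideal.add_mem _ ((IsLocalRing.mem_maximalIdeal _).2 hu)
          (Ideal.mul_mem_right b _ ha)
        rw [sub_add_cancel] at h2
        exact (IsLocalRing.mem_maximalIdeal _).1 h2 isUnit_one
      refine hm0 ((hu.smul_eq_zero).1 ?_)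
      rw [sub_smul, one_smul, mul_smul, ht, sub_self]
  · exact LieModuleHom.mem_ker.1 (h ▸ LieSubmodule.mem_top n : n ∈ (homSMul 𝔤 A M a).ker)

/-- A simple object with a nonzero weight space of weight `μ` maps onto a simple highest weight
module of weight at least `μ`. -/
lemma exists_surjective_simple_of_simple (T : Triangular H 𝔟) (hJb : IsLocallyBounded H 𝔟 J)
    (hM : ∀ ν, weightSpace H A M ν ≠ ⊥ → ν ∈ J)
    (hS : ∀ N : LieSubmodule A (AffineOver 𝔤 A) M, N = ⊥ ∨ N = ⊤)
    {μ : Wt H} (hμ : weightSpace H A M μ ≠ ⊥) :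
    ∃ γ ∈ J, WtLE H 𝔟 μ γ ∧ Simple.gen H 𝔟 A γ ≠ 0 ∧
      ∃ f : M →ₗ⁅A, AffineOver 𝔤 A⁆ Simple A H 𝔟 γ, Function.Surjective f := by
  obtain ⟨γ, hγ, hμγ, m, hm, hm0, hpos⟩ := exists_highestWeight T hJb hM hμ
  have hgen : LieSubmodule.lieSpan A (AffineOver 𝔤 A) {m} = ⊤ := by
    refine (hS _).resolve_left fun h => hm0 ?_
    rw [← LieSubmodule.mem_bot (R := A) (L := AffineOver 𝔤 A), ← h]
    exact LieSubmodule.subset_lieSpan rfl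
  exact ⟨γ, hγ, hμγ, exists_surjective_simple T
    (fun a ha n => smul_eq_zero_of_simple T hS hm hm0 hpos hgen ha n) hm0 hm hpos hgen⟩

/-- A nonzero homomorphism to a simple object is surjective. -/
lemma Simple.surjective_of_ne_zero {γ : Wt H} (f : M →ₗ⁅A, AffineOver 𝔤 A⁆ Simple A H 𝔟 γ)
    {m : M} (hm : f m ≠ 0) : Function.Surjective f := by
  refine (LieModuleHom.range_eq_top _).1 ((Simple.eq_bot_or_eq_top _).resolve_left fun h => hm ?_)
  have : f m ∈ f.range := ⟨m, rfl⟩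
  rwa [h, LieSubmodule.mem_bot] at this

lemma Simple.wtLE_of_surjective (T : Triangular H 𝔟) (hJ : IsOpenWt H 𝔟 J) {μ γ : Wt H}
    (hμ : μ ∈ J) (hγ : Simple.gen H 𝔟 A γ ≠ 0)
    (f : Simple A H 𝔟 μ →ₗ⁅A, AffineOver 𝔤 A⁆ Simple A H 𝔟 γ) (hf : Function.Surjective f) :
    WtLE H 𝔟 γ μ := by
  obtain ⟨h1, h2⟩ := Simple.inOJ (A := A) T hJ hμ
  obtain ⟨m, hm, hmγ⟩ := h1.isWeightModule.exists_lift f hf (Simple.gen_mem_weightSpace γ)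
  refine h2 γ ((Submodule.ne_bot_iff _).2 ⟨m, hm, fun h => hγ ?_⟩)
  rw [← hmγ, h, map_zero]

end SimpleQuotient

/-! ### Splitting off projective covers by idempotents -/

section Covers

variable {𝔤 : Type v} [LieRing 𝔤] [LieAlgebra ℂ 𝔤] {H 𝔟 : LieSubalgebra ℂ 𝔤}
  [LieRing.IsNilpotent H] {A : Type u} [CommRing A] [Algebra ℂ A]
  [Algebra (SymmetricAlgebra ℂ H) A] [IsScalarTower ℂ (SymmetricAlgebra ℂ H) A]
  [IsNoetherianRing A] {J : Set (Wt H)} {μ : Wt H}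

/-- The corestriction of an endomorphism to its range. -/
def toRange {M : Type w} [AddCommGroup M] [Module A M] [LieRingModule (AffineOver 𝔤 A) M]
    [LieModule A (AffineOver 𝔤 A) M] (e : M →ₗ⁅A, AffineOver 𝔤 A⁆ M) :
    M →ₗ⁅A, AffineOver 𝔤 A⁆ e.range :=
  lieModuleHomOfAct (LinearMap.codRestrict e.range.toSubmodule (e : M →ₗ[A] M) fun m => ⟨m, rfl⟩)
    fun x m => Subtype.ext (map_act e x m)

/-- Direct summands of the objects that represent the weight space functors are projective. -/
lemma isProjectiveInOJ_range (T : Triangular H 𝔟) (hJb : IsLocallyBounded H 𝔟 J)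
    {e : WeightObj H A J μ →ₗ⁅A, AffineOver 𝔤 A⁆ WeightObj H A J μ}
    (he : ∀ x, e (e x) = e x) : IsProjectiveInOJ.{u, v, w} H 𝔟 A J e.range := by
  refine ⟨(weightObj_inOJ T hJb μ).1.of_injective e.range.incl e.range.injective_incl, ?_⟩
  intro M N _ _ _ _ _ _ _ _ hM _ f hf h
  obtain ⟨k, hk⟩ := exists_lift_weightObj hM f hf (h.comp (toRange e))
  refine ⟨k.comp e.range.incl, LieModuleHom.ext ?_⟩
  rintro ⟨_, x, rfl⟩
  have h1 := LieModuleHom.congr_fun hk (e x)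
  have h2 : toRange e (e x) = ⟨e x, x, rfl⟩ := Subtype.ext (he x)
  rw [LieModuleHom.comp_apply, LieModuleHom.comp_apply, h2] at h1
  exact h1

variable [IsLocalRing A]

/-- If the idempotent `e` splits off a summand through which `c₀` factors, and `c₀` is onto on
a proper submodule of this summand, then a smaller summand has the same property. -/
theorem exists_smaller_idempotent (T : Triangular H 𝔟) (hJo : IsOpenWt H 𝔟 J)
    (hJb : IsLocallyBounded H 𝔟 J) (hμ : μ ∈ J)
    (ih : ∀ γ ∈ J, WtLE H 𝔟 μ γ → γ ≠ μ →
      ∃ (P : Type (max u v)) (_ : AddCommGroup P) (_ : Module A P)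
        (_ : LieRingModule (AffineOver 𝔤 A) P) (_ : LieModule A (AffineOver 𝔤 A) P)
        (c : P →ₗ⁅A, AffineOver 𝔤 A⁆ Simple A H 𝔟 γ),
        IsProjectiveCover.{u, v, max u v} H 𝔟 A J c)
    {c₀ : WeightObj H A J μ →ₗ⁅A, AffineOver 𝔤 A⁆ Simple A H 𝔟 μ}
    (hc₀ : c₀ (Cyc.gen _) = Simple.gen H 𝔟 A μ)
    {e : WeightObj H A J μ →ₗ⁅A, AffineOver 𝔤 A⁆ WeightObj H A J μ}
    (he : ∀ x, e (e x) = e x) (hce : ∀ x, c₀ (e x) = c₀ x)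
    {M : LieSubmodule A (AffineOver 𝔤 A) e.range} (hM : M ≠ ⊤)
    (hcM : ∀ y, ∃ m ∈ M, c₀ (m : WeightObj H A J μ) = y) :
    ∃ e' : WeightObj H A J μ →ₗ⁅A, AffineOver 𝔤 A⁆ WeightObj H A J μ,
      (∀ x, e' (e' x) = e' x) ∧ (∀ x, c₀ (e' x) = c₀ x) ∧ (∀ x, e x = 0 → e' x = 0) ∧
        ∃ x ∈ weightSpace H A (WeightObj H A J μ) μ, e' x = 0 ∧ e x ≠ 0 := by
  set q : WeightObj H A J μ := Cyc.gen _ with hq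
  have hqμ : q ∈ weightSpace H A (WeightObj H A J μ) μ := gen_mem_weightObj J μ
  have hqgen : LieSubmodule.lieSpan A (AffineOver 𝔤 A) {q} = ⊤ := Cyc.lieSpan_gen _
  have hPJ : InOJ H 𝔟 A e.range J :=
    (isProjectiveInOJ_range.{u, v, 0} T hJb he).1
  have hesurj : Function.Surjective (toRange e) := by
    rintro ⟨_, x, rfl⟩
    exact ⟨x, rfl⟩
  have hecoe : ∀ y : e.range, toRange e (y : WeightObj H A J μ) = y := by
    rintro ⟨_, x, rfl⟩
    exact Subtype.ext (he x)
  have hPgen := lieSpan_map_of_surjective hqgen (toRange e) hesurj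
  -- a simple quotient
  obtain ⟨M', hM', hMM'⟩ := exists_isCoatom_le hPgen hM
  let π : e.range →ₗ⁅A, AffineOver 𝔤 A⁆ e.range ⧸ M' := LieSubmodule.Quotient.mk' M'
  have hπ : Function.Surjective π := LieSubmodule.Quotient.surjective_mk' M'
  have hπM : ∀ y, π y = 0 ↔ y ∈ M' := fun y => LieSubmodule.Quotient.mk_eq_zero'
  have hSJ : InOJ H 𝔟 A (e.range ⧸ M') J := hPJ.of_surjective π hπ
  have hSsimple : ∀ N : LieSubmodule A (AffineOver 𝔤 A) (e.range ⧸ M'), N = ⊥ ∨ N = ⊤ := by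
    intro N
    have hle : M' ≤ N.comap π := fun y hy => by
      rw [LieSubmodule.mem_comap, (hπM y).2 hy]; exact zero_mem _
    rcases hle.eq_or_lt with h | h
    · refine Or.inl (eq_bot_iff.2 fun n hn => ?_)
      obtain ⟨y, rfl⟩ := hπ n
      exact (hπM y).2 (h ▸ hn)
    · refine Or.inr (eq_top_iff.2 fun n _ => ?_)
      obtain ⟨y, rfl⟩ := hπ n
      have : y ∈ N.comap π := (hM'.2 _ h) ▸ LieSubmodule.mem_top y
      exact this
  have hSμ : weightSpace H A (e.range ⧸ M') μ ≠ ⊥ := by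
    refine (Submodule.ne_bot_iff _).2 ⟨π (toRange e q),
      map_mem_weightSpace π (map_mem_weightSpace (toRange e) hqμ), fun h => hM'.1 ?_⟩
    rw [eq_top_iff, ← hPgen, LieSubmodule.lieSpan_le, Set.singleton_subset_iff]
    exact (hπM _).1 h
  obtain ⟨γ, hγ, hμγ, hγ0, f, hf⟩ :=
    exists_surjective_simple_of_simple T hJb hSJ.weight_mem hSsimple hSμ
  let p : e.range →ₗ⁅A, AffineOver 𝔤 A⁆ Simple A H 𝔟 γ := f.comp π
  have hp : Function.Surjective p := hf.comp hπ
  have hpM : ∀ y ∈ M, p y = 0 := fun y hy => by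
    change f (π y) = 0
    rw [(hπM y).2 (hMM' hy), map_zero]
  -- the weight of the quotient is not `μ`
  have hγμ : γ ≠ μ := by
    rintro rfl
    -- Both `p ∘ e` and `c₀` send the generator into the same weight space, spanned by `Simple.gen`,
    -- so the former is `a • c₀`. On `M` the map `p` vanishes while `c₀` is onto; hence `a` kills
    -- the simple object and `p = 0`.
    obtain ⟨a, ha⟩ := Submodule.mem_span_singleton.1 (Simple.weightSpace_le T γ
      (map_mem_weightSpace (p.comp (toRange e)) hqμ))
    have hpa : p.comp (toRange e) = a • c₀ :=
      hom_ext_of_lieSpan hqgen (by rw [LieModuleHom.smul_apply, hc₀, ha])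
    have ha0 : ∀ y : Simple A H 𝔟 γ, a • y = 0 := by
      intro y
      obtain ⟨m, hm, rfl⟩ := hcM y
      have := LieModuleHom.congr_fun hpa (m : WeightObj H A J γ)
      rw [LieModuleHom.comp_apply, hecoe, hpM m hm] at this
      exact this.symm
    obtain ⟨y, hy⟩ := hp (Simple.gen H 𝔟 A γ)
    have := LieModuleHom.congr_fun hpa (y : WeightObj H A J γ)
    rw [LieModuleHom.comp_apply, hecoe, hy, LieModuleHom.smul_apply, ha0] at this
    exact hγ0 this
  -- split off the projective cover of the simple quotient
  obtain ⟨P, _, _, _, _, c, hc⟩ := ih γ hγ hμγ hγμ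
  obtain ⟨t, ht⟩ := (isProjectiveInOJ_range.{u, v, max u v} T hJb he).2 P (Simple A H 𝔟 γ)
    hc.isProjective.1 hc.mem_target c hc.surjective p
  have htsurj : Function.Surjective t := hc.essential e.range hPJ t (by rw [ht]; exact hp)
  obtain ⟨s, hs⟩ := hc.isProjective.2 e.range P hPJ hc.isProjective.1 t htsurj LieModuleHom.id
  have hts : ∀ y, t (s y) = y := fun y => LieModuleHom.congr_fun hs y
  -- Otherwise `P` maps onto L(μ) by `g`. The image of `ker g` in L(γ) is zero or everything. If
  -- everything, `ker g = P` by essentiality, which is absurd. If zero, L(μ) maps onto L(γ), giving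
  -- `γ ≤ μ` and so `γ = μ`.
  have hcs : ∀ y, c₀ (s y : WeightObj H A J μ) = 0 := by
    by_contra! hne
    obtain ⟨y₀, hy₀⟩ := hne
    let g : P →ₗ⁅A, AffineOver 𝔤 A⁆ Simple A H 𝔟 μ := (c₀.comp e.range.incl).comp s
    have hg : Function.Surjective g := Simple.surjective_of_ne_zero g hy₀
    have hker : ∀ y, g y = 0 → c y = 0 := by
      rcases Simple.eq_bot_or_eq_top (g.ker.map c) with h | h
      · intro y hy
        have : c y ∈ g.ker.map c := LieSubmodule.mem_map_of_mem (LieModuleHom.mem_ker.2 hy)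
        rwa [h, LieSubmodule.mem_bot] at this
      · exfalso
        have := hc.essential g.ker (hc.isProjective.1.of_injective g.ker.incl
          g.ker.injective_incl) g.ker.incl (fun z => by
            have hz : z ∈ g.ker.map c := h ▸ LieSubmodule.mem_top z
            obtain ⟨y, hy, rfl⟩ := (LieSubmodule.mem_map _).1 hz
            exact ⟨⟨y, hy⟩, rfl⟩) y₀
        obtain ⟨⟨y, hy⟩, rfl⟩ := this
        exact hy₀ (LieModuleHom.mem_ker.1 hy)
    obtain ⟨k, hk⟩ := LieModuleHom.exists_factor g hg c hker
    refine hγμ (T.wtLE_antisymm (Simple.wtLE_of_surjective T hJo hμ hγ0 k fun z => ?_) hμγ)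
    obtain ⟨y, rfl⟩ := hc.surjective z
    exact ⟨g y, hk y⟩
  let τ : WeightObj H A J μ →ₗ⁅A, AffineOver 𝔤 A⁆ P := t.comp (toRange e)
  let σ : P →ₗ⁅A, AffineOver 𝔤 A⁆ WeightObj H A J μ := e.range.incl.comp s
  have hτσ : ∀ y, τ (σ y) = y := fun y => by
    change t (toRange e (s y : WeightObj H A J μ)) = y
    rw [hecoe, hts]
  have hcσ : ∀ y, c₀ (σ y) = 0 := hcs
  have heσ : ∀ y, e (σ y) = σ y := fun y => congrArg Subtype.val (hecoe (s y))
  have hτe : ∀ x, τ (e x) = τ x := fun x => congrArg t (hecoe (toRange e x))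
  -- `σ ∘ τ` is an idempotent below `e` with image the copy of `P`; subtracting it leaves the
  -- complementary summand. The vector `q - e' q` witnesses the strict growth of the kernel, since
  -- `e` sends it to `σ (τ q)`, which is nonzero as `P` is.
  let e' : WeightObj H A J μ →ₗ⁅A, AffineOver 𝔤 A⁆ WeightObj H A J μ := e - σ.comp τ
  have he' : ∀ x, e' x = e x - σ (τ x) := fun x => rfl
  have hee' : ∀ x, e (e' x) = e' x := fun x => by rw [he', map_sub, he, heσ]
  have hτe' : ∀ x, τ (e' x) = 0 := fun x => by rw [he', map_sub, hτe, hτσ, sub_self]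
  have he'e' : ∀ x, e' (e' x) = e' x := fun x => by
    rw [he' (e' x), hee', hτe', map_zero, sub_zero]
  refine ⟨e', he'e', fun x => by rw [he', map_sub, hce, hcσ, sub_zero], fun x hx => ?_,
    q - e' q, Submodule.sub_mem _ hqμ (map_mem_weightSpace e' hqμ), ?_, fun h => ?_⟩
  · rw [he', hx, ← hτe, hx, map_zero, map_zero, sub_zero]
  · rw [map_sub, he'e', sub_self]
  · rw [map_sub, hee', he', sub_sub_cancel] at h
    have hτq : τ q = 0 := by rw [← hτσ (τ q), h, map_zero]
    have hτ0 : τ = 0 := hom_ext_of_lieSpan hqgen hτq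
    obtain ⟨y, hy⟩ := hc.surjective (Simple.gen H 𝔟 A γ)
    refine hγ0 ?_
    rw [← hy, ← hτσ y, hτ0, LieModuleHom.zero_apply, map_zero]

/-- The projective covers of the simple objects exist. -/
theorem exists_projectiveCover (T : Triangular H 𝔟) (hJo : IsOpenWt H 𝔟 J)
    (hJb : IsLocallyBounded H 𝔟 J) (n : ℕ) : ∀ μ ∈ J, {γ ∈ J | WtLE H 𝔟 μ γ}.ncard = n →
      ∃ (P : Type (max u v)) (_ : AddCommGroup P) (_ : Module A P)
        (_ : LieRingModule (AffineOver 𝔤 A) P) (_ : LieModule A (AffineOver 𝔤 A) P)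
        (c : P →ₗ⁅A, AffineOver 𝔤 A⁆ Simple A H 𝔟 μ),
        IsProjectiveCover.{u, v, w} H 𝔟 A J c ∧ IsProjectiveCover.{u, v, max u v} H 𝔟 A J c := by
  induction n using Nat.strong_induction_on with
  | _ n ihn =>
  intro μ hμ hn
  have hL := (Simple.inOJ (A := A) T hJo hμ).1
  -- Fewer weights lie above `γ`, because `μ` no longer does. The induction tests essentiality and
  -- projectivity on submodules and summands of the representing objects, hence the second universe
  -- in the conclusion.
  have ih : ∀ γ ∈ J, WtLE H 𝔟 μ γ → γ ≠ μ →
      ∃ (P : Type (max u v)) (_ : AddCommGroup P) (_ : Module A P)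
        (_ : LieRingModule (AffineOver 𝔤 A) P) (_ : LieModule A (AffineOver 𝔤 A) P)
        (c : P →ₗ⁅A, AffineOver 𝔤 A⁆ Simple A H 𝔟 γ),
        IsProjectiveCover.{u, v, max u v} H 𝔟 A J c := by
    intro γ hγ hμγ hne
    obtain ⟨P, i₁, i₂, i₃, i₄, c, -, hc⟩ := ihn _ (by
      rw [← hn]
      refine Set.ncard_lt_ncard ⟨fun κ hκ => ⟨hκ.1, hμγ.trans hκ.2⟩, fun h => hne ?_⟩ (hJb μ)
      exact T.wtLE_antisymm (h ⟨hμ, WtLE.refl μ⟩).2 hμγ) γ hγ rfl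
    exact ⟨P, i₁, i₂, i₃, i₄, c, hc⟩
  obtain ⟨c₀, hc₀⟩ := exists_hom_weightObj hL (Simple.gen_mem_weightSpace μ)
  have hc₀surj : Function.Surjective c₀ :=
    surjective_of_mem_range (Simple.lieSpan_gen μ) c₀ ⟨_, hc₀⟩
  have : IsNoetherian A (weightSpace H A (WeightObj H A J μ) μ) :=
    isNoetherian_of_fg_of_noetherian _ ((weightObj_inOJ T hJb μ).2 μ)
  let K : (WeightObj H A J μ →ₗ⁅A, AffineOver 𝔤 A⁆ WeightObj H A J μ) →
      Submodule A (weightSpace H A (WeightObj H A J μ) μ) := fun e =>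
    e.ker.toSubmodule.comap (weightSpace H A (WeightObj H A J μ) μ).subtype
  -- Minimality for the reversed order picks a maximal kernel in the weight space `μ`; the identity
  -- shows that there is a candidate.
  obtain ⟨_, ⟨e, ⟨he, hce⟩, rfl⟩, hmax⟩ := wellFounded_gt.has_min
    (K '' {e | (∀ x, e (e x) = e x) ∧ ∀ x, c₀ (e x) = c₀ x})
    ⟨_, LieModuleHom.id, ⟨fun _ => rfl, fun _ => rfl⟩, rfl⟩
  have hess : ∀ M : LieSubmodule A (AffineOver 𝔤 A) e.range,
      (∀ y, ∃ m ∈ M, c₀ (m : WeightObj H A J μ) = y) → M = ⊤ := by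
    intro M hcM
    by_contra hM
    obtain ⟨e', he', hce', hle, x, hx, hx', hxe⟩ :=
      exists_smaller_idempotent T hJo hJb hμ ih hc₀ he hce hM hcM
    refine hmax (K e') ⟨e', ⟨he', hce'⟩, rfl⟩ (lt_of_le_not_ge (fun y hy => ?_) fun h => hxe ?_)
    · exact LieModuleHom.mem_ker.2 (hle _ (LieModuleHom.mem_ker.1 hy))
    · exact LieModuleHom.mem_ker.1 (@h ⟨x, hx⟩ (LieModuleHom.mem_ker.2 hx'))
  have hcsurj : Function.Surjective (c₀.comp e.range.incl) := fun y => by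
    obtain ⟨x, rfl⟩ := hc₀surj y
    exact ⟨⟨e x, x, rfl⟩, hce x⟩
  refine ⟨e.range, inferInstance, inferInstance, inferInstance, inferInstance,
    c₀.comp e.range.incl, ⟨isProjectiveInOJ_range T hJb he, hL, hcsurj, ?_⟩,
    ⟨isProjectiveInOJ_range T hJb he, hL, hcsurj, ?_⟩⟩ <;>
  · intro M _ _ _ _ _ g hg
    refine (LieModuleHom.range_eq_top _).1 (hess _ fun y => ?_)
    obtain ⟨m, hm⟩ := hg y
    exact ⟨g m, ⟨m, rfl⟩, hm⟩

end Covers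

end AffineO

end

theorem mainTheorem1 {𝔤 : Type v} [LieRing 𝔤] [LieAlgebra ℂ 𝔤]
    [FiniteDimensional ℂ 𝔤] [LieAlgebra.IsSimple ℂ 𝔤]
    (H : LieSubalgebra ℂ 𝔤) [H.IsCartanSubalgebra]
    (𝔟 : LieSubalgebra ℂ 𝔤) (h𝔟 : AffineO.IsBorel 𝔟) (hH : H ≤ 𝔟)
    (A : Type u) [CommRing A] [Algebra ℂ A] [Algebra (SymmetricAlgebra ℂ H) A]
    [IsScalarTower ℂ (SymmetricAlgebra ℂ H) A] [IsNoetherianRing A] [IsLocalRing A]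
    (J : Set (AffineO.Wt H)) (hJo : AffineO.IsOpenWt H 𝔟 J)
    (hJb : AffineO.IsLocallyBounded H 𝔟 J) (μ : AffineO.Wt H) (hμ : μ ∈ J) :
    ∃ (P : Type (max u v)) (_ : AddCommGroup P) (_ : Module A P)
      (_ : LieRingModule (AffineO.AffineOver 𝔤 A) P)
      (_ : LieModule A (AffineO.AffineOver 𝔤 A) P)
      (c : P →ₗ⁅A, AffineO.AffineOver 𝔤 A⁆ AffineO.Simple A H 𝔟 μ),
      AffineO.IsProjectiveCover.{u, v, w} H 𝔟 A J c := by
  obtain ⟨T⟩ := AffineO.exists_triangular h𝔟 hH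
  obtain ⟨P, i₁, i₂, i₃, i₄, c, hc, -⟩ :=
    AffineO.exists_projectiveCover.{u, v, w} (A := A) T hJo hJb _ μ hμ rfl
  exact ⟨P, i₁, i₂, i₃, i₄, c, hc⟩
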